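/- **Navier–Stokes limit of the ES-BGK model with discrete vibrational energy.** *Model.* Let $R,T_0,\delta>0$, $e_{tr}(T)=\frac32RT$, $e_{rot}(T)=\frac\delta2RT$, $e_{vib}(T)=\frac{RT_0}{\exp(T_0/T)-1}$, $e_{tr,rot}=e_{tr}+e_{rot}$, $e=e_{tr}+e_{rot}+e_{vib}$ for $T>0$; inverses of these increasing functions are written $e_{tr}^{-1}$, etc. For $\phi(v,\varepsilon,i)$, $v\in\mathbb R^3$, $\varepsilon>0$, $i\in\mathbb N$, let $\langle\phi\rangle=\sum_{i\ge0}\int_{\mathbb R^3}\int_0^\infty\phi\,d\varepsilon\,dv$. A distribution $f\ge 0$ has the moments $\rho=\langle f\rangle$, $\rho u=\langle vf\rangle$, $\rho E_{tr}=\langle\frac12|v-u|^2f\rangle$, $\rho E_{rot}=\langle\varepsilon f\rangle$, $\rho E_{vib}=\langle iRT_0f\rangle$, $E=E_{tr}+E_{rot}+E_{vib}$, $\Sigma(f)=\rho\Theta=\langle(v-u)\otimes(v-u)f\rangle$, $q(f)=\langle(\frac12|v-u|^2+\varepsilon+iRT_0)(v-u)f\rangle$, $\mathcal E=\langle(\frac12|v|^2+\varepsilon+iRT_0)f\rangle$,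 and the temperatures $T_{tr}=e_{tr}^{-1}(E_{tr})$, $T_{tr,rot}=e_{tr,rot}^{-1}(E_{tr}+E_{rot})$, $T_{eq}=e^{-1}(E)$. The relaxation time $\tau>0$ and the parameters $0<\Gamma<1$, $0\le\theta<1$, $-\frac12\le\nu<1$ are constants or, more generally, smooth functions of $(\rho,T_{eq})\in(0,\infty)^2$. The Gaussian is $$\mathcal G[f]=\frac{\rho}{\sqrt{\det(2\pi\Pi)}}e^{-\frac12(v-u)^T\Pi^{-1}(v-u)}\cdot\frac{\varepsilon^{\frac{\delta-2}2}e^{-\varepsilon/(RT_{rot}^{rel})}}{\mathbf\Gamma(\frac\delta2)(RT_{rot}^{rel})^{\delta/2}}\cdot\bigl(1-e^{-T_0/T_{vib}^{rel}}\bigr)e^{-iT_0/T_{vib}^{rel}},$$ where $\mathbf\Gamma$ is the gamma function, $\Pi=\Gamma RT_{eq}I+(1-\Gamma)[\theta RT_{tr,rot}I+(1-\theta)(\nu\Theta+(1-\nu)RT_{tr}I)]$, $T_{rot}^{rel}=e_{rot}^{-1}\bigl(\Gamma e_{rot}(T_{eq})+(1-\Gamma)[\theta e_{rot}(T_{tr,rot})+(1-\theta)E_{rot}]\bigr)$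 and $T_{vib}^{rel}=e_{vib}^{-1}\bigl(\Gamma e_{vib}(T_{eq})+(1-\Gamma)E_{vib}\bigr)$. *Assumptions.* Let $\Omega\subset\mathbb R_t\times\mathbb R^3_x$ be open and, for $0<\mathrm{Kn}<\mathrm{Kn}_0$, let $f=f_{\mathrm{Kn}}\ge0$, smooth in $(t,x)\in\Omega$ and measurable in $(v,\varepsilon,i)$, solve the non-dimensional equation $$\partial_tf+v\cdot\nabla f=\frac1{\mathrm{Kn}\,\tau}(\mathcal G[f]-f)\quad\text{on }\Omega .$$ Suppose that $f$ and its time and space derivatives are $O(1)$ with respect to $\mathrm{Kn}$, in the sense that for every order $k$ and every $m$ the moment $\langle(1+|v|^2+\varepsilon+i)^m|D^k_{t,x}f|\rangle$ is bounded uniformly in $\mathrm{Kn}$ and $(t,x)\in\Omega$, and that $\rho$ and $T_{eq}$ are bounded below by a positive constant, uniformly in $\mathrm{Kn}$ and $(t,x)\in\Omega$. *Notation for the coefficients.* Put $p=\rho RT_{eq}$, $h=e(T_{eq})+p/\rho$, $c_v=e'(T_{eq})$, $c_p=\partial h/\partial T_{eq}$, $\gamma=1+R/c_v$, $\gamma_{mono}=\frac53$,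 $\gamma_{rot}=\frac{5+\delta}{3+\delta}$, and $$\mu=\frac{\tau p}{1-(1-\Gamma)(1-\theta)\nu},\qquad\kappa=\bigl(1-(1-\Gamma)(1-\theta)\nu\bigr)\mu c_p,$$ $$\alpha=(\gamma-1)-\frac{(1-\Gamma)(1-\theta)(1-\nu)}{1-(1-\Gamma)(1-\theta)}(\gamma_{mono}-\gamma_{rot})-\frac{(1-\Gamma)(1-(1-\theta)\nu)}{\Gamma}(\gamma_{rot}-\gamma),$$ $$\sigma=-\mu\bigl(\nabla u+(\nabla u)^T-\alpha(\nabla\cdot u)I\bigr),\qquad q=-\kappa\nabla T_{eq}.$$ *Conclusion.* The fields $\rho,u,T_{eq},\mathcal E$ are smooth on $\Omega$. Uniformly on $\Omega$ (that is, with one constant for all $0<\mathrm{Kn}<\mathrm{Kn}_0$ and all points of $\Omega$) the stress tensor and the heat flux of $f$ satisfy $$\Sigma(f)=pI+\mathrm{Kn}\,\sigma+O(\mathrm{Kn}^2),\qquad q(f)=\mathrm{Kn}\,q+O(\mathrm{Kn}^2),$$ and the moments of $f$ satisfy the compressible Navier–Stokes equations up to $O(\mathrm{Kn}^2)$: $$\partial_t\rho+\nabla\cdot(\rho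 u)=O(\mathrm{Kn}^2),$$ $$\partial_t(\rho u)+\nabla\cdot(\rho u\otimes u)+\nabla p=-\nabla\cdot(\mathrm{Kn}\,\sigma)+O(\mathrm{Kn}^2),$$ $$\partial_t\mathcal E+\nabla\cdot((\mathcal E+p)u)=-\nabla\cdot(\mathrm{Kn}\,q)-\nabla\cdot(\mathrm{Kn}\,\sigma u)+O(\mathrm{Kn}^2).$$ (In dimensional form the factor $\mathrm{Kn}$ is absorbed in the relaxation time $\tau$, so that $\mu$, $\kappa$, $\alpha$ are the dimensional coefficients.) The Prandtl number is $\mathrm{Pr}=\dfrac{\mu c_p}{\kappa}=\dfrac1{1-(1-\Gamma)(1-\theta)\nu}$. -/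

import Mathlib

open scoped ContDiff

noncomputable section

namespace ESBGK

/-- Vectors of `ℝ³` with the Euclidean norm. -/
abbrev Vec : Type := EuclideanSpace ℝ (Fin 3)

/-- Space-time points `(t, x)`. -/
abbrev SpaceTime : Type := ℝ × Vec

/-- Microscopic states `(v, ε, i)`: velocity, rotational energy, vibrational level. -/
abbrev Micro : Type := Vec × ℝ × ℕ

/-- `dv dε` on `ℝ³ × (0, ∞)` times the counting measure in `i`; rotational energies are positive. -/
def microMeasure : MeasureTheory.Measure Micro :=
  (MeasureTheory.volume : MeasureTheory.Measure Vec).prod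
    (((MeasureTheory.volume : MeasureTheory.Measure ℝ).restrict (Set.Ioi 0)).prod
      MeasureTheory.Measure.count)

/-- The bracket `⟨φ⟩ = ∑ᵢ ∫∫ φ(v, ε, i) dε dv`. -/
def bracket (φ : Micro → ℝ) : ℝ := ∫ y, φ y ∂microMeasure

/-! ### Data of the model -/

/-- Physical constants and parameters of the model. The relaxation time `τ` and the parameters
`Γ, θ, ν` are smooth functions of the pair (density, equilibrium temperature); constant parameters
are the constant functions. -/
structure Params where
  /-- gas constant -/
  R : ℝ
  /-- characteristic temperature of vibration -/
  T₀ : ℝ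
  /-- number of rotational degrees of freedom -/
  δ : ℝ
  /-- relaxation time -/
  τ : ℝ × ℝ → ℝ
  /-- exchange between translation-rotation and vibration -/
  Γ : ℝ × ℝ → ℝ
  /-- exchange between translation and rotation -/
  θ : ℝ × ℝ → ℝ
  /-- relaxation of the directional temperatures -/
  ν : ℝ × ℝ → ℝ
  R_pos : 0 < R
  T₀_pos : 0 < T₀
  δ_pos : 0 < δ
  τ_pos : ∀ s ∈ Set.Ioi (0 : ℝ) ×ˢ Set.Ioi (0 : ℝ), 0 < τ s
  Γ_mem : ∀ s ∈ Set.Ioi (0 : ℝ) ×ˢ Set.Ioi (0 : ℝ), 0 < Γ s ∧ Γ s < 1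
  θ_mem : ∀ s ∈ Set.Ioi (0 : ℝ) ×ˢ Set.Ioi (0 : ℝ), 0 ≤ θ s ∧ θ s < 1
  ν_mem : ∀ s ∈ Set.Ioi (0 : ℝ) ×ˢ Set.Ioi (0 : ℝ), -(1 / 2) ≤ ν s ∧ ν s < 1
  τ_smooth : ContDiffOn ℝ ∞ τ (Set.Ioi (0 : ℝ) ×ˢ Set.Ioi (0 : ℝ))
  Γ_smooth : ContDiffOn ℝ ∞ Γ (Set.Ioi (0 : ℝ) ×ˢ Set.Ioi (0 : ℝ))
  θ_smooth : ContDiffOn ℝ ∞ θ (Set.Ioi (0 : ℝ) ×ˢ Set.Ioi (0 : ℝ))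
  ν_smooth : ContDiffOn ℝ ∞ ν (Set.Ioi (0 : ℝ) ×ˢ Set.Ioi (0 : ℝ))

variable (P : Params)

/-! ### Equilibrium energies as functions of the temperature -/

/-- Translational energy `e_tr(T)`. -/
def eTr (T : ℝ) : ℝ := 3 / 2 * P.R * T

/-- Rotational energy `e_rot(T)`. -/
def eRot (T : ℝ) : ℝ := P.δ / 2 * P.R * T

/-- Vibrational energy `e_vib(T)`. -/
def eVib (T : ℝ) : ℝ := P.R * P.T₀ / (Real.exp (P.T₀ / T) - 1)

/-- Translational-rotational energy `e_{tr,rot}(T)`. -/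
def eTrRot (T : ℝ) : ℝ := eTr P T + eRot P T

/-- Total internal energy `e(T)`. -/
def eTot (T : ℝ) : ℝ := eTr P T + eRot P T + eVib P T

/-- The temperature `T > 0` with `e(T) = E`, for any of the (strictly increasing) energy functions
above. -/
def tempOf (e : ℝ → ℝ) (E : ℝ) : ℝ := Function.invFunOn e (Set.Ioi 0) E

/-! ### Moments of a distribution `g(v, ε, i)` -/

/-- Mass density `ρ`. -/
def density (g : Micro → ℝ) : ℝ := bracket g

/-- Bulk velocity `u`, with `ρ u = ⟨v g⟩`. -/
def velocity (g : Micro → ℝ) : Vec :=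
  WithLp.toLp 2 fun j => bracket (fun y => y.1 j * g y) / density g

/-- Specific translational energy `E_tr`. -/
def energyTr (g : Micro → ℝ) : ℝ :=
  bracket (fun y => 1 / 2 * ‖y.1 - velocity g‖ ^ 2 * g y) / density g

/-- Specific rotational energy `E_rot`. -/
def energyRot (g : Micro → ℝ) : ℝ := bracket (fun y => y.2.1 * g y) / density g

/-- Specific vibrational energy `E_vib`. -/
def energyVib (g : Micro → ℝ) : ℝ :=
  bracket (fun y => (y.2.2 : ℝ) * P.R * P.T₀ * g y) / density g

/-- Specific internal energy `E`. -/
def energyInt (g : Micro → ℝ) : ℝ :=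
  bracket (fun y => (1 / 2 * ‖y.1 - velocity g‖ ^ 2 + y.2.1 + (y.2.2 : ℝ) * P.R * P.T₀) * g y)
    / density g

/-- Total energy density `𝓔 = ⟨(|v|²/2 + ε + i R T₀) g⟩`. -/
def totalEnergy (g : Micro → ℝ) : ℝ :=
  bracket fun y => (1 / 2 * ‖y.1‖ ^ 2 + y.2.1 + (y.2.2 : ℝ) * P.R * P.T₀) * g y

/-- Stress tensor `Σ(g) = ⟨(v - u) ⊗ (v - u) g⟩ = ρ Θ`. -/
def stress (g : Micro → ℝ) : Matrix (Fin 3) (Fin 3) ℝ :=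
  Matrix.of fun j k => bracket fun y => (y.1 j - velocity g j) * (y.1 k - velocity g k) * g y

/-- The tensor `Θ`. -/
def theta (g : Micro → ℝ) : Matrix (Fin 3) (Fin 3) ℝ := (density g)⁻¹ • stress g

/-- Heat flux `q(g) = ⟨(|v - u|²/2 + ε + i R T₀) (v - u) g⟩`. -/
def heatFlux (g : Micro → ℝ) (j : Fin 3) : ℝ :=
  bracket fun y => (1 / 2 * ‖y.1 - velocity g‖ ^ 2 + y.2.1 + (y.2.2 : ℝ) * P.R * P.T₀)
    * (y.1 j - velocity g j) * g y

/-- Translational temperature `T_tr`. -/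
def tempTr (g : Micro → ℝ) : ℝ := tempOf (eTr P) (energyTr g)

/-- Translational-rotational temperature `T_{tr,rot}`. -/
def tempTrRot (g : Micro → ℝ) : ℝ := tempOf (eTrRot P) (energyTr g + energyRot g)

/-- Equilibrium temperature `T_eq`. -/
def tempEq (g : Micro → ℝ) : ℝ := tempOf (eTot P) (energyInt P g)

/-- The local state `(ρ, T_eq)` on which the parameters depend. -/
def state (g : Micro → ℝ) : ℝ × ℝ := (density g, tempEq P g)

/-! ### The Gaussian and the kinetic equation -/

/-- The corrected tensor `Π`. -/
def piTensor (g : Micro → ℝ) : Matrix (Fin 3) (Fin 3) ℝ :=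
  let Γ := P.Γ (state P g)
  let θ := P.θ (state P g)
  let ν := P.ν (state P g)
  (Γ * P.R * tempEq P g) • (1 : Matrix (Fin 3) (Fin 3) ℝ)
    + (1 - Γ) • ((θ * P.R * tempTrRot P g) • (1 : Matrix (Fin 3) (Fin 3) ℝ)
      + (1 - θ) • (ν • theta g
        + ((1 - ν) * P.R * tempTr P g) • (1 : Matrix (Fin 3) (Fin 3) ℝ)))

/-- Relaxation energy of rotation. -/
def eRotRel (g : Micro → ℝ) : ℝ :=
  let Γ := P.Γ (state P g)
  let θ := P.θ (state P g)
  Γ * eRot P (tempEq P g)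
    + (1 - Γ) * (θ * eRot P (tempTrRot P g) + (1 - θ) * energyRot g)

/-- Relaxation energy of vibration. -/
def eVibRel (g : Micro → ℝ) : ℝ :=
  let Γ := P.Γ (state P g)
  Γ * eVib P (tempEq P g) + (1 - Γ) * energyVib P g

/-- Relaxation temperature of rotation. -/
def tempRotRel (g : Micro → ℝ) : ℝ := tempOf (eRot P) (eRotRel P g)

/-- Relaxation temperature of vibration. -/
def tempVibRel (g : Micro → ℝ) : ℝ := tempOf (eVib P) (eVibRel P g)

/-- Translational part of the Gaussian. -/
def gaussTr (g : Micro → ℝ) (v : Vec) : ℝ :=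
  density g / Real.sqrt ((2 * Real.pi) • piTensor P g).det
    * Real.exp (-(1 / 2) *
      ((fun j => v j - velocity g j) ⬝ᵥ
        Matrix.mulVec (piTensor P g)⁻¹ (fun j => v j - velocity g j)))

/-- Rotational part of the Gaussian. -/
def gaussRot (g : Micro → ℝ) (ε : ℝ) : ℝ :=
  1 / Real.Gamma (P.δ / 2) / (P.R * tempRotRel P g) ^ (P.δ / 2) * ε ^ ((P.δ - 2) / 2)
    * Real.exp (-ε / (P.R * tempRotRel P g))

/-- Vibrational part of the Gaussian. -/
def gaussVib (g : Micro → ℝ) (i : ℕ) : ℝ :=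
  (1 - Real.exp (-P.T₀ / tempVibRel P g)) * Real.exp (-(i : ℝ) * (P.T₀ / tempVibRel P g))

/-- The Gaussian `𝓖[g]`. -/
def gaussian (g : Micro → ℝ) (y : Micro) : ℝ :=
  gaussTr P g y.1 * gaussRot P g y.2.1 * gaussVib P g y.2.2

/-- Time derivative at `z = (t, x)`. -/
def dt (h : SpaceTime → ℝ) (z : SpaceTime) : ℝ := fderiv ℝ h z (1, 0)

/-- Derivative with respect to `x_j` at `z = (t, x)`. -/
def dx (j : Fin 3) (h : SpaceTime → ℝ) (z : SpaceTime) : ℝ :=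
  fderiv ℝ h z (0, EuclideanSpace.single j 1)

/-- `f` is a nonnegative classical solution, smooth in `(t, x)`, on the open set `Ω` of space-time,
of the non-dimensional equation `∂ₜ f + v · ∇f = (𝓖[f] - f) / (Kn τ)`. -/
structure IsSolution (Kn : ℝ) (Ω : Set SpaceTime) (f : SpaceTime → Micro → ℝ) : Prop where
  measurable : ∀ z ∈ Ω, Measurable (f z)
  nonneg : ∀ z ∈ Ω, ∀ y : Micro, 0 < y.2.1 → 0 ≤ f z y
  smooth : ∀ y : Micro, 0 < y.2.1 → ContDiffOn ℝ ∞ (fun z => f z y) Ω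
  equation : ∀ z ∈ Ω, ∀ y : Micro, 0 < y.2.1 →
    dt (fun z' => f z' y) z + ∑ j, y.1 j * dx j (fun z' => f z' y) z
      = 1 / (Kn * P.τ (state P (f z))) * (gaussian P (f z) y - f z y)

/-- The family `f Kn`, `0 < Kn < Kn₀`, and its derivatives in time and space are `O(1)` with
respect to `Kn` on `Ω`: every polynomial moment of every derivative is bounded uniformly. -/
def IsBoundedFamily (Kn₀ : ℝ) (Ω : Set SpaceTime) (f : ℝ → SpaceTime → Micro → ℝ) : Prop :=
  ∀ m k : ℕ, ∃ C : ℝ, ∀ Kn ∈ Set.Ioo 0 Kn₀, ∀ z ∈ Ω,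
    ∫⁻ y, ENNReal.ofReal ((1 + ‖y.1‖ ^ 2 + y.2.1 + (y.2.2 : ℝ)) ^ m
      * ‖iteratedFDeriv ℝ k (fun z' => f Kn z' y) z‖) ∂microMeasure ≤ ENNReal.ofReal C

/-- Density and equilibrium temperature are bounded away from zero on `Ω`, uniformly in `Kn`. -/
def IsNondegenerateFamily (Kn₀ : ℝ) (Ω : Set SpaceTime) (f : ℝ → SpaceTime → Micro → ℝ) : Prop :=
  ∃ c > 0, ∀ Kn ∈ Set.Ioo 0 Kn₀, ∀ z ∈ Ω, c ≤ density (f Kn z) ∧ c ≤ tempEq P (f Kn z)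

/-! ### Transport coefficients, as functions of the density `r` and the temperature `T` -/

/-- Pressure `p = ρ R T`. -/
def pressure (r T : ℝ) : ℝ := r * P.R * T

/-- Enthalpy `h = e(T) + p / ρ`, where `p / ρ = R T`. -/
def enthalpy (T : ℝ) : ℝ := eTot P T + P.R * T

/-- Heat capacity at constant volume. -/
def cv (T : ℝ) : ℝ := deriv (eTot P) T

/-- Heat capacity at constant pressure. -/
def cp (T : ℝ) : ℝ := deriv (enthalpy P) T

/-- Heat capacity ratio of a monoatomic gas. -/
def gammaMono : ℝ := 5 / 3

/-- Heat capacity ratio of a gas with rotational modes only. -/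
def gammaRot : ℝ := (5 + P.δ) / (3 + P.δ)

/-- Heat capacity ratio of the gas. -/
def gamma (T : ℝ) : ℝ := 1 + P.R / cv P T

/-- Viscosity `μ`. -/
def viscosity (r T : ℝ) : ℝ :=
  P.τ (r, T) * pressure P r T / (1 - (1 - P.Γ (r, T)) * (1 - P.θ (r, T)) * P.ν (r, T))

/-- Heat transfer coefficient `κ`. -/
def conductivity (r T : ℝ) : ℝ :=
  (1 - (1 - P.Γ (r, T)) * (1 - P.θ (r, T)) * P.ν (r, T)) * viscosity P r T * cp P T

/-- Second viscosity coefficient `α`. -/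
def secondViscosity (r T : ℝ) : ℝ :=
  let Γ := P.Γ (r, T)
  let θ := P.θ (r, T)
  let ν := P.ν (r, T)
  (gamma P T - 1)
    - (1 - Γ) * (1 - θ) * (1 - ν) / (1 - (1 - Γ) * (1 - θ)) * (gammaMono - gammaRot P)
    - (1 - Γ) * (1 - (1 - θ) * ν) / Γ * (gammaRot P - gamma P T)

/-- Prandtl number `Pr = μ c_p / κ`. -/
def prandtl (r T : ℝ) : ℝ := viscosity P r T * cp P T / conductivity P r T

/-! ### The compressible Navier–Stokes equations for fields `ρ, u, T, 𝓔` -/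

/-- Divergence of a vector field. -/
def divergence (w : SpaceTime → Fin 3 → ℝ) (z : SpaceTime) : ℝ := ∑ k, dx k (fun z' => w z' k) z

/-- Viscous stress `σ = -μ (∇u + (∇u)ᵀ - α (∇·u) I)`. -/
def nsStress (ρ T : SpaceTime → ℝ) (u : SpaceTime → Vec) (z : SpaceTime) (j k : Fin 3) : ℝ :=
  -viscosity P (ρ z) (T z) *
    (dx k (fun z' => u z' j) z + dx j (fun z' => u z' k) z
      - secondViscosity P (ρ z) (T z) * divergence (fun z' l => u z' l) z
        * (1 : Matrix (Fin 3) (Fin 3) ℝ) j k)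

/-- Fourier law `q = -κ ∇T`. -/
def nsHeatFlux (ρ T : SpaceTime → ℝ) (z : SpaceTime) (j : Fin 3) : ℝ :=
  -conductivity P (ρ z) (T z) * dx j T z

/-- `∂ₜρ + ∇·(ρu)`. -/
def massResidual (ρ : SpaceTime → ℝ) (u : SpaceTime → Vec) (z : SpaceTime) : ℝ :=
  dt ρ z + divergence (fun z' k => ρ z' * u z' k) z

/-- `∂ₜ(ρu) + ∇·(ρu⊗u) + ∇p + ∇·(Kn σ)`, component `j`. -/
def momentumResidual (Kn : ℝ) (ρ T : SpaceTime → ℝ) (u : SpaceTime → Vec) (j : Fin 3)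
    (z : SpaceTime) : ℝ :=
  dt (fun z' => ρ z' * u z' j) z + divergence (fun z' k => ρ z' * u z' j * u z' k) z
    + dx j (fun z' => pressure P (ρ z') (T z')) z
    + divergence (fun z' k => Kn * nsStress P ρ T u z' j k) z

/-- `∂ₜ𝓔 + ∇·((𝓔 + p)u) + ∇·(Kn q) + ∇·(Kn σu)`. -/
def energyResidual (Kn : ℝ) (ρ T 𝓔 : SpaceTime → ℝ) (u : SpaceTime → Vec) (z : SpaceTime) : ℝ :=
  dt 𝓔 z + divergence (fun z' k => (𝓔 z' + pressure P (ρ z') (T z')) * u z' k) z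
    + divergence (fun z' k => Kn * nsHeatFlux P ρ T z' k) z
    + divergence (fun z' k => Kn * ∑ j, nsStress P ρ T u z' k j * u z' j) z

end ESBGK

end

open ESBGK

/-!
# The Navier–Stokes limit of the ES-BGK model

On a solution the Gaussian is `𝓖[f] = f + Kn τ (∂ₜ f + v · ∇f)`. The idea is to test this identity
with `1`, `c = v - u`, `η = |c|² / 2 + ε + i R T₀`, `c ⊗ c`, `ε`, `i R T₀` and `η c`. The moments of
`𝓖[f]` are explicit (`integral_gaussKernel_two`, `integral_gaussKernel_four`,
`integral_gaussKernel_odd`), which turns the tested identities into algebraic relations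
between macroscopic fields and their transport terms: the conservation laws, and relaxation
equations for stress, rotational energy, vibrational energy and heat flux that hold *exactly*
(`KineticFamily.momentSystem`). From there on the argument is about fields on space-time only.

Each deviation from equilibrium is `Kn` times a transport term, hence `O(Kn)`. Inserting this into
the transport terms gives them up to `O(Kn)`, and inserting that into the relaxation equations gives
stress and heat flux up to `O(Kn²)` (`MomentSystem.order_stress_two`,
`MomentSystem.order_q_two`). The trace part of the stress collects the relaxation of the vibrational
and rotational energies; that it has the coefficient `α` is the identity
`second_viscosity_identity`. The residuals of the Navier–Stokes equations are then the divergences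
of these `O(Kn²)` remainders, because the conservation laws hold without error
(`MomentSystem.order_momentumResidual`, `MomentSystem.order_energyResidual`).

Since transport terms contain derivatives, a bound `O(Knⁿ)` has to survive differentiation. It is
therefore understood, in `IsOrder`, as `Knⁿ` times a family that is smooth with all derivatives
bounded uniformly in `Kn` and on `Ω` (`UnifSmooth`). This class is closed under products,
derivatives and composition with functions smooth near a compact set containing the values, the last
of which applies to the coefficients of the model and to the inverse energy functions because density
and temperature stay in a compact subset of `(0, ∞)`.

The moments of `f` belong to this class by differentiation under the integral sign
(`Tame.unifSmooth_integral`). The hypotheses bound the integrals of the derivatives of `f` at each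
point, and provide no dominating function. The first-order Taylor remainder of a moment is instead
bounded by an integral of second derivatives over a segment, with Tonelli's theorem to exchange the
order of integration (`Tame.enorm_taylor_le`). Distributions are set to zero at nonpositive
rotational energies (`cutoff`), where nothing is assumed about them.
-/

open ESBGK

namespace ESBGK

open MeasureTheory

open scoped ENNReal NNReal

/-! ### Families with uniformly bounded derivatives -/

section UnifSmooth

variable {ι E : Type*} [NormedAddCommGroup E] [NormedSpace ℝ E] {Ω : Set E}

/-- The derivative of a scalar function in a fixed direction `w`. Both `dt` and `dx j` are of this
form. -/
noncomputable def dirDeriv (w : E) (a : E → ℝ) (z : E) : ℝ := fderiv ℝ a z w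

/-- All iterated directional derivatives of order at most `n` are bounded on `Ω`, uniformly in the
index of the family. -/
def BddDerivs (Ω : Set E) : ℕ → (ι → E → ℝ) → Prop
  | 0, a => ∃ C, ∀ i, ∀ z ∈ Ω, |a i z| ≤ C
  | n + 1, a => (∃ C, ∀ i, ∀ z ∈ Ω, |a i z| ≤ C) ∧
      ∀ w, BddDerivs Ω n (fun i => dirDeriv w (a i))

/-- A family of functions that are smooth on `Ω`, with bounds for all derivatives that are uniform
both on `Ω` and in the index of the family. -/
structure UnifSmooth (Ω : Set E) (a : ι → E → ℝ) : Prop where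
  smooth : ∀ i, ContDiffOn ℝ ∞ (a i) Ω
  bdd : ∀ n, BddDerivs Ω n a

theorem dirDeriv_congr (hΩ : IsOpen Ω) {a b : E → ℝ} (h : ∀ z ∈ Ω, a z = b z) (w : E) :
    ∀ z ∈ Ω, dirDeriv w a z = dirDeriv w b z := by
  intro z hz
  have : a =ᶠ[nhds z] b := Filter.eventually_of_mem (hΩ.mem_nhds hz) h
  simp only [dirDeriv, this.fderiv_eq]

theorem ContDiffOn.differentiableAt_of_isOpen (hΩ : IsOpen Ω) {a : E → ℝ}
    (h : ContDiffOn ℝ ∞ a Ω) {z : E} (hz : z ∈ Ω) : DifferentiableAt ℝ a z :=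
  (h.contDiffAt (hΩ.mem_nhds hz)).differentiableAt (by simp)

theorem contDiffOn_dirDeriv (hΩ : IsOpen Ω) {a : E → ℝ} (h : ContDiffOn ℝ ∞ a Ω) (w : E) :
    ContDiffOn ℝ ∞ (dirDeriv w a) Ω :=
  (h.fderiv_of_isOpen hΩ (by simp)).clm_apply contDiffOn_const

theorem BddDerivs.congr (hΩ : IsOpen Ω) : ∀ {n : ℕ} {a b : ι → E → ℝ},
    (∀ i, ∀ z ∈ Ω, a i z = b i z) → BddDerivs Ω n a → BddDerivs Ω n b := by
  intro n
  induction n with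
  | zero =>
    rintro a b h ⟨C, hC⟩
    exact ⟨C, fun i z hz => h i z hz ▸ hC i z hz⟩
  | succ n ih =>
    rintro a b h ⟨⟨C, hC⟩, h'⟩
    exact ⟨⟨C, fun i z hz => h i z hz ▸ hC i z hz⟩, fun w =>
      ih (fun i => dirDeriv_congr hΩ (h i) w) (h' w)⟩

namespace UnifSmooth

theorem congr (hΩ : IsOpen Ω) {a b : ι → E → ℝ} (ha : UnifSmooth Ω a)
    (h : ∀ i, ∀ z ∈ Ω, a i z = b i z) : UnifSmooth Ω b where
  smooth i := (ha.smooth i).congr fun z hz => (h i z hz).symm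
  bdd n := (ha.bdd n).congr hΩ h

theorem differentiableAt (hΩ : IsOpen Ω) {a : ι → E → ℝ} (ha : UnifSmooth Ω a) (i : ι) {z : E}
    (hz : z ∈ Ω) : DifferentiableAt ℝ (a i) z :=
  ContDiffOn.differentiableAt_of_isOpen hΩ (ha.smooth i) hz

theorem dirDeriv (hΩ : IsOpen Ω) {a : ι → E → ℝ} (ha : UnifSmooth Ω a) (w : E) :
    UnifSmooth Ω (fun i => dirDeriv w (a i)) where
  smooth i := contDiffOn_dirDeriv hΩ (ha.smooth i) w
  bdd n := (ha.bdd (n + 1)).2 w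

theorem const {c : ι → ℝ} (C : ℝ) (hc : ∀ i, |c i| ≤ C) : UnifSmooth Ω (fun i (_ : E) => c i) where
  smooth i := contDiffOn_const
  bdd n := by
    induction n generalizing c C with
    | zero => exact ⟨C, fun i _ _ => hc i⟩
    | succ n ih =>
      refine ⟨⟨C, fun i _ _ => hc i⟩, fun w => ?_⟩
      have := ih (c := fun _ => 0) 0 (by simp)
      have h0 : (fun i => ESBGK.dirDeriv w fun _ : E => c i) = fun (_ : ι) (_ : E) => (0 : ℝ) := by
        funext i z
        simp [ESBGK.dirDeriv]
      rw [h0]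
      exact this

theorem const' (c : ℝ) : UnifSmooth Ω (fun (_ : ι) (_ : E) => c) := const |c| fun _ => le_rfl

end UnifSmooth

theorem BddDerivs.add (hΩ : IsOpen Ω) : ∀ {n : ℕ} {a b : ι → E → ℝ},
    (∀ i, ContDiffOn ℝ ∞ (a i) Ω) → (∀ i, ContDiffOn ℝ ∞ (b i) Ω) →
    BddDerivs Ω n a → BddDerivs Ω n b → BddDerivs Ω n (fun i z => a i z + b i z) := by
  have key : ∀ {a b : ι → E → ℝ}, (∃ C, ∀ i, ∀ z ∈ Ω, |a i z| ≤ C) →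
      (∃ C, ∀ i, ∀ z ∈ Ω, |b i z| ≤ C) → ∃ C, ∀ i, ∀ z ∈ Ω, |a i z + b i z| ≤ C := by
    rintro a b ⟨C, hC⟩ ⟨D, hD⟩
    exact ⟨C + D, fun i z hz => (abs_add_le _ _).trans (add_le_add (hC i z hz) (hD i z hz))⟩
  intro n
  induction n with
  | zero => exact fun _ _ ha hb => key ha hb
  | succ n ih =>
    intro a b hsa hsb ha hb
    refine ⟨key ha.1 hb.1, fun w => ?_⟩
    refine BddDerivs.congr hΩ (fun i z hz => ?_) (ih (fun i => contDiffOn_dirDeriv hΩ (hsa i) w)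
      (fun i => contDiffOn_dirDeriv hΩ (hsb i) w) (ha.2 w) (hb.2 w))
    simp only [dirDeriv]
    rw [fderiv_fun_add (ContDiffOn.differentiableAt_of_isOpen hΩ (hsa i) hz)
      (ContDiffOn.differentiableAt_of_isOpen hΩ (hsb i) hz)]
    rfl

theorem dirDeriv_fun_mul {a b : E → ℝ} {z : E} (ha : DifferentiableAt ℝ a z)
    (hb : DifferentiableAt ℝ b z) (w : E) :
    dirDeriv w (fun z => a z * b z) z = dirDeriv w a z * b z + a z * dirDeriv w b z := by
  simp only [dirDeriv]
  rw [fderiv_fun_mul ha hb]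
  simp
  ring

theorem dirDeriv_fun_add {a b : E → ℝ} {z : E} (ha : DifferentiableAt ℝ a z)
    (hb : DifferentiableAt ℝ b z) (w : E) :
    dirDeriv w (fun z => a z + b z) z = dirDeriv w a z + dirDeriv w b z := by
  simp only [dirDeriv]
  rw [fderiv_fun_add ha hb]
  rfl

theorem dirDeriv_fun_sub {a b : E → ℝ} {z : E} (ha : DifferentiableAt ℝ a z)
    (hb : DifferentiableAt ℝ b z) (w : E) :
    dirDeriv w (fun z => a z - b z) z = dirDeriv w a z - dirDeriv w b z := by
  simp only [dirDeriv]
  rw [fderiv_fun_sub ha hb]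
  rfl

theorem dirDeriv_const_mul {a : E → ℝ} {z : E} (ha : DifferentiableAt ℝ a z) (c : ℝ) (w : E) :
    dirDeriv w (fun z => c * a z) z = c * dirDeriv w a z := by
  simp only [dirDeriv]
  rw [fderiv_const_mul ha]
  rfl

theorem dirDeriv_fun_sum {κ : Type*} {s : Finset κ} {a : κ → E → ℝ} {z : E}
    (ha : ∀ k ∈ s, DifferentiableAt ℝ (a k) z) (w : E) :
    dirDeriv w (fun z => ∑ k ∈ s, a k z) z = ∑ k ∈ s, dirDeriv w (a k) z := by
  simp only [dirDeriv]
  rw [fderiv_fun_sum ha]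
  simp

namespace UnifSmooth

theorem add (hΩ : IsOpen Ω) {a b : ι → E → ℝ} (ha : UnifSmooth Ω a) (hb : UnifSmooth Ω b) :
    UnifSmooth Ω (fun i z => a i z + b i z) where
  smooth i := (ha.smooth i).add (hb.smooth i)
  bdd n := (ha.bdd n).add hΩ ha.smooth hb.smooth (hb.bdd n)

theorem mul (hΩ : IsOpen Ω) {a b : ι → E → ℝ} (ha : UnifSmooth Ω a) (hb : UnifSmooth Ω b) :
    UnifSmooth Ω (fun i z => a i z * b i z) where
  smooth i := (ha.smooth i).mul (hb.smooth i)
  bdd n := by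
    have key : ∀ {a b : ι → E → ℝ}, (∃ C, ∀ i, ∀ z ∈ Ω, |a i z| ≤ C) →
        (∃ C, ∀ i, ∀ z ∈ Ω, |b i z| ≤ C) → ∃ C, ∀ i, ∀ z ∈ Ω, |a i z * b i z| ≤ C := by
      rintro a b ⟨C, hC⟩ ⟨D, hD⟩
      refine ⟨C * D, fun i z hz => ?_⟩
      rw [abs_mul]
      exact mul_le_mul (hC i z hz) (hD i z hz) (abs_nonneg _) ((abs_nonneg _).trans (hC i z hz))
    induction n generalizing a b with
    | zero => exact key (ha.bdd 0) (hb.bdd 0)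
    | succ n ih =>
      refine ⟨key (ha.bdd 0) (hb.bdd 0), fun w => ?_⟩
      have h1 := ih (ha.dirDeriv hΩ w) hb
      have h2 := ih ha (hb.dirDeriv hΩ w)
      refine BddDerivs.congr hΩ (fun i z hz => ?_) (BddDerivs.add hΩ
        (fun i => ((ha.dirDeriv hΩ w).smooth i).mul (hb.smooth i))
        (fun i => (ha.smooth i).mul ((hb.dirDeriv hΩ w).smooth i)) h1 h2)
      rw [dirDeriv_fun_mul (ha.differentiableAt hΩ i hz) (hb.differentiableAt hΩ i hz)]

theorem const_mul (hΩ : IsOpen Ω) {a : ι → E → ℝ} (c : ℝ) (ha : UnifSmooth Ω a) :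
    UnifSmooth Ω (fun i z => c * a i z) := (const' c).mul hΩ ha

theorem neg (hΩ : IsOpen Ω) {a : ι → E → ℝ} (ha : UnifSmooth Ω a) :
    UnifSmooth Ω (fun i z => -a i z) :=
  (ha.const_mul hΩ (-1)).congr hΩ (by simp)

theorem sub (hΩ : IsOpen Ω) {a b : ι → E → ℝ} (ha : UnifSmooth Ω a) (hb : UnifSmooth Ω b) :
    UnifSmooth Ω (fun i z => a i z - b i z) :=
  (ha.add hΩ (hb.neg hΩ)).congr hΩ (fun _ _ _ => by ring)

theorem sum (hΩ : IsOpen Ω) {κ : Type*} {s : Finset κ} {a : κ → ι → E → ℝ}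
    (ha : ∀ k ∈ s, UnifSmooth Ω (a k)) : UnifSmooth Ω (fun i z => ∑ k ∈ s, a k i z) := by
  classical
  induction s using Finset.induction_on with
  | empty => simpa using const' (ι := ι) (Ω := Ω) 0
  | insert k s hk ih =>
    simp only [Finset.sum_insert hk]
    exact (ha k (by simp)).add hΩ (ih fun l hl => ha l (by simp [hl]))

/-- A smooth function of two families stays in the class as soon as the values of the pair remain
in a compact subset of the domain of smoothness. -/
theorem comp₂ (hΩ : IsOpen Ω) {U K : Set (ℝ × ℝ)} (hU : IsOpen U) (hK : IsCompact K) (hKU : K ⊆ U)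
    {φ : ℝ × ℝ → ℝ} (hφ : ContDiffOn ℝ ∞ φ U) {a b : ι → E → ℝ} (ha : UnifSmooth Ω a)
    (hb : UnifSmooth Ω b) (hab : ∀ i, ∀ z ∈ Ω, (a i z, b i z) ∈ K) :
    UnifSmooth Ω (fun i z => φ (a i z, b i z)) := by
  have hs : ∀ {φ : ℝ × ℝ → ℝ}, ContDiffOn ℝ ∞ φ U → ∀ i,
      ContDiffOn ℝ ∞ (fun z => φ (a i z, b i z)) Ω := fun hφ i =>
    hφ.comp ((ha.smooth i).prodMk (hb.smooth i)) fun z hz => hKU (hab i z hz)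
  have key : ∀ {φ : ℝ × ℝ → ℝ}, ContDiffOn ℝ ∞ φ U →
      ∃ C, ∀ i, ∀ z ∈ Ω, |φ (a i z, b i z)| ≤ C := by
    intro φ hφ
    obtain ⟨C, hC⟩ := hK.exists_bound_of_continuousOn (hφ.continuousOn.mono hKU)
    exact ⟨C, fun i z hz => hC _ (hab i z hz)⟩
  -- The chain rule expresses a derivative of `φ (a, b)` by products of functions of the same form;
  -- boundedness of such products to order `n` is therefore proved along with the claim.
  have main : ∀ (n : ℕ) (φ : ℝ × ℝ → ℝ), ContDiffOn ℝ ∞ φ U →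
      ∀ c : ι → E → ℝ, UnifSmooth Ω c → BddDerivs Ω n (fun i z => c i z * φ (a i z, b i z)) := by
    intro n
    induction n with
    | zero =>
      intro φ hφ c hc
      obtain ⟨C, hC⟩ := key hφ
      obtain ⟨D, hD⟩ := hc.bdd 0
      refine ⟨D * C, fun i z hz => ?_⟩
      rw [abs_mul]
      exact mul_le_mul (hD i z hz) (hC i z hz) (abs_nonneg _) ((abs_nonneg _).trans (hD i z hz))
    | succ n ih =>
      intro φ hφ c hc
      refine ⟨?_, fun w => ?_⟩
      · obtain ⟨C, hC⟩ := key hφ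
        obtain ⟨D, hD⟩ := hc.bdd 0
        refine ⟨D * C, fun i z hz => ?_⟩
        rw [abs_mul]
        exact mul_le_mul (hD i z hz) (hC i z hz) (abs_nonneg _) ((abs_nonneg _).trans (hD i z hz))
      · have h0 := contDiffOn_dirDeriv hU hφ (1, 0)
        have h1 := contDiffOn_dirDeriv hU hφ (0, 1)
        have e1 := ih φ hφ _ (hc.dirDeriv hΩ w)
        have e2 := ih _ h0 _ (hc.mul hΩ (ha.dirDeriv hΩ w))
        have e3 := ih _ h1 _ (hc.mul hΩ (hb.dirDeriv hΩ w))
        have s1 := fun i => ((hc.dirDeriv hΩ w).smooth i).mul (hs hφ i)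
        have s2 := fun i => ((hc.mul hΩ (ha.dirDeriv hΩ w)).smooth i).mul (hs h0 i)
        have s3 := fun i => ((hc.mul hΩ (hb.dirDeriv hΩ w)).smooth i).mul (hs h1 i)
        refine BddDerivs.congr hΩ (fun i z hz => ?_)
          (BddDerivs.add hΩ (fun i => (s1 i).add (s2 i)) s3 (BddDerivs.add hΩ s1 s2 e1 e2) e3)
        have dφ : DifferentiableAt ℝ φ (a i z, b i z) :=
          (hφ.contDiffAt (hU.mem_nhds (hKU (hab i z hz)))).differentiableAt (by simp)
        have dab := (ha.differentiableAt hΩ i hz).prodMk (hb.differentiableAt hΩ i hz)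
        have hd : HasFDerivAt (fun z => φ (a i z, b i z)) _ z :=
          dφ.hasFDerivAt.comp z ((ha.differentiableAt hΩ i hz).hasFDerivAt.prodMk
            (hb.differentiableAt hΩ i hz).hasFDerivAt)
        rw [dirDeriv_fun_mul (hc.differentiableAt hΩ i hz) hd.differentiableAt]
        have : ESBGK.dirDeriv w (fun z => φ (a i z, b i z)) z
            = ESBGK.dirDeriv w (a i) z * ESBGK.dirDeriv (1, 0) φ (a i z, b i z)
              + ESBGK.dirDeriv w (b i) z * ESBGK.dirDeriv (0, 1) φ (a i z, b i z) := by
          simp only [ESBGK.dirDeriv, hd.fderiv]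
          have : ((fderiv ℝ (a i) z).prod (fderiv ℝ (b i) z)) w
              = (fderiv ℝ (a i) z w) • ((1 : ℝ), (0 : ℝ))
                + (fderiv ℝ (b i) z w) • ((0 : ℝ), (1 : ℝ)) := by simp
          rw [ContinuousLinearMap.comp_apply, this, map_add, map_smul, map_smul]
          simp
        rw [this]
        ring
  refine ⟨hs hφ, fun n => ?_⟩
  simpa using main n φ hφ _ (const' 1)

/-- The one-variable case of `UnifSmooth.comp₂`. -/
theorem comp (hΩ : IsOpen Ω) {U K : Set ℝ} (hU : IsOpen U) (hK : IsCompact K) (hKU : K ⊆ U)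
    {φ : ℝ → ℝ} (hφ : ContDiffOn ℝ ∞ φ U) {a : ι → E → ℝ} (ha : UnifSmooth Ω a)
    (haK : ∀ i, ∀ z ∈ Ω, a i z ∈ K) : UnifSmooth Ω (fun i z => φ (a i z)) :=
  comp₂ hΩ (hU.prod hU) (hK.prod hK) (Set.prod_mono hKU hKU) (φ := fun s => φ s.1)
    (hφ.comp contDiffOn_fst fun _ h => h.1) ha ha fun i z hz => ⟨haK i z hz, haK i z hz⟩

theorem inv (hΩ : IsOpen Ω) {a : ι → E → ℝ} (ha : UnifSmooth Ω a) {c : ℝ} (hc : 0 < c)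
    (hac : ∀ i, ∀ z ∈ Ω, c ≤ a i z) : UnifSmooth Ω (fun i z => (a i z)⁻¹) := by
  obtain ⟨C, hC⟩ := ha.bdd 0
  exact comp hΩ (U := Set.Ioi 0) (K := Set.Icc c C) isOpen_Ioi isCompact_Icc
    (fun x hx => hc.trans_le hx.1) (φ := fun x => x⁻¹)
    (contDiffOn_id.inv fun x hx => ne_of_gt hx) ha
    fun i z hz => ⟨hac i z hz, (le_abs_self _).trans (hC i z hz)⟩

end UnifSmooth

/-! ### Powers of the small parameter -/

/-- `a = O(εⁿ)` together with all derivatives: `a` is `εⁿ` times a family whose derivatives are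
uniformly bounded. The small parameter `ε` is a function of the index. -/
def IsOrder (Ω : Set E) (ε : ι → ℝ) (n : ℕ) (a : ι → E → ℝ) : Prop :=
  ∃ b : ι → E → ℝ, UnifSmooth Ω b ∧ ∀ i, ∀ z ∈ Ω, a i z = ε i ^ n * b i z

namespace IsOrder

variable {ε : ι → ℝ} {n m : ℕ} {a b : ι → E → ℝ}

theorem congr (ha : IsOrder Ω ε n a) (h : ∀ i, ∀ z ∈ Ω, a i z = b i z) : IsOrder Ω ε n b := by
  obtain ⟨c, hc, h'⟩ := ha
  exact ⟨c, hc, fun i z hz => by rw [← h i z hz, h' i z hz]⟩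

theorem add (hΩ : IsOpen Ω) (ha : IsOrder Ω ε n a) (hb : IsOrder Ω ε n b) :
    IsOrder Ω ε n (fun i z => a i z + b i z) := by
  obtain ⟨c, hc, h⟩ := ha
  obtain ⟨d, hd, h'⟩ := hb
  exact ⟨_, hc.add hΩ hd, fun i z hz => by beta_reduce; rw [h i z hz, h' i z hz]; ring⟩

theorem mul_left (hΩ : IsOpen Ω) (hb : UnifSmooth Ω b) (ha : IsOrder Ω ε n a) :
    IsOrder Ω ε n (fun i z => b i z * a i z) := by
  obtain ⟨c, hc, h⟩ := ha
  exact ⟨_, hb.mul hΩ hc, fun i z hz => by beta_reduce; rw [h i z hz]; ring⟩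

theorem param_mul (ha : IsOrder Ω ε n a) :
    IsOrder Ω ε (n + 1) (fun i z => ε i * a i z) := by
  obtain ⟨c, hc, h⟩ := ha
  exact ⟨c, hc, fun i z hz => by beta_reduce; rw [h i z hz]; ring⟩

theorem sum (hΩ : IsOpen Ω) {κ : Type*} {s : Finset κ} {a : κ → ι → E → ℝ}
    (ha : ∀ k ∈ s, IsOrder Ω ε n (a k)) : IsOrder Ω ε n (fun i z => ∑ k ∈ s, a k i z) := by
  choose! c hc h using ha
  exact ⟨_, UnifSmooth.sum hΩ hc, fun i z hz => by
    rw [Finset.mul_sum]; exact Finset.sum_congr rfl fun k hk => h k hk i z hz⟩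

theorem const_mul (hΩ : IsOpen Ω) (c : ℝ) (ha : IsOrder Ω ε n a) :
    IsOrder Ω ε n (fun i z => c * a i z) := ha.mul_left hΩ (UnifSmooth.const' c)

theorem neg (hΩ : IsOpen Ω) (ha : IsOrder Ω ε n a) : IsOrder Ω ε n (fun i z => -a i z) :=
  (ha.const_mul hΩ (-1)).congr (by simp)

theorem sub (hΩ : IsOpen Ω) (ha : IsOrder Ω ε n a) (hb : IsOrder Ω ε n b) :
    IsOrder Ω ε n (fun i z => a i z - b i z) :=
  (ha.add hΩ (hb.neg hΩ)).congr fun _ _ _ => by ring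

theorem dirDeriv (hΩ : IsOpen Ω) (ha : IsOrder Ω ε n a) (w : E) :
    IsOrder Ω ε n (fun i => dirDeriv w (a i)) := by
  obtain ⟨c, hc, h⟩ := ha
  refine ⟨_, hc.dirDeriv hΩ w, fun i z hz => ?_⟩
  beta_reduce
  rw [dirDeriv_congr hΩ (h i) w z hz, dirDeriv_const_mul (hc.differentiableAt hΩ i hz)]

theorem bound (ha : IsOrder Ω ε n a) : ∃ C, ∀ i, ∀ z ∈ Ω, |a i z| ≤ C * |ε i| ^ n := by
  obtain ⟨c, hc, h⟩ := ha
  obtain ⟨C, hC⟩ := hc.bdd 0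
  refine ⟨C, fun i z hz => ?_⟩
  rw [h i z hz, abs_mul, abs_pow, mul_comm]
  exact mul_le_mul_of_nonneg_right (hC i z hz) (by positivity)

end IsOrder

end UnifSmooth

/-! ### Differentiation of moments under the integral sign -/

section MomentBdd

variable {ι E Y : Type*} [MeasurableSpace Y] {Ω : Set E} {μ : Measure Y} {W : Y → ℝ}

/-- All moments with respect to powers of the weight `W` are bounded on `Ω`, uniformly in the index
of the family. -/
def MomentBdd (Ω : Set E) (μ : Measure Y) (W : Y → ℝ) (g : ι → E → Y → ℝ) : Prop :=
  ∀ m : ℕ, ∃ C : ℝ≥0, ∀ i, ∀ z ∈ Ω, ∫⁻ y, ‖W y ^ m * g i z y‖ₑ ∂μ ≤ C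

theorem MomentBdd.congr {g h : ι → E → Y → ℝ} (hg : MomentBdd Ω μ W g)
    (hgh : ∀ i, ∀ z ∈ Ω, ∀ y, g i z y = h i z y) : MomentBdd Ω μ W h := by
  intro m
  obtain ⟨C, hC⟩ := hg m
  exact ⟨C, fun i z hz => by simpa only [hgh i z hz] using hC i z hz⟩

theorem MomentBdd.add {g h : ι → E → Y → ℝ} (hW : Measurable W)
    (hg : MomentBdd Ω μ W g) (hh : MomentBdd Ω μ W h)
    (hm : ∀ i, ∀ z ∈ Ω, Measurable (g i z)) :
    MomentBdd Ω μ W (fun i z y => g i z y + h i z y) := by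
  intro m
  obtain ⟨C, hC⟩ := hg m
  obtain ⟨D, hD⟩ := hh m
  refine ⟨C + D, fun i z hz => ?_⟩
  calc ∫⁻ y, ‖W y ^ m * (g i z y + h i z y)‖ₑ ∂μ
      ≤ ∫⁻ y, (‖W y ^ m * g i z y‖ₑ + ‖W y ^ m * h i z y‖ₑ) ∂μ := by
        refine lintegral_mono fun y => ?_
        rw [mul_add]
        exact enorm_add_le _ _
    _ = ∫⁻ y, ‖W y ^ m * g i z y‖ₑ ∂μ + ∫⁻ y, ‖W y ^ m * h i z y‖ₑ ∂μ :=
        lintegral_add_left ((hW.pow_const m).mul (hm i z hz)).enorm _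
    _ ≤ ((C + D : ℝ≥0) : ℝ≥0∞) := by
        rw [ENNReal.coe_add]
        exact add_le_add (hC i z hz) (hD i z hz)

theorem MomentBdd.mul_left {g : ι → E → Y → ℝ} (hg : MomentBdd Ω μ W g) {a : ι → E → ℝ} {C : ℝ}
    (ha : ∀ i, ∀ z ∈ Ω, |a i z| ≤ C) : MomentBdd Ω μ W (fun i z y => a i z * g i z y) := by
  intro m
  obtain ⟨D, hD⟩ := hg m
  refine ⟨C.toNNReal * D, fun i z hz => ?_⟩
  calc ∫⁻ y, ‖W y ^ m * (a i z * g i z y)‖ₑ ∂μ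
      = ∫⁻ y, ‖a i z‖ₑ * ‖W y ^ m * g i z y‖ₑ ∂μ := by
        refine lintegral_congr fun y => ?_
        rw [← enorm_mul]; congr 1; ring
    _ = ‖a i z‖ₑ * ∫⁻ y, ‖W y ^ m * g i z y‖ₑ ∂μ := lintegral_const_mul' _ _ enorm_ne_top
    _ ≤ ((C.toNNReal * D : ℝ≥0) : ℝ≥0∞) := by
        rw [ENNReal.coe_mul]
        refine mul_le_mul' ?_ (hD i z hz)
        rw [← ofReal_norm]
        exact ENNReal.ofReal_le_ofReal (ha i z hz)

theorem MomentBdd.weight_mul {g : ι → E → Y → ℝ} (hg : MomentBdd Ω μ W g) (hW1 : ∀ y, 1 ≤ W y)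
    {φ : Y → ℝ} {C : ℝ} {k : ℕ} (hφ : ∀ y, |φ y| ≤ C * W y ^ k) :
    MomentBdd Ω μ W (fun i z y => φ y * g i z y) := by
  intro m
  obtain ⟨D, hD⟩ := hg (m + k)
  refine ⟨C.toNNReal * D, fun i z hz => ?_⟩
  calc ∫⁻ y, ‖W y ^ m * (φ y * g i z y)‖ₑ ∂μ
      ≤ ∫⁻ y, (C.toNNReal : ℝ≥0∞) * ‖W y ^ (m + k) * g i z y‖ₑ ∂μ := by
        refine lintegral_mono fun y => ?_
        have h1 : ‖φ y‖ₑ ≤ (C.toNNReal : ℝ≥0∞) * ‖W y ^ k‖ₑ := by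
          have hC : 0 ≤ C := by
            have := (abs_nonneg _).trans (hφ y)
            exact nonneg_of_mul_nonneg_left this (pow_pos (by linarith [hW1 y]) k)
          have hp : 0 ≤ W y ^ k := pow_nonneg (by linarith [hW1 y]) k
          rw [← ofReal_norm, ← ofReal_norm, Real.norm_eq_abs, Real.norm_eq_abs,
            abs_of_nonneg hp]
          change _ ≤ ENNReal.ofReal C * _
          rw [← ENNReal.ofReal_mul hC]
          exact ENNReal.ofReal_le_ofReal (hφ y)
        rw [pow_add]
        simp only [enorm_mul]
        calc ‖W y ^ m‖ₑ * (‖φ y‖ₑ * ‖g i z y‖ₑ)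
            ≤ ‖W y ^ m‖ₑ * (((C.toNNReal : ℝ≥0∞) * ‖W y ^ k‖ₑ) * ‖g i z y‖ₑ) := by gcongr
          _ = _ := by ring
    _ = (C.toNNReal : ℝ≥0∞) * ∫⁻ y, ‖W y ^ (m + k) * g i z y‖ₑ ∂μ :=
        lintegral_const_mul' _ _ ENNReal.coe_ne_top
    _ ≤ ((C.toNNReal * D : ℝ≥0) : ℝ≥0∞) := by
        rw [ENNReal.coe_mul]
        exact mul_le_mul' le_rfl (hD i z hz)

end MomentBdd

section Tame

variable {ι E Y : Type*} [NormedAddCommGroup E] [NormedSpace ℝ E] [MeasurableSpace Y]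
  {Ω : Set E} {μ : Measure Y} {W : Y → ℝ}

/-- The directional derivative of `g(z, y)` with respect to `z`, for a family `g`. -/
noncomputable def famDeriv (w : E) (g : ι → E → Y → ℝ) : ι → E → Y → ℝ :=
  fun i z y => dirDeriv w (fun z' => g i z' y) z

/-- All iterated directional derivatives of order at most `n` have bounded moments. -/
def TameDerivs (Ω : Set E) (μ : Measure Y) (W : Y → ℝ) : ℕ → (ι → E → Y → ℝ) → Prop
  | 0, g => MomentBdd Ω μ W g
  | n + 1, g => MomentBdd Ω μ W g ∧ ∀ w, TameDerivs Ω μ W n (famDeriv w g)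

/-- A family of functions `g(z, y)` that are smooth in the macroscopic variable `z ∈ Ω`, measurable
in the microscopic variable `y`, and whose derivatives in `z` have moments of all orders, bounded
uniformly on `Ω` and in the index of the family. -/
structure Tame (Ω : Set E) (μ : Measure Y) (W : Y → ℝ) (g : ι → E → Y → ℝ) : Prop where
  smooth : ∀ i y, ContDiffOn ℝ ∞ (fun z => g i z y) Ω
  measurable : ∀ i, ∀ z ∈ Ω, Measurable (g i z)
  moments : ∀ n, TameDerivs Ω μ W n g

omit [MeasurableSpace Y] in
theorem famDeriv_congr (hΩ : IsOpen Ω) {g h : ι → E → Y → ℝ}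
    (hgh : ∀ i, ∀ z ∈ Ω, ∀ y, g i z y = h i z y) (w : E) :
    ∀ i, ∀ z ∈ Ω, ∀ y, famDeriv w g i z y = famDeriv w h i z y := fun i z hz y =>
  dirDeriv_congr hΩ (fun z hz => hgh i z hz y) w z hz

theorem TameDerivs.congr (hΩ : IsOpen Ω) {n : ℕ} : ∀ {g h : ι → E → Y → ℝ},
    (∀ i, ∀ z ∈ Ω, ∀ y, g i z y = h i z y) → TameDerivs Ω μ W n g → TameDerivs Ω μ W n h := by
  induction n with
  | zero => exact fun h hg => MomentBdd.congr hg h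
  | succ n ih => exact fun h hg =>
      ⟨MomentBdd.congr hg.1 h, fun w => ih (famDeriv_congr hΩ h w) (hg.2 w)⟩

theorem measurable_famDeriv (hΩ : IsOpen Ω) {g : ι → E → Y → ℝ}
    (hs : ∀ i y, ContDiffOn ℝ ∞ (fun z => g i z y) Ω) (hm : ∀ i, ∀ z ∈ Ω, Measurable (g i z))
    (w : E) (i : ι) {z : E} (hz : z ∈ Ω) : Measurable (famDeriv w g i z) := by
  -- the derivative is a limit of difference quotients, which lie in `Ω` eventually
  have ht : Filter.Tendsto (fun n : ℕ => z + (1 / ((n : ℝ) + 1)) • w) Filter.atTop (nhds z) := by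
    have := (tendsto_one_div_add_atTop_nhds_zero_nat (𝕜 := ℝ)).smul_const w
    simpa using this.const_add z
  obtain ⟨N, hN⟩ := Filter.eventually_atTop.1 (ht.eventually (hΩ.mem_nhds hz))
  refine measurable_of_tendsto_metrizable (f := fun (n : ℕ) y =>
    ((n + N : ℕ) + 1 : ℝ) * (g i (z + (1 / (((n + N : ℕ) : ℝ) + 1)) • w) y - g i z y))
    (fun n => ((hm i _ (hN _ (by omega))).sub (hm i z hz)).const_mul _) ?_
  rw [tendsto_pi_nhds]
  intro y
  have hd := (ContDiffOn.differentiableAt_of_isOpen hΩ (hs i y) hz).hasFDerivAt.hasLineDerivAt w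
  have hl := hd.tendsto_slope_zero
  have h0 : Filter.Tendsto (fun n : ℕ => 1 / (((n + N : ℕ) : ℝ) + 1)) Filter.atTop
      (nhdsWithin 0 {0}ᶜ) := by
    refine tendsto_nhdsWithin_of_tendsto_nhds_of_eventually_within _
      ((tendsto_one_div_add_atTop_nhds_zero_nat (𝕜 := ℝ)).comp
        (Filter.tendsto_add_atTop_nat N)) (Filter.Eventually.of_forall fun n => ?_)
    have : (0 : ℝ) < 1 / (((n + N : ℕ) : ℝ) + 1) := by positivity
    exact this.ne'
  have := hl.comp h0
  refine this.congr fun n => ?_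
  simp

theorem TameDerivs.add (hΩ : IsOpen Ω) (hW : Measurable W) {n : ℕ} : ∀ {g h : ι → E → Y → ℝ},
    (∀ i y, ContDiffOn ℝ ∞ (fun z => g i z y) Ω) → (∀ i, ∀ z ∈ Ω, Measurable (g i z)) →
    (∀ i y, ContDiffOn ℝ ∞ (fun z => h i z y) Ω) → (∀ i, ∀ z ∈ Ω, Measurable (h i z)) →
    TameDerivs Ω μ W n g → TameDerivs Ω μ W n h →
    TameDerivs Ω μ W n (fun i z y => g i z y + h i z y) := by
  induction n with
  | zero => exact fun _ hmg _ _ hg hh => MomentBdd.add hW hg hh hmg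
  | succ n ih =>
    intro g h hsg hmg hsh hmh hg hh
    refine ⟨MomentBdd.add hW hg.1 hh.1 hmg, fun w => ?_⟩
    refine (ih (fun i y => contDiffOn_dirDeriv hΩ (hsg i y) w)
      (fun i z hz => measurable_famDeriv hΩ hsg hmg w i hz)
      (fun i y => contDiffOn_dirDeriv hΩ (hsh i y) w)
      (fun i z hz => measurable_famDeriv hΩ hsh hmh w i hz)
      (hg.2 w) (hh.2 w)).congr hΩ fun i z hz y => ?_
    exact (dirDeriv_fun_add (ContDiffOn.differentiableAt_of_isOpen hΩ (hsg i y) hz)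
      (ContDiffOn.differentiableAt_of_isOpen hΩ (hsh i y) hz) w).symm

/-- A second-order Taylor estimate, with the remainder in the form used for Tonelli's theorem. -/
theorem enorm_taylor_le {φ φ' φ'' : ℝ → ℝ} (h0 : ∀ s ∈ Set.Icc (0 : ℝ) 1, HasDerivAt φ (φ' s) s)
    (h1 : ∀ s ∈ Set.Icc (0 : ℝ) 1, HasDerivAt φ' (φ'' s) s)
    (h2 : ContinuousOn φ'' (Set.Icc 0 1)) :
    ‖φ 1 - φ 0 - φ' 0‖ₑ ≤ ∫⁻ s in Set.Icc (0 : ℝ) 1, ‖φ'' s‖ₑ := by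
  have hint : IntegrableOn φ'' (Set.Icc 0 1) := h2.integrableOn_Icc
  set J := ∫ s in Set.Icc (0 : ℝ) 1, ‖φ'' s‖ with hJ
  have hJ' : ENNReal.ofReal J = ∫⁻ s in Set.Icc (0 : ℝ) 1, ‖φ'' s‖ₑ :=
    ofReal_integral_norm_eq_lintegral_enorm hint
  have hb : ∀ s ∈ Set.Icc (0 : ℝ) 1, ‖φ' s - φ' 0‖ ≤ J := by
    intro s hs
    have hsub : Set.Icc 0 s ⊆ Set.Icc (0 : ℝ) 1 := Set.Icc_subset_Icc le_rfl hs.2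
    have : ∫ r in (0 : ℝ)..s, φ'' r = φ' s - φ' 0 := by
      refine intervalIntegral.integral_eq_sub_of_hasDerivAt (fun r hr => h1 r ?_) ?_
      · rw [Set.uIcc_of_le hs.1] at hr
        exact hsub hr
      · rw [intervalIntegrable_iff_integrableOn_Icc_of_le hs.1]
        exact hint.mono_set hsub
    rw [← this]
    refine (intervalIntegral.norm_integral_le_integral_norm hs.1).trans ?_
    rw [intervalIntegral.integral_of_le hs.1]
    exact setIntegral_mono_set hint.norm (Filter.Eventually.of_forall fun _ => norm_nonneg _)
      (Set.Ioc_subset_Icc_self.trans hsub).eventuallyLE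
  have key := norm_image_sub_le_of_norm_deriv_le_segment_01'
    (f := fun s => φ s - s * φ' 0) (f' := fun s => φ' s - φ' 0) (C := J)
    (fun s hs => by
      have := ((h0 s hs).sub ((hasDerivAt_id s).mul_const (φ' 0))).hasDerivWithinAt
        (s := Set.Icc (0 : ℝ) 1)
      simpa [Pi.sub_def] using this)
    (fun s hs => hb s ⟨hs.1, hs.2.le⟩)
  rw [← hJ', ← ofReal_norm]
  refine ENNReal.ofReal_le_ofReal ?_
  refine le_of_eq_of_le ?_ key
  congr 1
  ring

namespace Tame

variable {g h : ι → E → Y → ℝ}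

theorem congr (hΩ : IsOpen Ω) (hg : Tame Ω μ W g)
    (hgh : ∀ i, ∀ z ∈ Ω, ∀ y, g i z y = h i z y) : Tame Ω μ W h where
  smooth i y := (hg.smooth i y).congr fun z hz => (hgh i z hz y).symm
  measurable i z hz := by
    have : h i z = g i z := funext fun y => (hgh i z hz y).symm
    rw [this]; exact hg.measurable i z hz
  moments n := (hg.moments n).congr hΩ hgh

theorem differentiableAt (hΩ : IsOpen Ω) (hg : Tame Ω μ W g) (i : ι) (y : Y) {z : E}
    (hz : z ∈ Ω) : DifferentiableAt ℝ (fun z => g i z y) z :=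
  ContDiffOn.differentiableAt_of_isOpen hΩ (hg.smooth i y) hz

theorem famDeriv (hΩ : IsOpen Ω) (hg : Tame Ω μ W g) (w : E) : Tame Ω μ W (famDeriv w g) where
  smooth i y := contDiffOn_dirDeriv hΩ (hg.smooth i y) w
  measurable i _ hz := measurable_famDeriv hΩ hg.smooth hg.measurable w i hz
  moments n := (hg.moments (n + 1)).2 w

theorem integrable_weight (hg : Tame Ω μ W g) (hW : Measurable W) (m : ℕ) (i : ι) {z : E}
    (hz : z ∈ Ω) : Integrable (fun y => W y ^ m * g i z y) μ := by
  obtain ⟨C, hC⟩ := (hg.moments 0) m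
  refine ⟨((hW.pow_const m).mul (hg.measurable i z hz)).aestronglyMeasurable, ?_⟩
  exact (hC i z hz).trans_lt ENNReal.coe_lt_top

theorem integrable (hg : Tame Ω μ W g) (i : ι) {z : E} (hz : z ∈ Ω) : Integrable (g i z) μ := by
  obtain ⟨C, hC⟩ := (hg.moments 0) 0
  refine ⟨(hg.measurable i z hz).aestronglyMeasurable, ?_⟩
  have := (hC i z hz).trans_lt ENNReal.coe_lt_top
  simpa [HasFiniteIntegral] using this

end Tame

namespace Tame

variable {g h : ι → E → Y → ℝ}

theorem add (hΩ : IsOpen Ω) (hW : Measurable W) (hg : Tame Ω μ W g) (hh : Tame Ω μ W h) :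
    Tame Ω μ W (fun i z y => g i z y + h i z y) where
  smooth i y := (hg.smooth i y).add (hh.smooth i y)
  measurable i z hz := (hg.measurable i z hz).add (hh.measurable i z hz)
  moments n := (hg.moments n).add hΩ hW hg.smooth hg.measurable hh.smooth hh.measurable (hh.moments n)

theorem mul_left (hΩ : IsOpen Ω) (hW : Measurable W) {a : ι → E → ℝ} (ha : UnifSmooth Ω a)
    (hg : Tame Ω μ W g) : Tame Ω μ W (fun i z y => a i z * g i z y) where
  smooth i y := (ha.smooth i).mul (hg.smooth i y)
  measurable i z hz := (hg.measurable i z hz).const_mul _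
  moments n := by
    have key : ∀ {a : ι → E → ℝ} {g : ι → E → Y → ℝ}, UnifSmooth Ω a → Tame Ω μ W g →
        MomentBdd Ω μ W (fun i z y => a i z * g i z y) := fun ha hg => by
      obtain ⟨C, hC⟩ := ha.bdd 0
      exact MomentBdd.mul_left (hg.moments 0) hC
    induction n generalizing a g with
    | zero => exact key ha hg
    | succ n ih =>
      refine ⟨key ha hg, fun w => ?_⟩
      have ha' := ha.dirDeriv hΩ w
      have hg' := hg.famDeriv hΩ w
      refine (TameDerivs.add hΩ hW (fun i y => (ha'.smooth i).mul (hg.smooth i y))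
        (fun i z hz => (hg.measurable i z hz).const_mul _)
        (fun i y => (ha.smooth i).mul (hg'.smooth i y))
        (fun i z hz => (hg'.measurable i z hz).const_mul _) (ih ha' hg) (ih ha hg')).congr hΩ
          fun i z hz y => ?_
      exact (dirDeriv_fun_mul (ha.differentiableAt hΩ i hz) (hg.differentiableAt hΩ i y hz) w).symm

theorem weight_mul (hΩ : IsOpen Ω) (hW1 : ∀ y, 1 ≤ W y) {φ : Y → ℝ} {C : ℝ} {k : ℕ}
    (hm : Measurable φ) (hφ : ∀ y, |φ y| ≤ C * W y ^ k) (hg : Tame Ω μ W g) :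
    Tame Ω μ W (fun i z y => φ y * g i z y) where
  smooth i y := contDiffOn_const.mul (hg.smooth i y)
  measurable i z hz := hm.mul (hg.measurable i z hz)
  moments n := by
    induction n generalizing g with
    | zero => exact MomentBdd.weight_mul (hg.moments 0) hW1 hφ
    | succ n ih =>
      refine ⟨MomentBdd.weight_mul (hg.moments 0) hW1 hφ, fun w => ?_⟩
      refine (ih (hg.famDeriv hΩ w)).congr hΩ fun i z hz y => ?_
      exact (dirDeriv_const_mul (hg.differentiableAt hΩ i y hz) (φ y) w).symm

theorem neg (hΩ : IsOpen Ω) (hW : Measurable W) (hg : Tame Ω μ W g) :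
    Tame Ω μ W (fun i z y => -g i z y) :=
  (hg.mul_left hΩ hW (UnifSmooth.const' (-1))).congr hΩ (by simp)

theorem sub (hΩ : IsOpen Ω) (hW : Measurable W) (hg : Tame Ω μ W g) (hh : Tame Ω μ W h) :
    Tame Ω μ W (fun i z y => g i z y - h i z y) :=
  (hg.add hΩ hW (hh.neg hΩ hW)).congr hΩ fun _ _ _ _ => by ring

theorem zero : Tame Ω μ W (fun (_ : ι) (_ : E) (_ : Y) => (0 : ℝ)) where
  smooth i y := contDiffOn_const
  measurable i z hz := measurable_const
  moments n := by
    induction n with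
    | zero => exact fun m => ⟨0, by simp⟩
    | succ n ih =>
      refine ⟨fun m => ⟨0, by simp⟩, fun w => ?_⟩
      have : ESBGK.famDeriv w (fun (_ : ι) (_ : E) (_ : Y) => (0 : ℝ)) = fun _ _ _ => 0 := by
        funext i z y
        simp [ESBGK.famDeriv, dirDeriv]
      rw [this]
      exact ih

theorem sum (hΩ : IsOpen Ω) (hW : Measurable W) {κ : Type*} {s : Finset κ}
    {g : κ → ι → E → Y → ℝ} (hg : ∀ k ∈ s, Tame Ω μ W (g k)) :
    Tame Ω μ W (fun i z y => ∑ k ∈ s, g k i z y) := by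
  classical
  induction s using Finset.induction_on with
  | empty => simpa using zero
  | insert k s hk ih =>
    simp only [Finset.sum_insert hk]
    exact (hg k (by simp)).add hΩ hW (ih fun l hl => hg l (by simp [hl]))

/-- The directional derivatives of `g(·, y)` control the second-order Taylor remainder of
`z ↦ ∫ g(z, y) dy`, along a segment inside `Ω` in direction `w`. -/
theorem enorm_taylor_le [SFinite μ] (hΩ : IsOpen Ω) (hg : Tame Ω μ W g) (i : ι) {z w : E}
    (hseg : ∀ s ∈ Set.Icc (0 : ℝ) 1, z + s • w ∈ Ω) {C : ℝ≥0∞}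
    (hC : ∀ z' ∈ Ω, ∫⁻ y, ‖ESBGK.famDeriv w (ESBGK.famDeriv w g) i z' y‖ₑ ∂μ ≤ C) :
    ∫⁻ y, ‖g i (z + w) y - g i z y - ESBGK.famDeriv w g i z y‖ₑ ∂μ ≤ C := by
  set g2 := ESBGK.famDeriv w (ESBGK.famDeriv w g) with hg2
  have hd1 := hg.famDeriv hΩ w
  have hd2 := hd1.famDeriv hΩ w
  -- the segment is parametrized by all of `ℝ`, to get a jointly measurable function
  set c : ℝ → ℝ := fun s => max 0 (min s 1) with hc
  have hc01 : ∀ s, c s ∈ Set.Icc (0 : ℝ) 1 := fun s =>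
    ⟨le_max_left _ _, max_le zero_le_one (min_le_right _ _)⟩
  have hcid : ∀ s ∈ Set.Icc (0 : ℝ) 1, c s = s := fun s hs => by
    simp [hc, min_eq_left hs.2, max_eq_right hs.1]
  have hcc : Continuous c := by fun_prop
  have hline : ∀ s : ℝ, HasDerivAt (fun s : ℝ => z + s • w) w s := fun s => by
    simpa using ((hasDerivAt_id s).smul_const w).const_add z
  have hder : ∀ {k : E → ℝ}, ContDiffOn ℝ ∞ k Ω → ∀ s ∈ Set.Icc (0 : ℝ) 1,
      HasDerivAt (fun s : ℝ => k (z + s • w)) (dirDeriv w k (z + s • w)) s := fun hk s hs =>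
    (ContDiffOn.differentiableAt_of_isOpen hΩ hk (hseg s hs)).hasFDerivAt.comp_hasDerivAt s
      (hline s)
  have hmeas : Measurable (Function.uncurry fun (s : ℝ) y => g2 i (z + c s • w) y) := by
    refine measurable_uncurry_of_continuous_of_measurable (fun y => ?_)
      (fun s => hd2.measurable i _ (hseg _ (hc01 s)))
    exact (hd2.smooth i y).continuousOn.comp_continuous (by fun_prop) fun s => hseg _ (hc01 s)
  calc ∫⁻ y, ‖g i (z + w) y - g i z y - ESBGK.famDeriv w g i z y‖ₑ ∂μ
      ≤ ∫⁻ y, ∫⁻ s in Set.Icc (0 : ℝ) 1, ‖g2 i (z + c s • w) y‖ₑ ∂volume ∂μ := by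
        refine lintegral_mono fun y => ?_
        have := ESBGK.enorm_taylor_le (φ := fun s => g i (z + s • w) y)
          (φ' := fun s => ESBGK.famDeriv w g i (z + s • w) y)
          (φ'' := fun s => g2 i (z + s • w) y)
          (hder (hg.smooth i y)) (hder (hd1.smooth i y))
          ((hd2.smooth i y).continuousOn.comp (by fun_prop) fun s hs => hseg s hs)
        refine le_trans (by simp) (this.trans (le_of_eq ?_))
        refine setLIntegral_congr_fun measurableSet_Icc fun s hs => ?_
        simp only [hcid s hs]
    _ = ∫⁻ s in Set.Icc (0 : ℝ) 1, ∫⁻ y, ‖g2 i (z + c s • w) y‖ₑ ∂μ :=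
        lintegral_lintegral_swap ((hmeas.comp measurable_swap).enorm.aemeasurable)
    _ ≤ ∫⁻ _ in Set.Icc (0 : ℝ) 1, C := lintegral_mono fun s => hC _ (hseg _ (hc01 s))
    _ = C := by simp

end Tame

end Tame

section Integral

variable {ι E Y : Type*} [NormedAddCommGroup E] [NormedSpace ℝ E] [FiniteDimensional ℝ E]
  [MeasurableSpace Y] {Ω : Set E} {μ : Measure Y} {W : Y → ℝ}

namespace Tame

variable {g : ι → E → Y → ℝ}

omit [FiniteDimensional ℝ E] in
/-- The integrals of the directional derivatives depend linearly on the direction. -/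
theorem integral_famDeriv_add (hΩ : IsOpen Ω) (hg : Tame Ω μ W g) (i : ι) {z : E} (hz : z ∈ Ω)
    (w w' : E) : ∫ y, ESBGK.famDeriv (w + w') g i z y ∂μ
      = ∫ y, ESBGK.famDeriv w g i z y ∂μ + ∫ y, ESBGK.famDeriv w' g i z y ∂μ := by
  rw [← integral_add ((hg.famDeriv hΩ w).integrable i hz) ((hg.famDeriv hΩ w').integrable i hz)]
  simp [ESBGK.famDeriv, dirDeriv]

omit [FiniteDimensional ℝ E] in
theorem integral_famDeriv_smul (i : ι) (z : E) (r : ℝ) (w : E) :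
    ∫ y, ESBGK.famDeriv (r • w) g i z y ∂μ = r * ∫ y, ESBGK.famDeriv w g i z y ∂μ := by
  rw [← integral_const_mul]
  simp [ESBGK.famDeriv, dirDeriv]

/-- The derivative of `z ↦ ∫ g(z, y) dy`. -/
noncomputable def integralFDeriv (hΩ : IsOpen Ω) (hg : Tame Ω μ W g) (i : ι) {z : E}
    (hz : z ∈ Ω) : E →L[ℝ] ℝ :=
  LinearMap.toContinuousLinearMap
    { toFun := fun w => ∫ y, ESBGK.famDeriv w g i z y ∂μ
      map_add' := hg.integral_famDeriv_add hΩ i hz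
      map_smul' := fun r w => integral_famDeriv_smul i z r w }

/-- Second directional derivatives are bounded in `L¹` by the square of the direction; this is
where finite dimension enters, through the expansion of the direction in a basis. -/
theorem exists_bound_second (hΩ : IsOpen Ω) (hg : Tame Ω μ W g) : ∃ C : ℝ≥0, ∀ i, ∀ z ∈ Ω, ∀ w,
    ∫⁻ y, ‖ESBGK.famDeriv w (ESBGK.famDeriv w g) i z y‖ₑ ∂μ ≤ C * ‖w‖ₑ ^ 2 := by
  set b := Module.finBasis ℝ E
  have hm0 : ∀ k l, ∃ C : ℝ≥0, ∀ i, ∀ z ∈ Ω,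
      ∫⁻ y, ‖ESBGK.famDeriv (b k) (ESBGK.famDeriv (b l) g) i z y‖ₑ ∂μ ≤ C := fun k l => by
    obtain ⟨C, hC⟩ := (((hg.famDeriv hΩ (b l)).famDeriv hΩ (b k)).moments 0) 0
    exact ⟨C, fun i z hz => by simpa using hC i z hz⟩
  choose C hC using hm0
  set β : Fin (Module.finrank ℝ E) → ℝ≥0 := fun k =>
    ‖LinearMap.toContinuousLinearMap (b.coord k)‖₊ with hβ
  have hcoord : ∀ k w, ‖b.repr w k‖ₑ ≤ β k * ‖w‖ₑ := fun k w =>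
    (LinearMap.toContinuousLinearMap (b.coord k)).le_opENorm w
  refine ⟨∑ k, ∑ l, β k * β l * C k l, fun i z hz w => ?_⟩
  have hexp : ∀ (a : E → ℝ) (z : E), dirDeriv w a z = ∑ l, b.repr w l * dirDeriv (b l) a z := by
    intro a z
    have : fderiv ℝ a z w = fderiv ℝ a z (∑ l, b.repr w l • b l) := by rw [b.sum_repr]
    simp only [dirDeriv]
    rw [this, map_sum]
    simp only [map_smul, smul_eq_mul]
  have h2 : ∀ y, ESBGK.famDeriv w (ESBGK.famDeriv w g) i z y
      = ∑ k, ∑ l, b.repr w k * b.repr w l *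
        ESBGK.famDeriv (b k) (ESBGK.famDeriv (b l) g) i z y := by
    intro y
    simp only [ESBGK.famDeriv]
    rw [hexp]
    refine Finset.sum_congr rfl fun k _ => ?_
    rw [show (fun z' => dirDeriv w (fun z'' => g i z'' y) z') = fun z' =>
      ∑ l, b.repr w l * dirDeriv (b l) (fun z'' => g i z'' y) z' from funext (hexp _),
      dirDeriv_fun_sum (a := fun l z' => b.repr w l * dirDeriv (b l) (fun z'' => g i z'' y) z')
        fun l _ => ((hg.famDeriv hΩ (b l)).differentiableAt hΩ i y hz).const_mul _,
      Finset.mul_sum]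
    refine Finset.sum_congr rfl fun l _ => ?_
    rw [dirDeriv_const_mul (a := fun z' => dirDeriv (b l) (fun z'' => g i z'' y) z')
      ((hg.famDeriv hΩ (b l)).differentiableAt hΩ i y hz)]
    ring
  have hmeas : ∀ k l, Measurable (ESBGK.famDeriv (b k) (ESBGK.famDeriv (b l) g) i z) := fun k l =>
    ((hg.famDeriv hΩ (b l)).famDeriv hΩ (b k)).measurable i z hz
  calc ∫⁻ y, ‖ESBGK.famDeriv w (ESBGK.famDeriv w g) i z y‖ₑ ∂μ
      ≤ ∫⁻ y, ∑ k, ∑ l, ‖b.repr w k‖ₑ * ‖b.repr w l‖ₑ *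
          ‖ESBGK.famDeriv (b k) (ESBGK.famDeriv (b l) g) i z y‖ₑ ∂μ := by
        refine lintegral_mono fun y => ?_
        rw [h2]
        refine (enorm_sum_le _ _).trans (Finset.sum_le_sum fun k _ =>
          (enorm_sum_le _ _).trans (Finset.sum_le_sum fun l _ => ?_))
        simp only [enorm_mul, le_refl]
    _ = ∑ k, ∑ l, ‖b.repr w k‖ₑ * ‖b.repr w l‖ₑ *
          ∫⁻ y, ‖ESBGK.famDeriv (b k) (ESBGK.famDeriv (b l) g) i z y‖ₑ ∂μ := by
        rw [lintegral_finsetSum _ fun k _ => Finset.measurable_sum _ fun l _ =>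
          (hmeas k l).enorm.const_mul _]
        refine Finset.sum_congr rfl fun k _ => ?_
        rw [lintegral_finsetSum _ fun l _ => (hmeas k l).enorm.const_mul _]
        refine Finset.sum_congr rfl fun l _ => ?_
        rw [lintegral_const_mul _ (hmeas k l).enorm]
    _ ≤ ∑ k, ∑ l, (β k * ‖w‖ₑ) * (β l * ‖w‖ₑ) * C k l := by
        refine Finset.sum_le_sum fun k _ => Finset.sum_le_sum fun l _ => ?_
        gcongr
        · exact hcoord k w
        · exact hcoord l w
        · exact hC k l i z hz
    _ = _ := by
        push_cast
        rw [Finset.sum_mul]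
        refine Finset.sum_congr rfl fun k _ => ?_
        rw [Finset.sum_mul]
        refine Finset.sum_congr rfl fun l _ => ?_
        ring

theorem hasFDerivAt_integral [SFinite μ] (hΩ : IsOpen Ω) (hg : Tame Ω μ W g) (i : ι) {z : E}
    (hz : z ∈ Ω) : HasFDerivAt (fun z => ∫ y, g i z y ∂μ) (hg.integralFDeriv hΩ i hz) z := by
  obtain ⟨C, hC⟩ := hg.exists_bound_second hΩ
  obtain ⟨r, hr, hball⟩ := Metric.isOpen_iff.1 hΩ z hz
  rw [hasFDerivAt_iff_isLittleO_nhds_zero]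
  have hO : (fun w => ∫ y, g i (z + w) y ∂μ - ∫ y, g i z y ∂μ - hg.integralFDeriv hΩ i hz w)
      =O[nhds 0] fun w => ‖w‖ ^ 2 := by
    refine Asymptotics.IsBigO.of_bound C ?_
    filter_upwards [Metric.ball_mem_nhds (0 : E) hr] with w hw
    have hw' : ‖w‖ < r := by simpa using hw
    have hseg : ∀ s ∈ Set.Icc (0 : ℝ) 1, z + s • w ∈ Ω := fun s hs => by
      apply hball
      rw [mem_ball_iff_norm, add_sub_cancel_left, norm_smul, Real.norm_eq_abs, abs_of_nonneg hs.1]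
      exact (mul_le_of_le_one_left (norm_nonneg _) hs.2).trans_lt hw'
    have hz1 : z + w ∈ Ω := by simpa using hseg 1 (by simp)
    have i1 := hg.integrable i hz1
    have i2 := hg.integrable i hz
    have i3 := (hg.famDeriv hΩ w).integrable i hz
    have e : ∫ y, g i (z + w) y ∂μ - ∫ y, g i z y ∂μ - hg.integralFDeriv hΩ i hz w
        = ∫ y, (g i (z + w) y - g i z y - ESBGK.famDeriv w g i z y) ∂μ := by
      rw [integral_sub (i1.sub' i2) i3, integral_sub i1 i2]
      rfl
    have hbound := hg.enorm_taylor_le hΩ i hseg (fun z' hz' => hC i z' hz' w)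
    have h1 := (enorm_integral_le_lintegral_enorm _).trans hbound
    rw [e]
    have h3 : (C : ℝ≥0∞) * ‖w‖ₑ ^ 2 = ENNReal.ofReal (C * ‖‖w‖ ^ 2‖) := by
      rw [ENNReal.ofReal_mul C.coe_nonneg, ENNReal.ofReal_coe_nnreal, norm_pow, norm_norm,
        ENNReal.ofReal_pow (norm_nonneg _), ofReal_norm]
    rw [h3, ← ofReal_norm] at h1
    exact (ENNReal.ofReal_le_ofReal_iff (by positivity)).1 h1
  exact hO.trans_isLittleO (Asymptotics.isLittleO_norm_pow_id one_lt_two)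

/-- Differentiation under the integral sign. -/
theorem dirDeriv_integral [SFinite μ] (hΩ : IsOpen Ω) (hg : Tame Ω μ W g) (i : ι) {z : E}
    (hz : z ∈ Ω) (w : E) :
    dirDeriv w (fun z => ∫ y, g i z y ∂μ) z = ∫ y, ESBGK.famDeriv w g i z y ∂μ := by
  rw [dirDeriv, (hg.hasFDerivAt_integral hΩ i hz).fderiv]
  rfl

theorem contDiffOn_integral [SFinite μ] (hΩ : IsOpen Ω) (n : ℕ) : ∀ {g : ι → E → Y → ℝ},
    Tame Ω μ W g → ∀ i, ContDiffOn ℝ n (fun z => ∫ y, g i z y ∂μ) Ω := by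
  induction n with
  | zero =>
    intro g hg i
    exact contDiffOn_zero.2 fun z hz =>
      (hg.hasFDerivAt_integral hΩ i hz).continuousAt.continuousWithinAt
  | succ n ih =>
    intro g hg i
    refine (contDiffOn_succ_iff_fderiv_of_isOpen hΩ (n := (n : WithTop ℕ∞))).2 ⟨fun z hz =>
      (hg.hasFDerivAt_integral hΩ i hz).differentiableAt.differentiableWithinAt,
      fun h => absurd h (WithTop.coe_ne_top (a := (n : ℕ∞))), ?_⟩
    rw [contDiffOn_clm_apply]
    intro w
    exact (ih (hg.famDeriv hΩ w) i).congr fun z hz => hg.dirDeriv_integral hΩ i hz w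

/-- Moments of tame families are smooth, with uniform bounds for all derivatives. -/
theorem unifSmooth_integral [SFinite μ] (hΩ : IsOpen Ω) (hg : Tame Ω μ W g) :
    UnifSmooth Ω (fun i z => ∫ y, g i z y ∂μ) where
  smooth i := contDiffOn_infty.2 fun n => contDiffOn_integral hΩ n hg i
  bdd n := by
    have key : ∀ {g : ι → E → Y → ℝ}, Tame Ω μ W g →
        ∃ C, ∀ i, ∀ z ∈ Ω, |∫ y, g i z y ∂μ| ≤ C := by
      intro g hg
      obtain ⟨C, hC⟩ := (hg.moments 0) 0
      refine ⟨C, fun i z hz => ?_⟩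
      have h := (enorm_integral_le_lintegral_enorm (μ := μ) (g i z)).trans
        (le_of_eq_of_le (by simp) (hC i z hz))
      rw [← ofReal_norm, ← ENNReal.ofReal_coe_nnreal] at h
      exact (ENNReal.ofReal_le_ofReal_iff C.coe_nonneg).1 h
    induction n generalizing g with
    | zero => exact key hg
    | succ n ih =>
      exact ⟨key hg, fun w => (ih (hg.famDeriv hΩ w)).congr hΩ fun i z hz =>
        (hg.dirDeriv_integral hΩ i hz w).symm⟩

end Tame

end Integral

/-! ### Moments of Gaussian densities -/

section Gaussian

/-- The moment of order `k ≤ 4` of the standard normal distribution. -/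
def stdMoment : ℕ → ℕ
  | 0 => 1
  | 2 => 1
  | 4 => 3
  | _ => 0

theorem integrable_pow_mul_exp (k : ℕ) :
    Integrable fun x : ℝ => x ^ k * Real.exp (-(1 / 2) * x ^ 2) := by
  have := integrable_rpow_mul_exp_neg_mul_sq (b := 1 / 2) (by norm_num) (s := k)
    (by linarith [Nat.cast_nonneg (α := ℝ) k])
  simpa only [Real.rpow_natCast] using this

theorem integral_even_pow_mul_exp (k : ℕ) :
    ∫ x : ℝ, x ^ (2 * k) * Real.exp (-(1 / 2) * x ^ 2)
      = (1 / 2 : ℝ) ^ (-(2 * k + 1 : ℝ) / 2) * Real.Gamma ((2 * k + 1 : ℝ) / 2) := by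
  have h1 : ∫ x : ℝ, x ^ (2 * k) * Real.exp (-(1 / 2) * x ^ 2)
      = ∫ x : ℝ, (fun r : ℝ => r ^ ((2 * k : ℕ) : ℝ) * Real.exp (-(1 / 2) * r ^ (2 : ℝ))) |x| := by
    refine integral_congr_ae (Filter.Eventually.of_forall fun x => ?_)
    simp only [Real.rpow_natCast, Real.rpow_two, sq_abs]
    rw [pow_mul, pow_mul, sq_abs]
  rw [h1, integral_comp_abs (f := fun r : ℝ =>
    r ^ ((2 * k : ℕ) : ℝ) * Real.exp (-(1 / 2) * r ^ (2 : ℝ))), integral_rpow_mul_exp_neg_mul_rpow two_pos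
    (by linarith [Nat.cast_nonneg (α := ℝ) (2 * k)]) (by norm_num)]
  push_cast
  ring

theorem integral_odd_pow_mul_exp (k : ℕ) (hk : Odd k) :
    ∫ x : ℝ, x ^ k * Real.exp (-(1 / 2) * x ^ 2) = 0 := by
  have h := integral_neg_eq_self (fun x : ℝ => x ^ k * Real.exp (-(1 / 2) * x ^ 2)) volume
  simp only [hk.neg_pow, neg_sq, neg_mul, integral_neg] at h ⊢
  linarith

theorem integral_pow_mul_exp {k : ℕ} (hk : k ≤ 4) :
    ∫ x : ℝ, x ^ k * Real.exp (-(1 / 2) * x ^ 2) = √(2 * Real.pi) * stdMoment k := by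
  have h0 : ∫ x : ℝ, Real.exp (-(1 / 2) * x ^ 2) = √(2 * Real.pi) := by
    rw [integral_gaussian]; congr 1; ring
  have half : (1 / 2 : ℝ) ^ (-1 / 2 : ℝ) * √Real.pi = √(2 * Real.pi) := by
    rw [← h0, ← Real.Gamma_one_half_eq]
    simpa using (integral_even_pow_mul_exp 0).symm
  interval_cases k
  · simpa [stdMoment] using h0
  · simpa [stdMoment] using integral_odd_pow_mul_exp 1 (by decide)
  · have h := integral_even_pow_mul_exp 1
    have e1 : (-(2 * ((1 : ℕ) : ℝ) + 1) / 2) = -1 / 2 + (-1) := by norm_num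
    have e2 : ((2 * ((1 : ℕ) : ℝ) + 1) / 2) = 1 / 2 + 1 := by norm_num
    rw [e1, e2, Real.rpow_add (by norm_num), Real.rpow_neg_one, Real.Gamma_add_one (by norm_num),
      Real.Gamma_one_half_eq] at h
    rw [show (2 : ℕ) = 2 * 1 from rfl, h, ← half]
    simp [stdMoment]
    ring
  · simpa [stdMoment] using integral_odd_pow_mul_exp 3 (by decide)
  · have h := integral_even_pow_mul_exp 2
    have e1 : (-(2 * ((2 : ℕ) : ℝ) + 1) / 2) = -1 / 2 + (-1) + (-1) := by norm_num
    have e2 : ((2 * ((2 : ℕ) : ℝ) + 1) / 2) = 1 / 2 + 1 + 1 := by norm_num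
    rw [e1, e2, Real.rpow_add (by norm_num), Real.rpow_add (by norm_num), Real.rpow_neg_one,
      Real.Gamma_add_one (by norm_num), Real.Gamma_add_one (by norm_num),
      Real.Gamma_one_half_eq] at h
    rw [show (4 : ℕ) = 2 * 2 from rfl, h, ← half]
    simp [stdMoment]
    ring

theorem prod_map_eq_prod_pow_count (L : List (Fin 3)) (w : Fin 3 → ℝ) :
    (L.map w).prod = ∏ i, w i ^ L.count i := by
  rw [Finset.prod_list_map_count]
  refine Finset.prod_subset (Finset.subset_univ _) fun i _ hi => ?_
  rw [List.count_eq_zero_of_not_mem (by simpa using hi), pow_zero]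

theorem monomial_mul_exp_eq (L : List (Fin 3)) (w : Fin 3 → ℝ) :
    (L.map w).prod * Real.exp (-(1 / 2) * (w ⬝ᵥ w))
      = ∏ i, (w i ^ L.count i * Real.exp (-(1 / 2) * w i ^ 2)) := by
  rw [Finset.prod_mul_distrib, ← prod_map_eq_prod_pow_count, ← Real.exp_sum, ← Finset.mul_sum]
  simp only [dotProduct, sq]

theorem integrable_monomial (L : List (Fin 3)) :
    Integrable fun w : Fin 3 → ℝ => (L.map w).prod * Real.exp (-(1 / 2) * (w ⬝ᵥ w)) := by
  simp only [monomial_mul_exp_eq]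
  exact Integrable.fintype_prod (f := fun i x => x ^ L.count i * Real.exp (-(1 / 2) * x ^ 2))
    fun i => integrable_pow_mul_exp _

theorem integral_monomial (L : List (Fin 3)) (hL : L.length ≤ 4) :
    ∫ w : Fin 3 → ℝ, (L.map w).prod * Real.exp (-(1 / 2) * (w ⬝ᵥ w))
      = √(2 * Real.pi) ^ 3 * ((∏ i, stdMoment (L.count i) : ℕ) : ℝ) := by
  simp only [monomial_mul_exp_eq]
  rw [integral_fintype_prod_volume_eq_prod
    (fun i x => x ^ L.count i * Real.exp (-(1 / 2) * x ^ 2))]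
  rw [Finset.prod_congr rfl fun i _ => integral_pow_mul_exp (List.count_le_length.trans hL)]
  rw [Finset.prod_mul_distrib]
  simp

/-- The density of the centred Gaussian with covariance matrix `M`. -/
noncomputable def gaussKernel (M : Matrix (Fin 3) (Fin 3) ℝ) (c : Fin 3 → ℝ) : ℝ :=
  1 / Real.sqrt ((2 * Real.pi) • M).det * Real.exp (-(1 / 2) * (c ⬝ᵥ Matrix.mulVec M⁻¹ c))

theorem integral_comp_matrix {A : Matrix (Fin 3) (Fin 3) ℝ} (hA : A.det ≠ 0)
    (H : (Fin 3 → ℝ) → ℝ) : ∫ x, H x = |A.det| * ∫ w, H (A.mulVec w) := by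
  have hinj : Function.Injective (Matrix.toLin' A) := by
    have := Matrix.mulVec_injective_iff_isUnit.2
      ((Matrix.isUnit_iff_isUnit_det A).2 (isUnit_iff_ne_zero.2 hA))
    simpa [Function.Injective, Matrix.toLin'_apply] using this
  have hemb : MeasurableEmbedding (Matrix.toLin' A) :=
    (LinearMap.continuous_on_pi _).measurableEmbedding hinj
  have h := hemb.integral_map (μ := volume) H
  rw [Real.map_matrix_volume_pi_eq_smul_volume_pi hA, integral_smul_measure,
    ENNReal.toReal_ofReal (abs_nonneg _), abs_inv, smul_eq_mul] at h
  have : ∫ w, H (A.mulVec w) = |A.det|⁻¹ * ∫ x, H x := h.symm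
  rw [this, ← mul_assoc, mul_inv_cancel₀ (abs_ne_zero.2 hA), one_mul]

/-- Whitening: integrals against a Gaussian density are integrals against the standard one. -/
theorem integral_gaussKernel {A : Matrix (Fin 3) (Fin 3) ℝ} (hA : A.det ≠ 0) (u : Vec)
    (F : (Fin 3 → ℝ) → ℝ) :
    ∫ v : Vec, F (fun j => v j - u j) * gaussKernel (A * A.transpose) (fun j => v j - u j)
      = (√(2 * Real.pi) ^ 3)⁻¹ * ∫ w, F (A.mulVec w) * Real.exp (-(1 / 2) * (w ⬝ᵥ w)) := by
  set H : (Fin 3 → ℝ) → ℝ := fun x => F x * gaussKernel (A * A.transpose) x with hH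
  have h1 : ∫ v : Vec, H (fun j => v j - u j) = ∫ x, H x := by
    have h2 := integral_sub_right_eq_self (μ := (volume : Measure Vec)) (fun v : Vec => H v.ofLp) u
    have h3 := (EuclideanSpace.volume_preserving_symm_measurableEquiv_toLp (Fin 3)).integral_comp' H
    exact h2.trans h3
  have hdet : Real.sqrt ((2 * Real.pi) • (A * A.transpose)).det = √(2 * Real.pi) ^ 3 * |A.det| := by
    rw [Matrix.det_smul, Matrix.det_mul, Matrix.det_transpose, Fintype.card_fin,
      Real.sqrt_mul (by positivity), Real.sqrt_mul_self_eq_abs]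
    congr 1
    rw [Real.sqrt_eq_iff_mul_self_eq (by positivity) (by positivity), ← mul_pow,
      Real.mul_self_sqrt (by positivity)]
  have hker : ∀ w, gaussKernel (A * A.transpose) (A.mulVec w)
      = (√(2 * Real.pi) ^ 3)⁻¹ * |A.det|⁻¹ * Real.exp (-(1 / 2) * (w ⬝ᵥ w)) := by
    intro w
    have hU : IsUnit A.det := isUnit_iff_ne_zero.2 hA
    have hU' : IsUnit A.transpose.det := by rwa [Matrix.det_transpose]
    have hq : A.mulVec w ⬝ᵥ Matrix.mulVec (A * A.transpose)⁻¹ (A.mulVec w) = w ⬝ᵥ w := by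
      rw [Matrix.mul_inv_rev, ← Matrix.mulVec_mulVec, Matrix.mulVec_mulVec w A⁻¹ A,
        Matrix.nonsing_inv_mul A hU, Matrix.one_mulVec, Matrix.dotProduct_mulVec,
        ← Matrix.mulVec_transpose, Matrix.mulVec_mulVec, Matrix.transpose_nonsing_inv,
        Matrix.transpose_transpose, Matrix.nonsing_inv_mul A hU, Matrix.one_mulVec]
    rw [gaussKernel, hdet, hq, one_div, mul_inv]
  calc _ = ∫ x, H x := h1
    _ = |A.det| * ∫ w, H (A.mulVec w) := integral_comp_matrix hA H
    _ = _ := by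
      simp only [hH, hker]
      rw [← integral_const_mul, ← integral_const_mul]
      congr 1
      funext w
      have : |A.det| ≠ 0 := abs_ne_zero.2 hA
      field_simp

/-- Factorization of a covariance matrix, to be used for whitening. -/
theorem exists_factor {M : Matrix (Fin 3) (Fin 3) ℝ} (hM : M.PosDef) :
    ∃ A : Matrix (Fin 3) (Fin 3) ℝ, A.det ≠ 0 ∧ M = A * A.transpose := by
  open scoped MatrixOrder in
  obtain ⟨B, hB⟩ := CStarAlgebra.nonneg_iff_eq_star_mul_self.mp hM.posSemidef.nonneg
  have hB' : M = B.transpose * B := by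
    rw [hB, Matrix.star_eq_conjTranspose, Matrix.conjTranspose_eq_transpose_of_trivial]
  refine ⟨B.transpose, fun h => ?_, by rw [Matrix.transpose_transpose, hB']⟩
  have := hM.det_pos
  rw [hB', Matrix.det_mul, h, zero_mul] at this
  exact lt_irrefl _ this

variable {M : Matrix (Fin 3) (Fin 3) ℝ}

theorem integral_gaussKernel_one (hM : M.PosDef) (u : Vec) :
    ∫ v : Vec, gaussKernel M (fun j => v j - u j) = 1 := by
  obtain ⟨A, hA, rfl⟩ := exists_factor hM
  have h := integral_gaussKernel hA u (fun _ => 1)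
  have h2 := integral_monomial [] (by simp)
  simp only [one_mul, List.map_nil, List.prod_nil, List.count_nil, stdMoment] at h h2
  have : √(2 * Real.pi) ^ 3 ≠ 0 := by positivity
  rw [h, h2]
  simpa using inv_mul_cancel₀ this

/-- Moments of odd polynomials vanish by symmetry. -/
theorem integral_gaussKernel_odd (hM : M.PosDef) (u : Vec) {F : (Fin 3 → ℝ) → ℝ}
    (hF : ∀ c, F (-c) = -F c) :
    ∫ v : Vec, F (fun j => v j - u j) * gaussKernel M (fun j => v j - u j) = 0 := by
  obtain ⟨A, hA, rfl⟩ := exists_factor hM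
  rw [integral_gaussKernel hA u F]
  have h := integral_neg_eq_self
    (fun w : Fin 3 → ℝ => F (A.mulVec w) * Real.exp (-(1 / 2) * (w ⬝ᵥ w))) volume
  simp only [Matrix.mulVec_neg, hF, neg_dotProduct, dotProduct_neg, neg_neg, neg_mul,
    integral_neg] at h ⊢
  have : ∫ w : Fin 3 → ℝ, F (A.mulVec w) * Real.exp (-(1 / 2 * (w ⬝ᵥ w))) = 0 := by linarith
  rw [this, mul_zero]

theorem integral_gaussKernel_two (hM : M.PosDef) (u : Vec) (j k : Fin 3) :
    ∫ v : Vec, (v j - u j) * (v k - u k) * gaussKernel M (fun j => v j - u j) = M j k := by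
  obtain ⟨A, hA, rfl⟩ := exists_factor hM
  rw [integral_gaussKernel hA u (fun c => c j * c k)]
  have hdec : ∀ a b : Fin 3, ∏ i, stdMoment ([a, b].count i) = if a = b then 1 else 0 := by decide
  have hexp : ∀ w : Fin 3 → ℝ, A.mulVec w j * A.mulVec w k * Real.exp (-(1 / 2) * (w ⬝ᵥ w))
      = ∑ a, ∑ b, A j a * A k b *
        (([a, b].map w).prod * Real.exp (-(1 / 2) * (w ⬝ᵥ w))) := by
    intro w
    rw [Matrix.mulVec, Matrix.mulVec, dotProduct, dotProduct, Finset.sum_mul_sum, Finset.sum_mul]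
    refine Finset.sum_congr rfl fun a _ => ?_
    rw [Finset.sum_mul]
    refine Finset.sum_congr rfl fun b _ => ?_
    simp only [List.map_cons, List.map_nil, List.prod_cons, List.prod_nil]
    ring
  simp only [hexp]
  rw [integral_finsetSum _ fun a _ => integrable_finsetSum _ fun b _ =>
    (integrable_monomial [a, b]).const_mul _]
  simp_rw [integral_finsetSum _ fun b _ => (integrable_monomial [_, b]).const_mul _,
    integral_const_mul, integral_monomial [_, _] (by simp : 2 ≤ 4), hdec]
  have : √(2 * Real.pi) ≠ 0 := by positivity
  simp only [Nat.cast_ite, Nat.cast_one, Nat.cast_zero, mul_ite, mul_one, mul_zero,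
    Finset.sum_ite_eq, Finset.mem_univ, if_true, Matrix.mul_apply, Matrix.transpose_apply]
  rw [← Finset.sum_mul, mul_comm, mul_assoc, mul_inv_cancel₀ (by positivity), mul_one]

/-- Isserlis' formula for the fourth moments. -/
theorem integral_gaussKernel_four (hM : M.PosDef) (u : Vec) (i j k l : Fin 3) :
    ∫ v : Vec, (v i - u i) * (v j - u j) * (v k - u k) * (v l - u l)
        * gaussKernel M (fun j => v j - u j)
      = M i j * M k l + M i k * M j l + M i l * M j k := by
  obtain ⟨A, hA, rfl⟩ := exists_factor hM
  rw [integral_gaussKernel hA u (fun c => c i * c j * c k * c l)]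
  have hdec : ∀ a b c d : Fin 3, ∏ i, stdMoment ([a, b, c, d].count i)
      = (if a = b then 1 else 0) * (if c = d then 1 else 0)
        + (if a = c then 1 else 0) * (if b = d then 1 else 0)
        + (if a = d then 1 else 0) * (if b = c then 1 else 0) := by decide
  have hexp : ∀ w : Fin 3 → ℝ, A.mulVec w i * A.mulVec w j * A.mulVec w k * A.mulVec w l
        * Real.exp (-(1 / 2) * (w ⬝ᵥ w))
      = ∑ a, ∑ b, ∑ c, ∑ d, A i a * A j b * A k c * A l d *
        (([a, b, c, d].map w).prod * Real.exp (-(1 / 2) * (w ⬝ᵥ w))) := by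
    intro w
    have e : ∀ a b c d, A i a * A j b * A k c * A l d *
        (([a, b, c, d].map w).prod * Real.exp (-(1 / 2) * (w ⬝ᵥ w)))
        = (A i a * w a) * (A j b * w b) * (A k c * w c) * (A l d * w d)
          * Real.exp (-(1 / 2) * (w ⬝ᵥ w)) := by
      intro a b c d
      simp only [List.map_cons, List.map_nil, List.prod_cons, List.prod_nil]
      ring
    simp only [e, ← Finset.sum_mul, ← Finset.mul_sum]
    rfl
  simp only [hexp]
  have hint : ∀ a b c d, Integrable fun w : Fin 3 → ℝ => A i a * A j b * A k c * A l d *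
      (([a, b, c, d].map w).prod * Real.exp (-(1 / 2) * (w ⬝ᵥ w))) := fun a b c d =>
    (integrable_monomial [a, b, c, d]).const_mul _
  have hval : ∀ a b c d, ∫ w : Fin 3 → ℝ, A i a * A j b * A k c * A l d *
      (([a, b, c, d].map w).prod * Real.exp (-(1 / 2) * (w ⬝ᵥ w)))
      = √(2 * Real.pi) ^ 3 * (A i a * A j b * A k c * A l d *
        ((if a = b then 1 else 0) * (if c = d then 1 else 0)
        + (if a = c then 1 else 0) * (if b = d then 1 else 0)
        + (if a = d then 1 else 0) * (if b = c then 1 else 0))) := by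
    intro a b c d
    rw [integral_const_mul, integral_monomial [a, b, c, d] le_rfl, hdec]
    push_cast
    ring
  rw [integral_finsetSum _ fun a _ => integrable_finsetSum _ fun b _ =>
    integrable_finsetSum _ fun c _ => integrable_finsetSum _ fun d _ => hint a b c d]
  simp_rw [integral_finsetSum _ fun b _ => integrable_finsetSum _ fun c _ =>
    integrable_finsetSum _ fun d _ => hint _ b c d,
    integral_finsetSum _ fun c _ => integrable_finsetSum _ fun d _ => hint _ _ c d,
    integral_finsetSum _ fun d _ => hint _ _ _ d, hval, ← Finset.mul_sum]
  have h3 : √(2 * Real.pi) ^ 3 ≠ 0 := by positivity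
  rw [← mul_assoc, inv_mul_cancel₀ h3, one_mul]
  simp only [mul_add, Finset.sum_add_distrib, mul_ite, mul_one, mul_zero,
    Finset.sum_ite_eq, Finset.sum_ite_irrel, Finset.sum_const_zero, Finset.mem_univ,
    if_true, Matrix.mul_apply, Matrix.transpose_apply, Finset.sum_mul_sum]
  refine congrArg₂ _ (congrArg₂ _ ?_ ?_) ?_ <;>
  exact Finset.sum_congr rfl fun a _ => Finset.sum_congr rfl fun b _ => by ring

end Gaussian

/-! ### Rotational and vibrational equilibrium distributions -/

/-- Density of the rotational energies: a Gamma distribution of shape `δ / 2` and scale `a`. -/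
noncomputable def rotKernel (δ a ε : ℝ) : ℝ :=
  1 / Real.Gamma (δ / 2) / a ^ (δ / 2) * ε ^ ((δ - 2) / 2) * Real.exp (-ε / a)

theorem integral_rotKernel {δ a : ℝ} (hδ : 0 < δ) (ha : 0 < a) :
    ∫ ε in Set.Ioi 0, rotKernel δ a ε = 1 := by
  have h := Real.integral_rpow_mul_exp_neg_mul_Ioi (a := δ / 2) (r := 1 / a) (by positivity)
    (by positivity)
  have e : ∀ ε, rotKernel δ a ε = 1 / Real.Gamma (δ / 2) / a ^ (δ / 2) *
      (ε ^ (δ / 2 - 1) * Real.exp (-(1 / a * ε))) := fun ε => by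
    rw [rotKernel, show (δ - 2) / 2 = δ / 2 - 1 by ring, show -ε / a = -(1 / a * ε) by ring]
    ring
  have hG := Real.Gamma_pos_of_pos (s := δ / 2) (by positivity)
  have hp : 0 < a ^ (δ / 2) := Real.rpow_pos_of_pos ha _
  simp only [e]
  rw [integral_const_mul, h, one_div_one_div]
  field_simp

theorem integral_mul_rotKernel {δ a : ℝ} (hδ : 0 < δ) (ha : 0 < a) :
    ∫ ε in Set.Ioi 0, ε * rotKernel δ a ε = δ / 2 * a := by
  have h := Real.integral_rpow_mul_exp_neg_mul_Ioi (a := δ / 2 + 1) (r := 1 / a) (by positivity)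
    (by positivity)
  have e : ∀ ε ∈ Set.Ioi (0 : ℝ), ε * rotKernel δ a ε = 1 / Real.Gamma (δ / 2) / a ^ (δ / 2) *
      (ε ^ (δ / 2 + 1 - 1) * Real.exp (-(1 / a * ε))) := fun ε hε => by
    have : ε ^ (δ / 2 + 1 - 1) = ε ^ ((δ - 2) / 2) * ε := by
      rw [← Real.rpow_add_one (ne_of_gt hε)]; congr 1; ring
    rw [rotKernel, this, show -ε / a = -(1 / a * ε) by ring]
    ring
  have hG := Real.Gamma_pos_of_pos (s := δ / 2) (by positivity)
  have hp : 0 < a ^ (δ / 2) := Real.rpow_pos_of_pos ha _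
  rw [setIntegral_congr_fun measurableSet_Ioi e, integral_const_mul, h, one_div_one_div,
    Real.Gamma_add_one (by positivity), Real.rpow_add_one ha.ne']
  field_simp

/-- The geometric distribution of the vibrational levels, with ratio `exp (-x)`. -/
noncomputable def vibKernel (x : ℝ) (i : ℕ) : ℝ := (1 - Real.exp (-x)) * Real.exp (-(i : ℝ) * x)

theorem vibKernel_eq (x : ℝ) (i : ℕ) : vibKernel x i = (1 - Real.exp (-x)) * Real.exp (-x) ^ i := by
  rw [vibKernel, ← Real.exp_nat_mul]
  congr 2
  ring

theorem norm_exp_neg_lt_one {x : ℝ} (hx : 0 < x) : ‖Real.exp (-x)‖ < 1 := by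
  rw [Real.norm_eq_abs, Real.abs_exp]
  exact Real.exp_lt_one_iff.2 (by linarith)

theorem integral_count_eq_tsum {F : ℕ → ℝ} (hF : Summable F) :
    ∫ i, F i ∂Measure.count = ∑' i, F i := by
  rw [integral_countable (integrable_count_iff.2 (by simpa using hF.norm))]
  simp

theorem integral_vibKernel {x : ℝ} (hx : 0 < x) : ∫ i, vibKernel x i ∂Measure.count = 1 := by
  have hr := norm_exp_neg_lt_one hx
  have hne : (1 - Real.exp (-x)) ≠ 0 := by
    have := Real.exp_lt_one_iff.2 (neg_lt_zero.2 hx)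
    linarith
  rw [integral_count_eq_tsum]
  · simp only [vibKernel_eq]
    rw [tsum_mul_left, tsum_geometric_of_norm_lt_one hr, mul_inv_cancel₀ hne]
  · exact ((summable_geometric_of_norm_lt_one hr).mul_left _).congr fun i => (vibKernel_eq x i).symm

theorem integral_mul_vibKernel {x : ℝ} (hx : 0 < x) :
    ∫ i : ℕ, (i : ℝ) * vibKernel x i ∂Measure.count = 1 / (Real.exp x - 1) := by
  have hr := norm_exp_neg_lt_one hx
  have hne : (1 - Real.exp (-x)) ≠ 0 := by
    have := Real.exp_lt_one_iff.2 (neg_lt_zero.2 hx)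
    linarith
  have hne' : Real.exp x - 1 ≠ 0 := by
    have := Real.one_lt_exp_iff.2 hx
    linarith
  have e : ∀ i : ℕ, (i : ℝ) * vibKernel x i
      = (1 - Real.exp (-x)) * ((i : ℝ) * Real.exp (-x) ^ i) := fun i => by
    rw [vibKernel_eq]; ring
  have hs := hasSum_coe_mul_geometric_of_norm_lt_one hr
  simp only [e]
  rw [integral_count_eq_tsum (hs.summable.mul_left _), tsum_mul_left, hs.tsum_eq]
  have hx' : Real.exp (-x) = (Real.exp x)⁻¹ := Real.exp_neg x
  have := (Real.exp_pos x).ne'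
  rw [hx'] at hne ⊢
  field_simp

/-! ### The energy functions and their inverses -/

section Energy

variable (P : Params)

theorem tempOf_spec {e : ℝ → ℝ} {E : ℝ} (h : ∃ T ∈ Set.Ioi (0 : ℝ), e T = E) :
    0 < tempOf e E ∧ e (tempOf e E) = E :=
  ⟨Function.invFunOn_mem h, Function.invFunOn_eq h⟩

theorem tempOf_eTr {E : ℝ} (hE : 0 < E) : P.R * tempOf (eTr P) E = 2 / 3 * E := by
  have hR := P.R_pos
  have h := (tempOf_spec (e := eTr P) (E := E) ⟨E / (3 / 2 * P.R), by simp only [Set.mem_Ioi]; positivity, by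
    rw [eTr]; field_simp⟩).2
  rw [eTr] at h
  linarith

theorem tempOf_eRot {E : ℝ} (hE : 0 < E) :
    0 < tempOf (eRot P) E ∧ P.δ / 2 * (P.R * tempOf (eRot P) E) = E := by
  have hR := P.R_pos
  have hδ := P.δ_pos
  have h := tempOf_spec (e := eRot P) (E := E) ⟨E / (P.δ / 2 * P.R), by simp only [Set.mem_Ioi]; positivity, by
    rw [eRot]; field_simp⟩
  rw [eRot] at h
  exact ⟨h.1, by linarith [h.2]⟩

theorem tempOf_eTrRot {E : ℝ} (hE : 0 < E) :
    P.R * tempOf (eTrRot P) E = 2 / (3 + P.δ) * E := by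
  have hR := P.R_pos
  have hδ := P.δ_pos
  have h := (tempOf_spec (e := eTrRot P) (E := E) ⟨E / ((3 + P.δ) / 2 * P.R), by
    simp only [Set.mem_Ioi]; positivity, by
    rw [eTrRot, eTr, eRot]; field_simp⟩).2
  rw [eTrRot, eTr, eRot] at h
  have h3 : (3 + P.δ) ≠ 0 := by positivity
  rw [div_mul_eq_mul_div, eq_div_iff h3]
  linarith

theorem tempOf_eVib {E : ℝ} (hE : 0 < E) :
    0 < tempOf (eVib P) E ∧ eVib P (tempOf (eVib P) E) = E := by
  have hR := P.R_pos
  have hT := P.T₀_pos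
  have hpos : 0 < P.R * P.T₀ / E := by positivity
  have hlog : 0 < Real.log (1 + P.R * P.T₀ / E) := Real.log_pos (by linarith)
  refine tempOf_spec ⟨P.T₀ / Real.log (1 + P.R * P.T₀ / E), by
    simp only [Set.mem_Ioi]; positivity, ?_⟩
  rw [eVib, div_div_cancel₀ hT.ne', Real.exp_log (by linarith)]
  field_simp
  simp

theorem exp_sub_one_pos {T : ℝ} (hT : 0 < T) : 0 < Real.exp (P.T₀ / T) - 1 := by
  have := Real.one_lt_exp_iff.2 (div_pos P.T₀_pos hT)
  linarith

theorem eVib_pos {T : ℝ} (hT : 0 < T) : 0 < eVib P T :=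
  div_pos (mul_pos P.R_pos P.T₀_pos) (exp_sub_one_pos P hT)

theorem eVib_le {T : ℝ} (hT : 0 < T) : eVib P T ≤ P.R * T := by
  have hR := P.R_pos
  have h := Real.add_one_le_exp (P.T₀ / T)
  rw [eVib, div_le_iff₀ (exp_sub_one_pos P hT)]
  calc P.R * P.T₀ = P.R * T * (P.T₀ / T) := by field_simp
    _ ≤ P.R * T * (Real.exp (P.T₀ / T) - 1) := by
      apply mul_le_mul_of_nonneg_left (by linarith) (by positivity)

theorem contDiffOn_eVib : ContDiffOn ℝ ∞ (eVib P) (Set.Ioi 0) := by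
  refine contDiffOn_const.div (((contDiffOn_const.div contDiffOn_id fun T hT => ne_of_gt hT).exp).sub
    contDiffOn_const) fun T hT => (exp_sub_one_pos P hT).ne'

theorem contDiffOn_eTot : ContDiffOn ℝ ∞ (eTot P) (Set.Ioi 0) := by
  refine ContDiffOn.add (ContDiffOn.add ?_ ?_) (contDiffOn_eVib P)
  · exact contDiffOn_const.mul contDiffOn_id
  · exact contDiffOn_const.mul contDiffOn_id

theorem differentiableAt_eVib {T : ℝ} (hT : 0 < T) : DifferentiableAt ℝ (eVib P) T :=
  ContDiffOn.differentiableAt_of_isOpen isOpen_Ioi (contDiffOn_eVib P) hT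

theorem strictMonoOn_eVib : StrictMonoOn (eVib P) (Set.Ioi 0) := by
  intro S hS T hT hST
  have hS' : (0 : ℝ) < S := hS
  refine div_lt_div_of_pos_left (mul_pos P.R_pos P.T₀_pos) (exp_sub_one_pos P hT) ?_
  have : P.T₀ / T < P.T₀ / S := div_lt_div_of_pos_left P.T₀_pos hS' hST
  have := Real.exp_lt_exp.2 this
  linarith

theorem deriv_eVib_nonneg {T : ℝ} (hT : 0 < T) : 0 ≤ deriv (eVib P) T := by
  rw [← derivWithin_of_isOpen isOpen_Ioi hT]
  exact (strictMonoOn_eVib P).monotoneOn.derivWithin_nonneg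

theorem hasDerivAt_eTot {T : ℝ} (hT : 0 < T) :
    HasDerivAt (eTot P) ((3 + P.δ) / 2 * P.R + deriv (eVib P) T) T := by
  have h1 : HasDerivAt (fun T => 3 / 2 * P.R * T + P.δ / 2 * P.R * T) ((3 + P.δ) / 2 * P.R) T := by
    have := ((hasDerivAt_id T).const_mul (3 / 2 * P.R)).add
      ((hasDerivAt_id T).const_mul (P.δ / 2 * P.R))
    refine this.congr_deriv ?_
    ring
  exact h1.add (differentiableAt_eVib P hT).hasDerivAt

theorem cv_eq {T : ℝ} (hT : 0 < T) : cv P T = (3 + P.δ) / 2 * P.R + deriv (eVib P) T :=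
  (hasDerivAt_eTot P hT).deriv

theorem cv_pos {T : ℝ} (hT : 0 < T) : 0 < cv P T := by
  have hR := P.R_pos
  have hδ := P.δ_pos
  rw [cv_eq P hT]
  have := deriv_eVib_nonneg P hT
  positivity

theorem cp_eq {T : ℝ} (hT : 0 < T) : cp P T = cv P T + P.R := by
  rw [cv_eq P hT, cp]
  have : HasDerivAt (enthalpy P) ((3 + P.δ) / 2 * P.R + deriv (eVib P) T + P.R) T := by
    have := (hasDerivAt_eTot P hT).add ((hasDerivAt_id T).const_mul P.R)
    exact this.congr_deriv (by simp)
  exact this.deriv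

theorem strictMonoOn_eTot : StrictMonoOn (eTot P) (Set.Ioi 0) := by
  intro S hS T hT hST
  have h := strictMonoOn_eVib P hS hT hST
  have hR := P.R_pos
  have hδ := P.δ_pos
  simp only [eTot, eTr, eRot]
  have h1 : 3 / 2 * P.R * S < 3 / 2 * P.R * T := mul_lt_mul_of_pos_left hST (by positivity)
  have h2 : P.δ / 2 * P.R * S < P.δ / 2 * P.R * T := mul_lt_mul_of_pos_left hST (by positivity)
  linarith

theorem le_eTot {T : ℝ} (hT : 0 < T) : 3 / 2 * P.R * T ≤ eTot P T := by
  have hR := P.R_pos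
  have hδ := P.δ_pos
  have := eVib_pos P hT
  have : 0 < P.δ / 2 * P.R * T := by positivity
  simp only [eTot, eTr, eRot]
  linarith

theorem tempOf_eTot {E : ℝ} (hE : 0 < E) :
    0 < tempOf (eTot P) E ∧ eTot P (tempOf (eTot P) E) = E := by
  have hR := P.R_pos
  have hδ := P.δ_pos
  refine tempOf_spec ?_
  set T₁ := E / ((5 + P.δ) / 2 * P.R) with hT₁
  set T₂ := E / (3 / 2 * P.R) with hT₂
  have h1 : 0 < T₁ := by positivity
  have h2 : 0 < T₂ := by positivity
  have h12 : T₁ ≤ T₂ := by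
    apply div_le_div_of_nonneg_left hE.le (by positivity)
    apply mul_le_mul_of_nonneg_right (by linarith) hR.le
  have e1 : eTot P T₁ ≤ E := by
    have h3 : (5 + P.δ) / 2 * P.R * T₁ = E := by rw [hT₁]; field_simp
    have := eVib_le P h1
    simp only [eTot, eTr, eRot]
    linarith
  have e2 : E ≤ eTot P T₂ := by
    have h3 : 3 / 2 * P.R * T₂ = E := by rw [hT₂]; field_simp
    linarith [le_eTot P h2]
  have hc : ContinuousOn (eTot P) (Set.Icc T₁ T₂) :=
    (contDiffOn_eTot P).continuousOn.mono fun T hT => h1.trans_le hT.1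
  obtain ⟨T, hT, hTE⟩ := intermediate_value_Icc h12 hc ⟨e1, e2⟩
  exact ⟨T, h1.trans_le hT.1, hTE⟩

theorem contDiffOn_tempOf_eTot : ContDiffOn ℝ ∞ (tempOf (eTot P)) (Set.Ioi 0) := by
  intro E hE
  refine ContDiffAt.contDiffWithinAt ?_
  obtain ⟨hT, hTE⟩ := tempOf_eTot P hE
  set T := tempOf (eTot P) E with hTdef
  have hcd : ContDiffAt ℝ ∞ (eTot P) T := (contDiffOn_eTot P).contDiffAt (isOpen_Ioi.mem_nhds hT)
  have hder := hasDerivAt_eTot P hT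
  have hne : (3 + P.δ) / 2 * P.R + deriv (eVib P) T ≠ 0 := by
    rw [← cv_eq P hT]; exact (cv_pos P hT).ne'
  set f' : ℝ ≃L[ℝ] ℝ := ContinuousLinearEquiv.unitsEquivAut ℝ (Units.mk0 _ hne) with hf'
  have hf : HasFDerivAt (eTot P) (f' : ℝ →L[ℝ] ℝ) T := by
    have e : (f' : ℝ →L[ℝ] ℝ)
        = ContinuousLinearMap.toSpanSingleton ℝ ((3 + P.δ) / 2 * P.R + deriv (eVib P) T) := by
      ext
      simp [hf']
    rw [e]
    exact hder.hasFDerivAt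
  have hloc := hcd.to_localInverse hf (by simp)
  rw [hTE] at hloc
  refine hloc.congr_of_eventuallyEq ?_
  have hs : HasStrictFDerivAt (eTot P) (f' : ℝ →L[ℝ] ℝ) T := hcd.hasStrictFDerivAt' hf (by simp)
  have hright := hs.eventually_right_inverse
  rw [hTE] at hright
  have hval : hcd.localInverse hf (by simp) E = T := by
    have := hcd.localInverse_apply_image hf (by simp)
    rwa [hTE] at this
  have hpos : ∀ᶠ E' in nhds E, 0 < hcd.localInverse hf (by simp) E' := by
    have := hloc.continuousAt
    rw [ContinuousAt, hval] at this
    exact this.eventually (isOpen_Ioi.mem_nhds hT)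
  filter_upwards [hright, hpos, isOpen_Ioi.mem_nhds hE] with E' h1 h2 h3
  obtain ⟨h4, h5⟩ := tempOf_eTot P h3
  exact (strictMonoOn_eTot P).injOn h4 h2 (h5.trans h1.symm)

end Energy

/-! ### Congruence up to powers of the small parameter -/

section Cong

variable {ι E : Type*} [NormedAddCommGroup E] [NormedSpace ℝ E] {Ω : Set E} {ε : ι → ℝ} {n : ℕ}

/-- Equality of two uniformly smooth families up to `O(εⁿ)`, with all derivatives. It is a
congruence for sums, products and derivatives. -/
structure CongOrder (Ω : Set E) (ε : ι → ℝ) (n : ℕ) (a b : ι → E → ℝ) : Prop where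
  left : UnifSmooth Ω a
  right : UnifSmooth Ω b
  order : IsOrder Ω ε n (fun i z => a i z - b i z)

namespace CongOrder

variable {a b c d : ι → E → ℝ}

theorem refl (ha : UnifSmooth Ω a) : CongOrder Ω ε n a a :=
  ⟨ha, ha, ⟨_, UnifSmooth.const' 0, fun i z _ => by simp⟩⟩

theorem add (hΩ : IsOpen Ω) (h : CongOrder Ω ε n a b) (h' : CongOrder Ω ε n c d) :
    CongOrder Ω ε n (fun i z => a i z + c i z) (fun i z => b i z + d i z) :=
  ⟨h.left.add hΩ h'.left, h.right.add hΩ h'.right,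
    (h.order.add hΩ h'.order).congr fun _ _ _ => by ring⟩

theorem mul (hΩ : IsOpen Ω) (h : CongOrder Ω ε n a b) (h' : CongOrder Ω ε n c d) :
    CongOrder Ω ε n (fun i z => a i z * c i z) (fun i z => b i z * d i z) :=
  ⟨h.left.mul hΩ h'.left, h.right.mul hΩ h'.right,
    ((h.order.mul_left hΩ h'.left).add hΩ (h'.order.mul_left hΩ h.right)).congr
      fun _ _ _ => by ring⟩

theorem const_mul (hΩ : IsOpen Ω) (r : ℝ) (h : CongOrder Ω ε n a b) :
    CongOrder Ω ε n (fun i z => r * a i z) (fun i z => r * b i z) :=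
  (refl (UnifSmooth.const' r)).mul hΩ h

theorem sum (hΩ : IsOpen Ω) {κ : Type*} {s : Finset κ} {a b : κ → ι → E → ℝ}
    (h : ∀ k ∈ s, CongOrder Ω ε n (a k) (b k)) :
    CongOrder Ω ε n (fun i z => ∑ k ∈ s, a k i z) (fun i z => ∑ k ∈ s, b k i z) :=
  ⟨UnifSmooth.sum hΩ fun k hk => (h k hk).left, UnifSmooth.sum hΩ fun k hk => (h k hk).right,
    (IsOrder.sum hΩ fun k hk => (h k hk).order).congr fun _ _ _ => by
      rw [Finset.sum_sub_distrib]⟩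

theorem dirDeriv (hΩ : IsOpen Ω) (h : CongOrder Ω ε n a b) (w : E) :
    CongOrder Ω ε n (fun i => dirDeriv w (a i)) (fun i => dirDeriv w (b i)) :=
  ⟨h.left.dirDeriv hΩ w, h.right.dirDeriv hΩ w, (h.order.dirDeriv hΩ w).congr fun i _ hz =>
    dirDeriv_fun_sub (h.left.differentiableAt hΩ i hz) (h.right.differentiableAt hΩ i hz) w⟩

theorem congr (hΩ : IsOpen Ω) (h : CongOrder Ω ε n a b) (hac : ∀ i, ∀ z ∈ Ω, a i z = c i z)
    (hbd : ∀ i, ∀ z ∈ Ω, b i z = d i z) : CongOrder Ω ε n c d :=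
  ⟨h.left.congr hΩ hac, h.right.congr hΩ hbd, h.order.congr fun i z hz => by
    rw [hac i z hz, hbd i z hz]⟩

theorem trans (hΩ : IsOpen Ω) (h : CongOrder Ω ε n a b) (h' : CongOrder Ω ε n b c) :
    CongOrder Ω ε n a c :=
  ⟨h.left, h'.right, (h.order.add hΩ h'.order).congr fun _ _ _ => by ring⟩

theorem zero (ha : UnifSmooth Ω a) (h : IsOrder Ω ε n a) : CongOrder Ω ε n a (fun _ _ => 0) :=
  ⟨ha, UnifSmooth.const' 0, h.congr fun _ _ _ => by ring⟩

end CongOrder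

end Cong

/-! ### The system of moment equations -/

section Moments

/-- The average `∂ₜ a + ∇ · (u a + w)` of `∂ₜ g + v · ∇g`, where `a = ⟨g⟩` and `w = ⟨(v - u) g⟩`. -/
noncomputable def transport (u : Fin 3 → SpaceTime → ℝ) (a : SpaceTime → ℝ)
    (w : Fin 3 → SpaceTime → ℝ) (z : SpaceTime) : ℝ :=
  dt a z + ∑ l, dx l (fun z' => u l z' * a z' + w l z') z

/-- The derivative `∂ₜ a + u · ∇a` along the mean flow. -/
noncomputable def materialDeriv (u : Fin 3 → SpaceTime → ℝ) (a : SpaceTime → ℝ)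
    (z : SpaceTime) : ℝ := dt a z + ∑ l, u l z * dx l a z

/-- Macroscopic consequences of the kinetic equation: conservation laws, and exact relaxation
equations for stress, rotational and vibrational energy and heat flux. The fields `S`, `Q`, `q`,
`qrot`, `qvib`, `M` are the moments of `f` with weights `c ⊗ c`, `c ⊗ c ⊗ c`, `η c`, `ε c`,
`i R T₀ c`, `η c ⊗ c`, where `c = v - u` and `η = |c|² / 2 + ε + i R T₀`. -/
structure MomentSystem {ι : Type*} (P : Params) (Ω : Set SpaceTime) (ε : ι → ℝ) where
  ρ : ι → SpaceTime → ℝ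
  T : ι → SpaceTime → ℝ
  Etr : ι → SpaceTime → ℝ
  Erot : ι → SpaceTime → ℝ
  Evib : ι → SpaceTime → ℝ
  u : Fin 3 → ι → SpaceTime → ℝ
  S : Fin 3 → Fin 3 → ι → SpaceTime → ℝ
  Q : Fin 3 → Fin 3 → Fin 3 → ι → SpaceTime → ℝ
  q : Fin 3 → ι → SpaceTime → ℝ
  qrot : Fin 3 → ι → SpaceTime → ℝ
  qvib : Fin 3 → ι → SpaceTime → ℝ
  M : Fin 3 → Fin 3 → ι → SpaceTime → ℝ
  /-- covariance tensor of the Gaussian -/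
  Cov : Fin 3 → Fin 3 → ι → SpaceTime → ℝ
  /-- rotational energy of the Gaussian -/
  rotRel : ι → SpaceTime → ℝ
  /-- vibrational energy of the Gaussian -/
  vibRel : ι → SpaceTime → ℝ
  isOpen : IsOpen Ω
  ε_bdd : ∃ K, ∀ i, |ε i| ≤ K
  lower : ∃ c > 0, ∀ i, ∀ z ∈ Ω, c ≤ ρ i z ∧ c ≤ T i z
  smooth_ρ : UnifSmooth Ω ρ
  smooth_T : UnifSmooth Ω T
  smooth_Erot : UnifSmooth Ω Erot
  smooth_Evib : UnifSmooth Ω Evib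
  smooth_u : ∀ j, UnifSmooth Ω (u j)
  smooth_S : ∀ j k, UnifSmooth Ω (S j k)
  smooth_Q : ∀ j k l, UnifSmooth Ω (Q j k l)
  smooth_q : ∀ j, UnifSmooth Ω (q j)
  smooth_qrot : ∀ j, UnifSmooth Ω (qrot j)
  smooth_qvib : ∀ j, UnifSmooth Ω (qvib j)
  smooth_M : ∀ j k, UnifSmooth Ω (M j k)
  mass : ∀ i, ∀ z ∈ Ω, dt (ρ i) z + ∑ l, dx l (fun z' => u l i z' * ρ i z') z = 0
  momentum : ∀ i, ∀ z ∈ Ω, ∀ j, ρ i z * materialDeriv (fun l => u l i) (u j i) z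
    + ∑ l, dx l (S j l i) z = 0
  energy : ∀ i, ∀ z ∈ Ω, transport (fun l => u l i) (fun z' => ρ i z' * eTot P (T i z'))
    (fun l => q l i) z + ∑ j, ∑ l, S j l i z * dx l (u j i) z = 0
  energy_split : ∀ i, ∀ z ∈ Ω, Etr i z + Erot i z + Evib i z = eTot P (T i z)
  cov_eq : ∀ i, ∀ z ∈ Ω, ∀ j k, ρ i z * Cov j k i z
    = ρ i z * (P.Γ (ρ i z, T i z) * P.R * T i z + (1 - P.Γ (ρ i z, T i z)) *
        (P.θ (ρ i z, T i z) * (2 / (3 + P.δ) * (Etr i z + Erot i z))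
          + (1 - P.θ (ρ i z, T i z)) * (1 - P.ν (ρ i z, T i z)) * (2 / 3 * Etr i z)))
        * (1 : Matrix (Fin 3) (Fin 3) ℝ) j k
      + (1 - P.Γ (ρ i z, T i z)) * (1 - P.θ (ρ i z, T i z)) * P.ν (ρ i z, T i z) * S j k i z
  rotRel_eq : ∀ i, ∀ z ∈ Ω, rotRel i z = P.Γ (ρ i z, T i z) * (P.δ / 2 * P.R * T i z)
    + (1 - P.Γ (ρ i z, T i z)) * (P.θ (ρ i z, T i z) * (P.δ / (3 + P.δ) * (Etr i z + Erot i z))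
      + (1 - P.θ (ρ i z, T i z)) * Erot i z)
  vibRel_eq : ∀ i, ∀ z ∈ Ω, vibRel i z = P.Γ (ρ i z, T i z) * eVib P (T i z)
    + (1 - P.Γ (ρ i z, T i z)) * Evib i z
  relax_S : ∀ i, ∀ z ∈ Ω, ∀ j k, S j k i z = ρ i z * Cov j k i z - ε i * P.τ (ρ i z, T i z) *
    (transport (fun l => u l i) (S j k i) (fun l => Q l j k i) z
      + ∑ l, (dx l (u j i) z * S l k i z + dx l (u k i) z * S l j i z))
  relax_rot : ∀ i, ∀ z ∈ Ω, ρ i z * Erot i z = ρ i z * rotRel i z - ε i * P.τ (ρ i z, T i z) *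
    transport (fun l => u l i) (fun z' => ρ i z' * Erot i z') (fun l => qrot l i) z
  relax_vib : ∀ i, ∀ z ∈ Ω, ρ i z * Evib i z = ρ i z * vibRel i z - ε i * P.τ (ρ i z, T i z) *
    transport (fun l => u l i) (fun z' => ρ i z' * Evib i z') (fun l => qvib l i) z
  relax_q : ∀ i, ∀ z ∈ Ω, ∀ j, q j i z = -(ε i * P.τ (ρ i z, T i z) *
    (transport (fun l => u l i) (q j i) (fun l => M l j i) z
      + ∑ l, (materialDeriv (fun m => u m i) (u l i) z * S l j i z
          + ∑ k, dx k (u l i) z * Q k l j i z)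
      + (materialDeriv (fun m => u m i) (u j i) z * (ρ i z * eTot P (T i z))
          + ∑ k, dx k (u j i) z * q k i z)))
  order_Q : ∀ j k l, IsOrder Ω ε 1 (Q j k l)
  order_qrot : ∀ j, IsOrder Ω ε 1 (qrot j)
  order_qvib : ∀ j, IsOrder Ω ε 1 (qvib j)
  order_M : ∀ j k, IsOrder Ω ε 1 (fun i z => M j k i z
    - ρ i z * (1 / 2 * ∑ l, (Cov l l i z * Cov j k i z + 2 * (Cov l j i z * Cov l k i z))
      + (rotRel i z + vibRel i z) * Cov j k i z))

namespace MomentSystem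

variable {ι : Type*} {P : Params} {Ω : Set SpaceTime} {ε : ι → ℝ} (m : MomentSystem P Ω ε)

include m

theorem ρ_pos (i : ι) {z : SpaceTime} (hz : z ∈ Ω) : 0 < m.ρ i z := by
  obtain ⟨c, hc, h⟩ := m.lower
  exact hc.trans_le (h i z hz).1

theorem T_pos (i : ι) {z : SpaceTime} (hz : z ∈ Ω) : 0 < m.T i z := by
  obtain ⟨c, hc, h⟩ := m.lower
  exact hc.trans_le (h i z hz).2

theorem smooth_param {φ : ℝ × ℝ → ℝ}
    (hφ : ContDiffOn ℝ ∞ φ (Set.Ioi (0 : ℝ) ×ˢ Set.Ioi (0 : ℝ))) :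
    UnifSmooth Ω (fun i z => φ (m.ρ i z, m.T i z)) := by
  obtain ⟨c, hc, h⟩ := m.lower
  obtain ⟨C, hC⟩ := m.smooth_ρ.bdd 0
  obtain ⟨D, hD⟩ := m.smooth_T.bdd 0
  exact UnifSmooth.comp₂ m.isOpen (isOpen_Ioi.prod isOpen_Ioi)
    (isCompact_Icc.prod (isCompact_Icc (a := c) (b := D)))
    (Set.prod_mono (fun x (hx : x ∈ Set.Icc c C) => hc.trans_le hx.1)
      fun x hx => hc.trans_le hx.1) hφ m.smooth_ρ m.smooth_T fun i z hz =>
    ⟨⟨(h i z hz).1, (le_abs_self _).trans (hC i z hz)⟩,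
      ⟨(h i z hz).2, (le_abs_self _).trans (hD i z hz)⟩⟩

theorem smooth_comp_T {φ : ℝ → ℝ} (hφ : ContDiffOn ℝ ∞ φ (Set.Ioi (0 : ℝ))) :
    UnifSmooth Ω (fun i z => φ (m.T i z)) :=
  m.smooth_param (hφ.comp contDiffOn_snd fun _ h => h.2)

end MomentSystem

end Moments

/-! ### First-order expansion of the moments -/

section Expansion

variable {ι : Type*} {P : Params} {Ω : Set SpaceTime} {ε : ι → ℝ}

theorem UnifSmooth.dt (hΩ : IsOpen Ω) {a : ι → SpaceTime → ℝ} (ha : UnifSmooth Ω a) :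
    UnifSmooth Ω (fun i => dt (a i)) := ha.dirDeriv hΩ _

theorem UnifSmooth.dx (hΩ : IsOpen Ω) {a : ι → SpaceTime → ℝ} (ha : UnifSmooth Ω a) (k : Fin 3) :
    UnifSmooth Ω (fun i => dx k (a i)) := ha.dirDeriv hΩ _

theorem CongOrder.dt (hΩ : IsOpen Ω) {n : ℕ} {a b : ι → SpaceTime → ℝ}
    (h : CongOrder Ω ε n a b) : CongOrder Ω ε n (fun i => dt (a i)) (fun i => dt (b i)) :=
  h.dirDeriv hΩ _

theorem CongOrder.dx (hΩ : IsOpen Ω) {n : ℕ} {a b : ι → SpaceTime → ℝ}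
    (h : CongOrder Ω ε n a b) (k : Fin 3) :
    CongOrder Ω ε n (fun i => dx k (a i)) (fun i => dx k (b i)) := h.dirDeriv hΩ _

theorem CongOrder.transport (hΩ : IsOpen Ω) {n : ℕ} {u : Fin 3 → ι → SpaceTime → ℝ}
    (hu : ∀ l, UnifSmooth Ω (u l)) {a b : ι → SpaceTime → ℝ} {w w' : Fin 3 → ι → SpaceTime → ℝ}
    (h : CongOrder Ω ε n a b) (hw : ∀ l, CongOrder Ω ε n (w l) (w' l)) :
    CongOrder Ω ε n (fun i => transport (fun l => u l i) (a i) (fun l => w l i))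
      (fun i => transport (fun l => u l i) (b i) (fun l => w' l i)) :=
  (h.dt hΩ).add hΩ (CongOrder.sum hΩ fun l _ =>
    (((CongOrder.refl (hu l)).mul hΩ h).add hΩ (hw l)).dx hΩ l)

theorem UnifSmooth.transport (hΩ : IsOpen Ω) {u : Fin 3 → ι → SpaceTime → ℝ}
    (hu : ∀ l, UnifSmooth Ω (u l)) {a : ι → SpaceTime → ℝ} {w : Fin 3 → ι → SpaceTime → ℝ}
    (h : UnifSmooth Ω a) (hw : ∀ l, UnifSmooth Ω (w l)) :
    UnifSmooth Ω (fun i => transport (fun l => u l i) (a i) (fun l => w l i)) :=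
  (CongOrder.transport (ε := fun _ => 0) (n := 0) hΩ hu (CongOrder.refl h)
    fun l => CongOrder.refl (hw l)).left

theorem UnifSmooth.materialDeriv (hΩ : IsOpen Ω) {u : Fin 3 → ι → SpaceTime → ℝ}
    (hu : ∀ l, UnifSmooth Ω (u l)) {a : ι → SpaceTime → ℝ} (h : UnifSmooth Ω a) :
    UnifSmooth Ω (fun i => materialDeriv (fun l => u l i) (a i)) :=
  (h.dt hΩ).add hΩ (UnifSmooth.sum hΩ fun l _ => (hu l).mul hΩ (h.dx hΩ l))

theorem IsOrder.of_eq {n : ℕ} {a b : ι → SpaceTime → ℝ} (hb : UnifSmooth Ω b)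
    (h : ∀ i, ∀ z ∈ Ω, a i z = ε i ^ n * b i z) : IsOrder Ω ε n a := ⟨b, hb, h⟩

/-- The coefficient `1 - (1 - Γ)(1 - θ)` of the relaxation of the rotational energy. -/
def relRot (P : Params) (s : ℝ × ℝ) : ℝ := 1 - (1 - P.Γ s) * (1 - P.θ s)

/-- The coefficient `1 - (1 - Γ)(1 - θ) ν` of the relaxation of the stress. -/
def relStress (P : Params) (s : ℝ × ℝ) : ℝ := 1 - (1 - P.Γ s) * (1 - P.θ s) * P.ν s

theorem relRot_pos {s : ℝ × ℝ} (hs : s ∈ Set.Ioi (0 : ℝ) ×ˢ Set.Ioi (0 : ℝ)) :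
    0 < relRot P s := by
  have h1 := P.Γ_mem s hs
  have h2 := P.θ_mem s hs
  rw [relRot]
  nlinarith [mul_nonneg (sub_nonneg.2 h1.2.le) h2.1]

theorem relStress_pos {s : ℝ × ℝ} (hs : s ∈ Set.Ioi (0 : ℝ) ×ˢ Set.Ioi (0 : ℝ)) :
    0 < relStress P s := by
  have h0 := relRot_pos (P := P) hs
  have h1 := P.Γ_mem s hs
  have h2 := P.θ_mem s hs
  have h3 := P.ν_mem s hs
  have h4 : 0 < (1 - P.Γ s) * (1 - P.θ s) := mul_pos (by linarith) (by linarith)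
  rw [relRot] at h0
  rw [relStress]
  nlinarith [mul_pos h4 (sub_pos.2 h3.2)]

theorem contDiffOn_relRot :
    ContDiffOn ℝ ∞ (relRot P) (Set.Ioi (0 : ℝ) ×ˢ Set.Ioi (0 : ℝ)) :=
  contDiffOn_const.sub ((contDiffOn_const.sub P.Γ_smooth).mul (contDiffOn_const.sub P.θ_smooth))

theorem contDiffOn_relStress :
    ContDiffOn ℝ ∞ (relStress P) (Set.Ioi (0 : ℝ) ×ˢ Set.Ioi (0 : ℝ)) :=
  contDiffOn_const.sub
    (((contDiffOn_const.sub P.Γ_smooth).mul (contDiffOn_const.sub P.θ_smooth)).mul P.ν_smooth)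

theorem contDiffOn_deriv_of_Ioi {φ : ℝ → ℝ} (h : ContDiffOn ℝ ∞ φ (Set.Ioi 0)) :
    ContDiffOn ℝ ∞ (deriv φ) (Set.Ioi 0) :=
  h.deriv_of_isOpen isOpen_Ioi (by simp)

namespace MomentSystem

variable (m : MomentSystem P Ω ε)

/-- The pair of density and temperature on which the coefficients depend. -/
abbrev st (i : ι) (z : SpaceTime) : ℝ × ℝ := (m.ρ i z, m.T i z)

/-- The average of `i R T₀ (∂ₜ f + v · ∇f)`. -/
noncomputable def Avib (i : ι) : SpaceTime → ℝ :=
  transport (fun l => m.u l i) (fun z' => m.ρ i z' * m.Evib i z') (fun l => m.qvib l i)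

/-- The average of `ε (∂ₜ f + v · ∇f)`. -/
noncomputable def Arot (i : ι) : SpaceTime → ℝ :=
  transport (fun l => m.u l i) (fun z' => m.ρ i z' * m.Erot i z') (fun l => m.qrot l i)

/-- The average of `c ⊗ c (∂ₜ f + v · ∇f)`. -/
noncomputable def AS (j k : Fin 3) (i : ι) (z : SpaceTime) : ℝ :=
  transport (fun l => m.u l i) (m.S j k i) (fun l => m.Q l j k i) z
    + ∑ l, (dx l (m.u j i) z * m.S l k i z + dx l (m.u k i) z * m.S l j i z)

/-- The average of `η c (∂ₜ f + v · ∇f)`. -/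
noncomputable def Aq (j : Fin 3) (i : ι) (z : SpaceTime) : ℝ :=
  transport (fun l => m.u l i) (m.q j i) (fun l => m.M l j i) z
    + ∑ l, (materialDeriv (fun k => m.u k i) (m.u l i) z * m.S l j i z
          + ∑ k, dx k (m.u l i) z * m.Q k l j i z)
    + (materialDeriv (fun k => m.u k i) (m.u j i) z * (m.ρ i z * eTot P (m.T i z))
          + ∑ k, dx k (m.u j i) z * m.q k i z)

/-- The divergence of the mean velocity. -/
noncomputable def divu (i : ι) (z : SpaceTime) : ℝ := ∑ l, dx l (m.u l i) z

theorem st_mem (i : ι) {z : SpaceTime} (hz : z ∈ Ω) :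
    m.st i z ∈ Set.Ioi (0 : ℝ) ×ˢ Set.Ioi (0 : ℝ) := ⟨m.ρ_pos i hz, m.T_pos i hz⟩

theorem smooth_ρ_inv : UnifSmooth Ω (fun i z => (m.ρ i z)⁻¹) :=
  m.smooth_param (φ := fun s => s.1⁻¹) (contDiffOn_fst.inv fun _ h => ne_of_gt h.1)

theorem smooth_Γ_inv : UnifSmooth Ω (fun i z => (P.Γ (m.st i z))⁻¹) :=
  m.smooth_param (φ := fun s => (P.Γ s)⁻¹) (P.Γ_smooth.inv fun s hs => (P.Γ_mem s hs).1.ne')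

theorem smooth_relRot_inv : UnifSmooth Ω (fun i z => (relRot P (m.st i z))⁻¹) :=
  m.smooth_param (φ := fun s => (relRot P s)⁻¹)
    (contDiffOn_relRot.inv fun _ hs => (relRot_pos hs).ne')

theorem smooth_relStress_inv : UnifSmooth Ω (fun i z => (relStress P (m.st i z))⁻¹) :=
  m.smooth_param (φ := fun s => (relStress P s)⁻¹)
    (contDiffOn_relStress.inv fun _ hs => (relStress_pos hs).ne')

theorem smooth_τ : UnifSmooth Ω (fun i z => P.τ (m.st i z)) := m.smooth_param P.τ_smooth
theorem smooth_Γ : UnifSmooth Ω (fun i z => P.Γ (m.st i z)) := m.smooth_param P.Γ_smooth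
theorem smooth_θ : UnifSmooth Ω (fun i z => P.θ (m.st i z)) := m.smooth_param P.θ_smooth
theorem smooth_ν : UnifSmooth Ω (fun i z => P.ν (m.st i z)) := m.smooth_param P.ν_smooth

theorem smooth_cv_inv : UnifSmooth Ω (fun i z => (cv P (m.T i z))⁻¹) :=
  m.smooth_comp_T (φ := fun T => (cv P T)⁻¹)
    ((contDiffOn_deriv_of_Ioi (contDiffOn_eTot P)).inv fun _ hT => (cv_pos P hT).ne')

theorem smooth_Avib : UnifSmooth Ω m.Avib :=
  UnifSmooth.transport m.isOpen m.smooth_u (m.smooth_ρ.mul m.isOpen m.smooth_Evib) m.smooth_qvib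

theorem smooth_Arot : UnifSmooth Ω m.Arot :=
  UnifSmooth.transport m.isOpen m.smooth_u (m.smooth_ρ.mul m.isOpen m.smooth_Erot) m.smooth_qrot

theorem smooth_AS (j k : Fin 3) : UnifSmooth Ω (m.AS j k) :=
  (UnifSmooth.transport m.isOpen m.smooth_u (m.smooth_S j k) fun l => m.smooth_Q l j k).add
    m.isOpen (UnifSmooth.sum m.isOpen fun l _ =>
      (((m.smooth_u j).dx m.isOpen l).mul m.isOpen (m.smooth_S l k)).add m.isOpen
        (((m.smooth_u k).dx m.isOpen l).mul m.isOpen (m.smooth_S l j)))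

theorem smooth_eTot : UnifSmooth Ω (fun i z => eTot P (m.T i z)) :=
  m.smooth_comp_T (contDiffOn_eTot P)

theorem smooth_eVib : UnifSmooth Ω (fun i z => eVib P (m.T i z)) :=
  m.smooth_comp_T (contDiffOn_eVib P)

theorem smooth_Aq (j : Fin 3) : UnifSmooth Ω (m.Aq j) :=
  ((UnifSmooth.transport m.isOpen m.smooth_u (m.smooth_q j) fun l => m.smooth_M l j).add
    m.isOpen (UnifSmooth.sum m.isOpen fun l _ =>
      ((UnifSmooth.materialDeriv m.isOpen m.smooth_u (m.smooth_u l)).mul m.isOpen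
        (m.smooth_S l j)).add m.isOpen (UnifSmooth.sum m.isOpen fun k _ =>
          ((m.smooth_u l).dx m.isOpen k).mul m.isOpen (m.smooth_Q k l j)))).add m.isOpen
    (((UnifSmooth.materialDeriv m.isOpen m.smooth_u (m.smooth_u j)).mul m.isOpen
      (m.smooth_ρ.mul m.isOpen m.smooth_eTot)).add m.isOpen (UnifSmooth.sum m.isOpen fun k _ =>
        ((m.smooth_u j).dx m.isOpen k).mul m.isOpen (m.smooth_q k)))

/-- Deviation of the vibrational energy from equilibrium. -/
theorem vib_deviation (i : ι) {z : SpaceTime} (hz : z ∈ Ω) :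
    m.Evib i z - eVib P (m.T i z)
      = -(ε i * (P.τ (m.st i z) * (P.Γ (m.st i z))⁻¹ * (m.ρ i z)⁻¹ * m.Avib i z)) := by
  have h1 := m.relax_vib i z hz
  rw [m.vibRel_eq i z hz] at h1
  have hΓ := (P.Γ_mem _ (m.st_mem i hz)).1.ne'
  have hρ := (m.ρ_pos i hz).ne'
  change _ = _ - ε i * P.τ (m.st i z) * m.Avib i z at h1
  field_simp
  linarith

/-- Deviation of the rotational energy from equilibrium. -/
theorem rot_deviation (i : ι) {z : SpaceTime} (hz : z ∈ Ω) :
    m.Erot i z - P.δ / 2 * P.R * m.T i z = (relRot P (m.st i z))⁻¹ *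
      (-((1 - P.Γ (m.st i z)) * P.θ (m.st i z) * (P.δ / (3 + P.δ))
        * (m.Evib i z - eVib P (m.T i z)))
        - ε i * (P.τ (m.st i z) * (m.ρ i z)⁻¹ * m.Arot i z)) := by
  have h1 := m.relax_rot i z hz
  have h2 := m.energy_split i z hz
  rw [m.rotRel_eq i z hz] at h1
  have ha := (relRot_pos (P := P) (m.st_mem i hz)).ne'
  have hρ := (m.ρ_pos i hz).ne'
  have hδ := P.δ_pos
  have h3 : 3 + P.δ ≠ 0 := by positivity
  change _ = _ - ε i * P.τ (m.st i z) * m.Arot i z at h1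
  simp only [eTot, eTr, eRot] at h2
  have h4 : m.Etr i z + m.Erot i z
      = (3 + P.δ) / 2 * P.R * m.T i z - (m.Evib i z - eVib P (m.T i z)) := by linarith
  rw [h4] at h1
  rw [eq_inv_mul_iff_mul_eq₀ ha, relRot]
  have h5 : m.Erot i z = P.Γ (m.st i z) * (P.δ / 2 * P.R * m.T i z)
    + (1 - P.Γ (m.st i z)) * (P.θ (m.st i z) * (P.δ / (3 + P.δ) *
      ((3 + P.δ) / 2 * P.R * m.T i z - (m.Evib i z - eVib P (m.T i z))))
      + (1 - P.θ (m.st i z)) * m.Erot i z)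
      - ε i * (P.τ (m.st i z) * (m.ρ i z)⁻¹ * m.Arot i z) := by
    refine mul_left_cancel₀ hρ ?_
    linear_combination h1 + ε i * P.τ (m.st i z) * m.Arot i z * mul_inv_cancel₀ hρ
  have h6 : P.δ / (3 + P.δ) * ((3 + P.δ) / 2 * P.R * m.T i z)
      = P.δ / 2 * P.R * m.T i z := by field_simp
  linear_combination h5 + (1 - P.Γ (m.st i z)) * P.θ (m.st i z) * h6

/-- Deviation of the stress from the pressure tensor. -/
theorem stress_deviation (i : ι) {z : SpaceTime} (hz : z ∈ Ω) (j k : Fin 3) :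
    relStress P (m.st i z) * (m.S j k i z
        - m.ρ i z * P.R * m.T i z * (1 : Matrix (Fin 3) (Fin 3) ℝ) j k)
      = -(m.ρ i z * ((1 - P.Γ (m.st i z)) * P.θ (m.st i z) * (2 / (3 + P.δ))
          * (m.Evib i z - eVib P (m.T i z))
        + (1 - P.Γ (m.st i z)) * (1 - P.θ (m.st i z)) * (1 - P.ν (m.st i z)) * (2 / 3)
          * ((m.Evib i z - eVib P (m.T i z)) + (m.Erot i z - P.δ / 2 * P.R * m.T i z)))
          * (1 : Matrix (Fin 3) (Fin 3) ℝ) j k)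
        - ε i * P.τ (m.st i z) * m.AS j k i z := by
  have h1 := m.relax_S i z hz j k
  have h2 := m.energy_split i z hz
  rw [m.cov_eq i z hz j k] at h1
  have hδ := P.δ_pos
  have h3 : 3 + P.δ ≠ 0 := by positivity
  change _ = _ - ε i * P.τ (m.st i z) * m.AS j k i z at h1
  simp only [eTot, eTr, eRot] at h2
  have h4 : m.Etr i z + m.Erot i z
      = (3 + P.δ) / 2 * P.R * m.T i z - (m.Evib i z - eVib P (m.T i z)) := by linarith
  have h5 : m.Etr i z = 3 / 2 * P.R * m.T i z - (m.Evib i z - eVib P (m.T i z))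
      - (m.Erot i z - P.δ / 2 * P.R * m.T i z) := by linarith
  rw [h4, h5] at h1
  have h6 : 2 / (3 + P.δ) * ((3 + P.δ) / 2 * P.R * m.T i z) = P.R * m.T i z := by field_simp
  rw [relStress]
  linear_combination h1 + m.ρ i z * (1 - P.Γ (m.st i z)) * P.θ (m.st i z)
    * (1 : Matrix (Fin 3) (Fin 3) ℝ) j k * h6

theorem order_vib : IsOrder Ω ε 1 (fun i z => m.Evib i z - eVib P (m.T i z)) :=
  IsOrder.of_eq ((((m.smooth_τ.mul m.isOpen m.smooth_Γ_inv).mul m.isOpen m.smooth_ρ_inv).mul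
    m.isOpen m.smooth_Avib).neg m.isOpen) fun i z hz => by
      rw [m.vib_deviation i hz]; ring

theorem smooth_one_sub {a : ι → SpaceTime → ℝ} (hΩ : IsOpen Ω) (ha : UnifSmooth Ω a) :
    UnifSmooth Ω (fun i z => 1 - a i z) := (UnifSmooth.const' 1).sub hΩ ha

theorem order_rot : IsOrder Ω ε 1 (fun i z => m.Erot i z - P.δ / 2 * P.R * m.T i z) := by
  have hΩ := m.isOpen
  have h1 : IsOrder Ω ε 1 (fun i z =>
      ε i * (P.τ (m.st i z) * (m.ρ i z)⁻¹ * m.Arot i z)) :=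
    IsOrder.of_eq ((m.smooth_τ.mul hΩ m.smooth_ρ_inv).mul hΩ m.smooth_Arot) fun i z _ => by ring
  have h2 := m.order_vib.mul_left hΩ (((smooth_one_sub hΩ m.smooth_Γ).mul hΩ m.smooth_θ).mul hΩ
    (UnifSmooth.const' (P.δ / (3 + P.δ))))
  exact (((h2.neg hΩ).sub hΩ h1).mul_left hΩ m.smooth_relRot_inv).congr fun i z hz =>
    (m.rot_deviation i hz).symm

theorem order_stress (j k : Fin 3) : IsOrder Ω ε 1 (fun i z => m.S j k i z
    - m.ρ i z * P.R * m.T i z * (1 : Matrix (Fin 3) (Fin 3) ℝ) j k) := by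
  have hΩ := m.isOpen
  have h1 : IsOrder Ω ε 1 (fun i z => ε i * (P.τ (m.st i z) * m.AS j k i z)) :=
    IsOrder.of_eq (m.smooth_τ.mul hΩ (m.smooth_AS j k)) fun i z _ => by ring
  have h2 := m.order_vib.mul_left hΩ (((smooth_one_sub hΩ m.smooth_Γ).mul hΩ m.smooth_θ).mul hΩ
    (UnifSmooth.const' (2 / (3 + P.δ))))
  have h3 := (m.order_vib.add hΩ m.order_rot).mul_left hΩ
    ((((smooth_one_sub hΩ m.smooth_Γ).mul hΩ (smooth_one_sub hΩ m.smooth_θ)).mul hΩ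
      (smooth_one_sub hΩ m.smooth_ν)).mul hΩ (UnifSmooth.const' (2 / 3)))
  have h4 := (((h2.add hΩ h3).mul_left hΩ m.smooth_ρ).mul_left hΩ
    (UnifSmooth.const' ((1 : Matrix (Fin 3) (Fin 3) ℝ) j k))).neg hΩ
  refine ((h4.sub hΩ h1).mul_left hΩ m.smooth_relStress_inv).congr fun i z hz => ?_
  have hb := (relStress_pos (P := P) (m.st_mem i hz)).ne'
  rw [inv_mul_eq_iff_eq_mul₀ hb, m.stress_deviation i hz j k]
  ring

theorem order_q (j : Fin 3) : IsOrder Ω ε 1 (m.q j) :=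
  IsOrder.of_eq ((m.smooth_τ.mul m.isOpen (m.smooth_Aq j)).neg m.isOpen) fun i z hz => by
    rw [m.relax_q i z hz j]
    change -(ε i * P.τ (m.st i z) * m.Aq j i z) = _
    ring

end MomentSystem

end Expansion

/-! ### Second-order expansion of stress and heat flux -/

section Expansion

variable {ι : Type*} {P : Params} {Ω : Set SpaceTime} {ε : ι → ℝ}

theorem transport_zero (u : Fin 3 → SpaceTime → ℝ) (a : SpaceTime → ℝ) :
    transport u a (fun _ _ => 0) = fun z => dt a z + ∑ l, dx l (fun z' => u l z' * a z') z := by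
  funext z
  simp [transport]

theorem materialDeriv_comp {u : Fin 3 → SpaceTime → ℝ} {T : SpaceTime → ℝ} {φ : ℝ → ℝ}
    {z : SpaceTime} (hT : DifferentiableAt ℝ T z) (hφ : DifferentiableAt ℝ φ (T z)) :
    materialDeriv u (fun z' => φ (T z')) z = deriv φ (T z) * materialDeriv u T z := by
  have h : fderiv ℝ (fun z' => φ (T z')) z = deriv φ (T z) • fderiv ℝ T z :=
    (hφ.hasDerivAt.comp_hasFDerivAt z hT.hasFDerivAt).fderiv
  simp only [materialDeriv, dt, dx, h, _root_.smul_apply, smul_eq_mul, mul_add,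
    Finset.mul_sum]
  congr 1
  exact Finset.sum_congr rfl fun l _ => by ring

namespace MomentSystem

variable (m : MomentSystem P Ω ε)

/-- Because of mass conservation, densities `ρ a` are transported through the material derivative
of `a`. -/
theorem transport_density {a : ι → SpaceTime → ℝ} (ha : UnifSmooth Ω a)
    {w : Fin 3 → ι → SpaceTime → ℝ} (hw : ∀ l, UnifSmooth Ω (w l)) (i : ι) {z : SpaceTime}
    (hz : z ∈ Ω) :
    transport (fun l => m.u l i) (fun z' => m.ρ i z' * a i z') (fun l => w l i) z
      = m.ρ i z * materialDeriv (fun l => m.u l i) (a i) z + ∑ l, dx l (w l i) z := by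
  have hΩ := m.isOpen
  have hρ := m.smooth_ρ.differentiableAt hΩ i hz
  have hda := ha.differentiableAt hΩ i hz
  have hu := fun l => (m.smooth_u l).differentiableAt hΩ i hz
  have hdw := fun l => (hw l).differentiableAt hΩ i hz
  have h1 : dt (fun z' => m.ρ i z' * a i z') z = dt (m.ρ i) z * a i z + m.ρ i z * dt (a i) z :=
    dirDeriv_fun_mul hρ hda _
  have h2 : ∀ l, dx l (fun z' => m.u l i z' * (m.ρ i z' * a i z') + w l i z') z
      = dx l (fun z' => m.u l i z' * m.ρ i z') z * a i z
        + m.ρ i z * (m.u l i z * dx l (a i) z) + dx l (w l i) z := by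
    intro l
    have e1 : dx l (fun z' => m.u l i z' * (m.ρ i z' * a i z') + w l i z') z
      = dx l (fun z' => m.u l i z' * (m.ρ i z' * a i z')) z + dx l (w l i) z :=
      dirDeriv_fun_add ((hu l).mul (hρ.mul hda)) (hdw l) _
    have e2 : dx l (fun z' => (m.u l i z' * m.ρ i z') * a i z') z
      = dx l (fun z' => m.u l i z' * m.ρ i z') z * a i z
        + (m.u l i z * m.ρ i z) * dx l (a i) z := dirDeriv_fun_mul ((hu l).mul hρ) hda _
    have e3 : (fun z' => m.u l i z' * (m.ρ i z' * a i z'))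
      = fun z' => (m.u l i z' * m.ρ i z') * a i z' := funext fun _ => by ring
    rw [e1, e3, e2]
    ring
  simp only [transport, materialDeriv]
  rw [h1, Finset.sum_congr rfl fun l _ => h2 l, Finset.sum_add_distrib, Finset.sum_add_distrib,
    ← Finset.sum_mul, ← Finset.mul_sum]
  linear_combination a i z * m.mass i z hz

theorem transport_density_zero {a : ι → SpaceTime → ℝ} (ha : UnifSmooth Ω a) (i : ι)
    {z : SpaceTime} (hz : z ∈ Ω) :
    transport (fun l => m.u l i) (fun z' => m.ρ i z' * a i z') (fun _ _ => 0) z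
      = m.ρ i z * materialDeriv (fun l => m.u l i) (a i) z := by
  have := m.transport_density ha (w := fun _ _ _ => 0) (fun _ => UnifSmooth.const' 0) i hz
  simpa [dx] using this

/-- The pressure `p = ρ R T`. -/
noncomputable def press (i : ι) (z : SpaceTime) : ℝ := m.ρ i z * P.R * m.T i z

theorem smooth_press : UnifSmooth Ω m.press :=
  (m.smooth_ρ.mul m.isOpen (UnifSmooth.const' P.R)).mul m.isOpen m.smooth_T

theorem cong_S (j k : Fin 3) : CongOrder Ω ε 1 (m.S j k)
    (fun i z => m.press i z * (1 : Matrix (Fin 3) (Fin 3) ℝ) j k) :=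
  ⟨m.smooth_S j k, m.smooth_press.mul m.isOpen (UnifSmooth.const' _), m.order_stress j k⟩

theorem cong_vib : CongOrder Ω ε 1 m.Evib (fun i z => eVib P (m.T i z)) :=
  ⟨m.smooth_Evib, m.smooth_eVib, m.order_vib⟩

theorem cong_rot : CongOrder Ω ε 1 m.Erot (fun i z => P.δ / 2 * P.R * m.T i z) :=
  ⟨m.smooth_Erot, m.smooth_T.const_mul m.isOpen _, m.order_rot⟩

theorem cong_q (j : Fin 3) : CongOrder Ω ε 1 (m.q j) (fun _ _ => 0) :=
  CongOrder.zero (m.smooth_q j) (m.order_q j)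

theorem smooth_divu : UnifSmooth Ω m.divu :=
  UnifSmooth.sum m.isOpen fun l _ => (m.smooth_u l).dx m.isOpen l

/-- The temperature equation at leading order. -/
theorem cong_DT : CongOrder Ω ε 1
    (fun i z => m.ρ i z * materialDeriv (fun l => m.u l i) (m.T i) z)
    (fun i z => -((cv P (m.T i z))⁻¹ * m.press i z * m.divu i z)) := by
  have hΩ := m.isOpen
  have h1 : CongOrder Ω ε 1
      (fun i z => ∑ l, dx l (m.q l i) z + ∑ j, ∑ l, m.S j l i z * dx l (m.u j i) z)
      (fun i z => m.press i z * m.divu i z) := by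
    refine ((CongOrder.sum hΩ (s := Finset.univ) fun l _ => (m.cong_q l).dx hΩ l).add hΩ
      (CongOrder.sum hΩ (s := Finset.univ) fun j _ => CongOrder.sum hΩ (s := Finset.univ)
        fun l _ => (m.cong_S j l).mul hΩ (CongOrder.refl ((m.smooth_u j).dx hΩ l)))).congr hΩ
        (fun _ _ _ => rfl) fun i z _ => ?_
    simp [dx, divu, Matrix.one_apply, Finset.mul_sum]
  refine (((CongOrder.refl m.smooth_cv_inv).mul hΩ h1).const_mul hΩ (-1)).congr hΩ
    (fun i z hz => ?_) fun i z _ => by ring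
  have h2 := m.energy i z hz
  rw [m.transport_density m.smooth_eTot m.smooth_q i hz,
    materialDeriv_comp (φ := eTot P) (m.smooth_T.differentiableAt hΩ i hz)
      (hasDerivAt_eTot P (m.T_pos i hz)).differentiableAt] at h2
  change m.ρ i z * (cv P (m.T i z) * _) + _ + _ = 0 at h2
  have hcv := (cv_pos P (m.T_pos i hz)).ne'
  field_simp
  linarith

theorem cong_Avib : CongOrder Ω ε 1 m.Avib (fun i z =>
    -(deriv (eVib P) (m.T i z) * ((cv P (m.T i z))⁻¹ * m.press i z * m.divu i z))) := by
  have hΩ := m.isOpen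
  have h1 : CongOrder Ω ε 1 m.Avib _ :=
    CongOrder.transport hΩ m.smooth_u ((CongOrder.refl m.smooth_ρ).mul hΩ m.cong_vib)
      (fun l => CongOrder.zero (m.smooth_qvib l) (m.order_qvib l))
  refine (h1.congr hΩ (fun _ _ _ => rfl) (fun i z hz => ?_)).trans hΩ
    (((CongOrder.refl (m.smooth_comp_T (contDiffOn_deriv_of_Ioi (contDiffOn_eVib P)))).mul hΩ
      m.cong_DT).congr hΩ (fun _ _ _ => rfl) fun i z _ => by ring)
  rw [m.transport_density_zero m.smooth_eVib i hz,
    materialDeriv_comp (m.smooth_T.differentiableAt hΩ i hz)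
      (differentiableAt_eVib P (m.T_pos i hz))]
  ring

theorem materialDeriv_const_mul {u : Fin 3 → SpaceTime → ℝ} {T : SpaceTime → ℝ} (r : ℝ)
    {z : SpaceTime} (hT : DifferentiableAt ℝ T z) :
    materialDeriv u (fun z' => r * T z') z = r * materialDeriv u T z := by
  rw [materialDeriv_comp (φ := fun x => r * x) hT (by fun_prop)]
  simp

theorem cong_Arot : CongOrder Ω ε 1 m.Arot (fun i z =>
    -(P.δ / 2 * P.R * ((cv P (m.T i z))⁻¹ * m.press i z * m.divu i z))) := by
  have hΩ := m.isOpen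
  have h1 : CongOrder Ω ε 1 m.Arot _ :=
    CongOrder.transport hΩ m.smooth_u ((CongOrder.refl m.smooth_ρ).mul hΩ m.cong_rot)
      (fun l => CongOrder.zero (m.smooth_qrot l) (m.order_qrot l))
  refine (h1.congr hΩ (fun _ _ _ => rfl) (fun i z hz => ?_)).trans hΩ
    ((m.cong_DT.const_mul hΩ (P.δ / 2 * P.R)).congr hΩ (fun _ _ _ => rfl) fun i z _ => by ring)
  rw [m.transport_density_zero (m.smooth_T.const_mul hΩ _) i hz,
    materialDeriv_const_mul _ (m.smooth_T.differentiableAt hΩ i hz)]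
  ring

/-- Leading order of the transport term of the stress. The trace part comes from the material
derivative of the pressure, which is expressed by `∇ · u` through the energy equation. -/
theorem cong_AS (j k : Fin 3) : CongOrder Ω ε 1 (m.AS j k) (fun i z => m.press i z *
    (dx k (m.u j i) z + dx j (m.u k i) z
      - P.R * (cv P (m.T i z))⁻¹ * m.divu i z * (1 : Matrix (Fin 3) (Fin 3) ℝ) j k)) := by
  have hΩ := m.isOpen
  have h1 := CongOrder.transport hΩ m.smooth_u (m.cong_S j k)
    (fun l => CongOrder.zero (m.smooth_Q l j k) (m.order_Q l j k))
  have h2 : CongOrder Ω ε 1 (m.AS j k) _ := h1.add hΩ (CongOrder.sum hΩ (s := Finset.univ)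
    fun l _ => ((CongOrder.refl ((m.smooth_u j).dx hΩ l)).mul hΩ (m.cong_S l k)).add hΩ
        ((CongOrder.refl ((m.smooth_u k).dx hΩ l)).mul hΩ (m.cong_S l j)))
  have h3 := ((m.cong_DT.const_mul hΩ (P.R * (1 : Matrix (Fin 3) (Fin 3) ℝ) j k))).add hΩ
    (CongOrder.refl (m.smooth_press.mul hΩ
      (((m.smooth_u j).dx hΩ k).add hΩ ((m.smooth_u k).dx hΩ j))))
  refine (h2.congr hΩ (fun _ _ _ => rfl) (fun i z hz => ?_)).trans hΩ
    (h3.congr hΩ (fun _ _ _ => rfl) fun i z _ => by ring)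
  have e : (fun z' => m.press i z' * (1 : Matrix (Fin 3) (Fin 3) ℝ) j k) = fun z' =>
      m.ρ i z' * ((P.R * (1 : Matrix (Fin 3) (Fin 3) ℝ) j k) * m.T i z') :=
    funext fun _ => by rw [press]; ring
  rw [e, m.transport_density_zero (a := fun i z' =>
    (P.R * (1 : Matrix (Fin 3) (Fin 3) ℝ) j k) * m.T i z') (m.smooth_T.const_mul hΩ _) i hz,
    materialDeriv_const_mul _ (m.smooth_T.differentiableAt hΩ i hz)]
  simp [Matrix.one_apply, Finset.sum_add_distrib]
  ring_nf

end MomentSystem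

end Expansion

section Expansion

variable {ι : Type*} {P : Params} {Ω : Set SpaceTime} {ε : ι → ℝ}

/-- The relaxation of the vibrational and rotational energies produces exactly the second viscosity
coefficient. Here `g` is the vibrational heat capacity. -/
theorem second_viscosity_identity {Γ θ ν δ R g c : ℝ} (hΓ : Γ ≠ 0)
    (ha : 1 - (1 - Γ) * (1 - θ) ≠ 0) (hδ : 3 + δ ≠ 0) (hc : c ≠ 0)
    (hcg : c = (3 + δ) / 2 * R + g) :
    ((1 - Γ) * θ * (2 / (3 + δ)) * (Γ⁻¹ * -(g * c⁻¹))
      + (1 - Γ) * (1 - θ) * (1 - ν) * (2 / 3) * (Γ⁻¹ * -(g * c⁻¹)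
        + (1 - (1 - Γ) * (1 - θ))⁻¹ *
          (-((1 - Γ) * θ * (δ / (3 + δ)) * (Γ⁻¹ * -(g * c⁻¹))) + -(δ / 2 * R * c⁻¹))))
      + R * c⁻¹
    = (1 + R / c - 1)
      - (1 - Γ) * (1 - θ) * (1 - ν) / (1 - (1 - Γ) * (1 - θ)) * (5 / 3 - (5 + δ) / (3 + δ))
      - (1 - Γ) * (1 - (1 - θ) * ν) / Γ * ((5 + δ) / (3 + δ) - (1 + R / c)) := by
  obtain rfl : g = c - (3 + δ) / 2 * R := by linarith
  field_simp
  ring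

namespace MomentSystem

variable (m : MomentSystem P Ω ε)

/-- The viscous stress. -/
noncomputable def visc (j k : Fin 3) (i : ι) (z : SpaceTime) : ℝ :=
  -viscosity P (m.ρ i z) (m.T i z) * (dx k (m.u j i) z + dx j (m.u k i) z
    - secondViscosity P (m.ρ i z) (m.T i z) * m.divu i z * (1 : Matrix (Fin 3) (Fin 3) ℝ) j k)

/-- The combination of the averages `Avib`, `Arot`, `AS` through which they enter the stress. -/
noncomputable def stressForm (j k : Fin 3) (i : ι) (z : SpaceTime) (x y w : ℝ) : ℝ :=
  P.τ (m.st i z) * (((1 - P.Γ (m.st i z)) * P.θ (m.st i z) * (2 / (3 + P.δ))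
        * ((P.Γ (m.st i z))⁻¹ * x)
      + (1 - P.Γ (m.st i z)) * (1 - P.θ (m.st i z)) * (1 - P.ν (m.st i z)) * (2 / 3)
        * ((P.Γ (m.st i z))⁻¹ * x + (relRot P (m.st i z))⁻¹ *
          (-((1 - P.Γ (m.st i z)) * P.θ (m.st i z) * (P.δ / (3 + P.δ))
            * ((P.Γ (m.st i z))⁻¹ * x)) + y))) * (1 : Matrix (Fin 3) (Fin 3) ℝ) j k - w)

/-- The deviation of the stress is an exact expression in the transport terms of vibrational energy,
rotational energy and stress; the deviations of the energies have been eliminated. -/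
theorem stress_eq_form (i : ι) {z : SpaceTime} (hz : z ∈ Ω) (j k : Fin 3) :
    relStress P (m.st i z) * (m.S j k i z
        - m.press i z * (1 : Matrix (Fin 3) (Fin 3) ℝ) j k)
      = ε i * m.stressForm j k i z (m.Avib i z) (m.Arot i z) (m.AS j k i z) := by
  have h := m.stress_deviation i hz j k
  rw [m.rot_deviation i hz, m.vib_deviation i hz] at h
  have hρ := (m.ρ_pos i hz).ne'
  have h1 : m.ρ i z * (m.ρ i z)⁻¹ = 1 := mul_inv_cancel₀ hρ
  rw [press, h, stressForm]
  linear_combination (ε i * P.τ (m.st i z) * ((1 - P.Γ (m.st i z)) * P.θ (m.st i z)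
      * (2 / (3 + P.δ)) * ((P.Γ (m.st i z))⁻¹ * m.Avib i z)
    + (1 - P.Γ (m.st i z)) * (1 - P.θ (m.st i z)) * (1 - P.ν (m.st i z)) * (2 / 3)
        * ((P.Γ (m.st i z))⁻¹ * m.Avib i z + (relRot P (m.st i z))⁻¹ *
          (-((1 - P.Γ (m.st i z)) * P.θ (m.st i z) * (P.δ / (3 + P.δ))
            * ((P.Γ (m.st i z))⁻¹ * m.Avib i z)) + m.Arot i z)))
        * (1 : Matrix (Fin 3) (Fin 3) ℝ) j k) * h1

/-- Evaluated at the leading order of the transport terms, the same expression is the Navier–Stokes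
stress. -/
theorem visc_eq_form (i : ι) {z : SpaceTime} (hz : z ∈ Ω) (j k : Fin 3) :
    relStress P (m.st i z) * m.visc j k i z = m.stressForm j k i z
      (-(deriv (eVib P) (m.T i z) * ((cv P (m.T i z))⁻¹ * m.press i z * m.divu i z)))
      (-(P.δ / 2 * P.R * ((cv P (m.T i z))⁻¹ * m.press i z * m.divu i z)))
      (m.press i z * (dx k (m.u j i) z + dx j (m.u k i) z
        - P.R * (cv P (m.T i z))⁻¹ * m.divu i z * (1 : Matrix (Fin 3) (Fin 3) ℝ) j k)) := by
  have hb := (relStress_pos (P := P) (m.st_mem i hz)).ne'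
  have hδ := P.δ_pos
  have key := second_viscosity_identity (Γ := P.Γ (m.st i z)) (θ := P.θ (m.st i z))
    (ν := P.ν (m.st i z)) (P.Γ_mem _ (m.st_mem i hz)).1.ne'
    (relRot_pos (P := P) (m.st_mem i hz)).ne' (by positivity : 3 + P.δ ≠ 0)
    (cv_pos P (m.T_pos i hz)).ne' (cv_eq P (m.T_pos i hz))
  have hα : secondViscosity P (m.ρ i z) (m.T i z) = _ := key.symm
  have hμ : relStress P (m.st i z) * viscosity P (m.ρ i z) (m.T i z)
      = P.τ (m.st i z) * m.press i z := mul_div_cancel₀ _ hb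
  rw [visc, ← mul_assoc, mul_neg, hμ, hα, stressForm, relRot]
  ring

/-- The Navier–Stokes stress: `stressForm` is linear in the transport terms, and these are known
up to `O(ε)`. -/
theorem order_stress_two (j k : Fin 3) : IsOrder Ω ε 2 (fun i z => m.S j k i z
    - (m.press i z * (1 : Matrix (Fin 3) (Fin 3) ℝ) j k + ε i * m.visc j k i z)) := by
  have hΩ := m.isOpen
  have hx := m.cong_Avib.order
  have hy := m.cong_Arot.order
  have hw := (m.cong_AS j k).order
  have h1Γ := smooth_one_sub hΩ m.smooth_Γ
  have h1θ := smooth_one_sub hΩ m.smooth_θ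
  have hx' := hx.mul_left hΩ m.smooth_Γ_inv
  have e1 := hx'.mul_left hΩ ((h1Γ.mul hΩ m.smooth_θ).mul hΩ (UnifSmooth.const' (2 / (3 + P.δ))))
  have e2 := (((hx'.mul_left hΩ ((h1Γ.mul hΩ m.smooth_θ).mul hΩ
    (UnifSmooth.const' (P.δ / (3 + P.δ))))).neg hΩ).add hΩ hy).mul_left hΩ m.smooth_relRot_inv
  have e3 := (hx'.add hΩ e2).mul_left hΩ (((h1Γ.mul hΩ h1θ).mul hΩ
    (smooth_one_sub hΩ m.smooth_ν)).mul hΩ (UnifSmooth.const' (2 / 3)))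
  have e4 := ((((e1.add hΩ e3).mul_left hΩ
    (UnifSmooth.const' ((1 : Matrix (Fin 3) (Fin 3) ℝ) j k))).sub hΩ hw).mul_left hΩ
      m.smooth_τ).mul_left hΩ m.smooth_relStress_inv
  refine e4.param_mul.congr fun i z hz => ?_
  have hb := (relStress_pos (P := P) (m.st_mem i hz)).ne'
  have h1 := m.stress_eq_form i hz j k
  have h2 := m.visc_eq_form i hz j k
  rw [mul_left_comm, inv_mul_eq_iff_eq_mul₀ hb]
  have h3 : relStress P (m.st i z) * (m.S j k i z
    - (m.press i z * (1 : Matrix (Fin 3) (Fin 3) ℝ) j k + ε i * m.visc j k i z))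
    = relStress P (m.st i z) * (m.S j k i z
        - m.press i z * (1 : Matrix (Fin 3) (Fin 3) ℝ) j k)
      - ε i * (relStress P (m.st i z) * m.visc j k i z) := by ring
  rw [h3, h1, h2]
  simp only [stressForm]
  ring

/-- The covariance of the Gaussian is isotropic to leading order, by the relaxation equation of the
stress itself. -/
theorem cong_Cov (j k : Fin 3) : CongOrder Ω ε 1 (m.Cov j k)
    (fun i z => P.R * m.T i z * (1 : Matrix (Fin 3) (Fin 3) ℝ) j k) := by
  have hΩ := m.isOpen
  have h0 : IsOrder Ω ε 1 (fun i z => ε i * (P.τ (m.st i z) * m.AS j k i z)) :=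
    IsOrder.of_eq (m.smooth_τ.mul hΩ (m.smooth_AS j k)) fun i z _ => by ring
  obtain ⟨K, hK⟩ := m.ε_bdd
  have h1 : UnifSmooth Ω (fun i z => ε i * (P.τ (m.st i z) * m.AS j k i z)) :=
    (UnifSmooth.const K hK).mul hΩ (m.smooth_τ.mul hΩ (m.smooth_AS j k))
  refine ((CongOrder.refl m.smooth_ρ_inv).mul hΩ
    ((m.cong_S j k).add hΩ (CongOrder.zero h1 h0))).congr hΩ (fun i z hz => ?_) fun i z hz => ?_
  · have hρ := (m.ρ_pos i hz).ne'
    have h := m.relax_S i z hz j k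
    change _ = _ - ε i * P.τ (m.st i z) * m.AS j k i z at h
    rw [inv_mul_eq_iff_eq_mul₀ hρ, h]
    ring
  · have hρ := (m.ρ_pos i hz).ne'
    rw [inv_mul_eq_iff_eq_mul₀ hρ, press]
    ring

theorem cong_rotRel : CongOrder Ω ε 1 m.rotRel (fun i z => P.δ / 2 * P.R * m.T i z) := by
  have hΩ := m.isOpen
  have h2 := (m.smooth_ρ_inv.mul hΩ m.smooth_τ).mul hΩ m.smooth_Arot
  obtain ⟨K, hK⟩ := m.ε_bdd
  refine (m.cong_rot.add hΩ (CongOrder.zero ((UnifSmooth.const K hK).mul hΩ h2)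
    (IsOrder.of_eq h2 fun i z _ => by ring))).congr hΩ (fun i z hz => ?_) fun i z hz => by ring
  have hρ := (m.ρ_pos i hz).ne'
  have h := m.relax_rot i z hz
  change _ = _ - ε i * P.τ (m.st i z) * m.Arot i z at h
  field_simp
  linarith

theorem cong_vibRel : CongOrder Ω ε 1 m.vibRel (fun i z => eVib P (m.T i z)) := by
  have hΩ := m.isOpen
  have h2 := (m.smooth_ρ_inv.mul hΩ m.smooth_τ).mul hΩ m.smooth_Avib
  obtain ⟨K, hK⟩ := m.ε_bdd
  refine (m.cong_vib.add hΩ (CongOrder.zero ((UnifSmooth.const K hK).mul hΩ h2)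
    (IsOrder.of_eq h2 fun i z _ => by ring))).congr hΩ (fun i z hz => ?_) fun i z hz => by ring
  have hρ := (m.ρ_pos i hz).ne'
  have h := m.relax_vib i z hz
  change _ = _ - ε i * P.τ (m.st i z) * m.Avib i z at h
  field_simp
  linarith

theorem contDiffOn_enthalpy : ContDiffOn ℝ ∞ (enthalpy P) (Set.Ioi 0) :=
  (contDiffOn_eTot P).add (contDiffOn_const.mul contDiffOn_id)

theorem smooth_enthalpy : UnifSmooth Ω (fun i z => enthalpy P (m.T i z)) :=
  m.smooth_comp_T contDiffOn_enthalpy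

theorem smooth_cp : UnifSmooth Ω (fun i z => cp P (m.T i z)) :=
  m.smooth_comp_T (contDiffOn_deriv_of_Ioi contDiffOn_enthalpy)

/-- At leading order the flux of `η c` is the isotropic tensor `p h I`. -/
theorem cong_M (j k : Fin 3) : CongOrder Ω ε 1 (m.M j k) (fun i z =>
    m.press i z * enthalpy P (m.T i z) * (1 : Matrix (Fin 3) (Fin 3) ℝ) j k) := by
  have hΩ := m.isOpen
  have h1 := (CongOrder.refl (n := 1) (ε := ε) m.smooth_ρ).mul hΩ ((((CongOrder.sum hΩ
    (s := Finset.univ) fun l _ => ((m.cong_Cov l l).mul hΩ (m.cong_Cov j k)).add hΩ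
      (((m.cong_Cov l j).mul hΩ (m.cong_Cov l k)).const_mul hΩ 2)).const_mul hΩ (1 / 2))).add hΩ
      ((m.cong_rotRel.add hΩ m.cong_vibRel).mul hΩ (m.cong_Cov j k)))
  have h0 : CongOrder Ω ε 1 (m.M j k) _ := ⟨m.smooth_M j k, h1.left, m.order_M j k⟩
  refine (h0.trans hΩ h1).congr hΩ (fun _ _ _ => rfl) fun i z hz => ?_
  clear h0 h1
  simp only [press, enthalpy, eTot, eTr, eRot, Matrix.one_apply]
  obtain rfl | hjk := eq_or_ne j k
  · simp [Finset.sum_add_distrib]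
    ring
  · simp [hjk, hjk.symm]

theorem smooth_Du (j : Fin 3) :
    UnifSmooth Ω (fun i => materialDeriv (fun l => m.u l i) (m.u j i)) :=
  UnifSmooth.materialDeriv m.isOpen m.smooth_u (m.smooth_u j)

/-- The momentum equation at leading order. -/
theorem cong_Du (j : Fin 3) : CongOrder Ω ε 1
    (fun i z => m.ρ i z * materialDeriv (fun l => m.u l i) (m.u j i) z)
    (fun i z => -dx j (m.press i) z) := by
  have hΩ := m.isOpen
  refine ((CongOrder.sum hΩ (s := Finset.univ) fun l _ => (m.cong_S j l).dx hΩ l).const_mul hΩ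
    (-1)).congr hΩ (fun i z hz => ?_) fun i z hz => ?_
  · linarith [m.momentum i z hz j]
  · have h : ∀ l, dx l (fun z' => m.press i z' * (1 : Matrix (Fin 3) (Fin 3) ℝ) j l) z
        = dx l (m.press i) z * (1 : Matrix (Fin 3) (Fin 3) ℝ) j l := by
      intro l
      have := dirDeriv_const_mul (m.smooth_press.differentiableAt hΩ i hz)
        ((1 : Matrix (Fin 3) (Fin 3) ℝ) j l) ((0 : ℝ), EuclideanSpace.single l (1 : ℝ))
      simp only [mul_comm _ ((1 : Matrix (Fin 3) (Fin 3) ℝ) j l)]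
      exact this
    simp only [h]
    simp [Matrix.one_apply]

theorem cong_Aq (j : Fin 3) : CongOrder Ω ε 1 (m.Aq j)
    (fun i z => m.press i z * cp P (m.T i z) * dx j (m.T i) z) := by
  have hΩ := m.isOpen
  have hph := m.smooth_press.mul hΩ m.smooth_enthalpy
  have h1 := CongOrder.transport hΩ m.smooth_u (m.cong_q j) (fun l => m.cong_M l j)
  have h2 := CongOrder.sum hΩ (s := Finset.univ) fun l _ =>
    ((CongOrder.refl (m.smooth_Du l)).mul hΩ (m.cong_S l j)).add hΩ
      (CongOrder.sum hΩ (s := Finset.univ) fun k _ =>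
        (CongOrder.refl ((m.smooth_u l).dx hΩ k)).mul hΩ
          (CongOrder.zero (m.smooth_Q k l j) (m.order_Q k l j)))
  have h3 := ((CongOrder.refl (ε := ε) (n := 1) (m.smooth_Du j)).mul hΩ
      (CongOrder.refl (m.smooth_ρ.mul hΩ m.smooth_eTot))).add hΩ
      (CongOrder.sum hΩ (s := Finset.univ) fun k _ =>
        (CongOrder.refl ((m.smooth_u j).dx hΩ k)).mul hΩ (m.cong_q k))
  have h4 : CongOrder Ω ε 1 (m.Aq j) _ := (h1.add hΩ h2).add hΩ h3
  have h5 := (CongOrder.refl (ε := ε) (n := 1) (hph.dx hΩ j)).add hΩ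
    ((CongOrder.refl m.smooth_enthalpy).mul hΩ (m.cong_Du j))
  refine (h4.congr hΩ (fun _ _ _ => rfl) fun i z hz => ?_).trans hΩ
    (h5.congr hΩ (fun _ _ _ => rfl) fun i z hz => ?_)
  · have h : ∀ l, dx l (fun z' => m.u l i z' * 0 + m.press i z' * enthalpy P (m.T i z')
          * (1 : Matrix (Fin 3) (Fin 3) ℝ) l j) z
        = (1 : Matrix (Fin 3) (Fin 3) ℝ) l j
          * dx l (fun z' => m.press i z' * enthalpy P (m.T i z')) z := by
      intro l
      have := dirDeriv_const_mul (hph.differentiableAt hΩ i hz)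
        ((1 : Matrix (Fin 3) (Fin 3) ℝ) l j) ((0 : ℝ), EuclideanSpace.single l (1 : ℝ))
      simp only [mul_comm _ ((1 : Matrix (Fin 3) (Fin 3) ℝ) l j), mul_zero, zero_add]
      exact this
    simp only [transport, h]
    simp [Matrix.one_apply, dt, press, enthalpy]
    ring
  · have hd : DifferentiableAt ℝ (enthalpy P) (m.T i z) :=
      ContDiffOn.differentiableAt_of_isOpen isOpen_Ioi contDiffOn_enthalpy (m.T_pos i hz)
    have hT := m.smooth_T.differentiableAt hΩ i hz
    have e1 : dx j (fun z' => enthalpy P (m.T i z')) z = cp P (m.T i z) * dx j (m.T i) z := by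
      have h : fderiv ℝ (fun z' => enthalpy P (m.T i z')) z
          = deriv (enthalpy P) (m.T i z) • fderiv ℝ (m.T i) z :=
        (hd.hasDerivAt.comp_hasFDerivAt z hT.hasFDerivAt).fderiv
      simp [dx, h, cp]
    have e2 : dx j (fun z' => m.press i z' * enthalpy P (m.T i z')) z
        = dx j (m.press i) z * enthalpy P (m.T i z)
          + m.press i z * dx j (fun z' => enthalpy P (m.T i z')) z :=
      dirDeriv_fun_mul (m.smooth_press.differentiableAt hΩ i hz)
        (m.smooth_enthalpy.differentiableAt hΩ i hz) _
    rw [e2, e1]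
    ring

/-- Fourier's law. The heat flux of the Gaussian vanishes, so that `q` is exactly `-ε τ` times its
transport term, of which the leading order suffices. -/
theorem order_q_two (j : Fin 3) : IsOrder Ω ε 2 (fun i z => m.q j i z
    - ε i * (-conductivity P (m.ρ i z) (m.T i z) * dx j (m.T i) z)) := by
  have hΩ := m.isOpen
  refine (((m.cong_Aq j).order.mul_left hΩ m.smooth_τ).neg hΩ).param_mul.congr fun i z hz => ?_
  have h := m.relax_q i z hz j
  change _ = -(ε i * P.τ (m.st i z) * m.Aq j i z) at h
  have hb := (relStress_pos (P := P) (m.st_mem i hz)).ne'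
  have hμ : relStress P (m.st i z) * viscosity P (m.ρ i z) (m.T i z)
      = P.τ (m.st i z) * m.press i z := mul_div_cancel₀ _ hb
  have hκ : conductivity P (m.ρ i z) (m.T i z)
      = P.τ (m.st i z) * m.press i z * cp P (m.T i z) := by rw [← hμ]; rfl
  rw [h, hκ]
  ring

theorem contDiffOn_viscosity : ContDiffOn ℝ ∞ (fun s : ℝ × ℝ => viscosity P s.1 s.2)
    (Set.Ioi (0 : ℝ) ×ˢ Set.Ioi (0 : ℝ)) :=
  (P.τ_smooth.mul ((contDiffOn_fst.mul contDiffOn_const).mul contDiffOn_snd)).div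
    contDiffOn_relStress fun _ hs => (relStress_pos hs).ne'

theorem contDiffOn_secondViscosity : ContDiffOn ℝ ∞ (fun s : ℝ × ℝ => secondViscosity P s.1 s.2)
    (Set.Ioi (0 : ℝ) ×ˢ Set.Ioi (0 : ℝ)) := by
  have h1Γ := (contDiffOn_const (c := (1 : ℝ))).sub P.Γ_smooth
  have h1θ := (contDiffOn_const (c := (1 : ℝ))).sub P.θ_smooth
  have hγ : ContDiffOn ℝ ∞ (fun s : ℝ × ℝ => gamma P s.2)
      (Set.Ioi (0 : ℝ) ×ˢ Set.Ioi (0 : ℝ)) :=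
    contDiffOn_const.add (contDiffOn_const.div
      ((contDiffOn_deriv_of_Ioi (contDiffOn_eTot P)).comp contDiffOn_snd fun _ hs => hs.2)
      fun s hs => (cv_pos P hs.2).ne')
  exact ((hγ.sub contDiffOn_const).sub ((((h1Γ.mul h1θ).mul
    (contDiffOn_const.sub P.ν_smooth)).div contDiffOn_relRot
      fun _ hs => (relRot_pos hs).ne').mul contDiffOn_const)).sub
    (((h1Γ.mul (contDiffOn_const.sub (h1θ.mul P.ν_smooth))).div P.Γ_smooth
      fun s hs => (P.Γ_mem s hs).1.ne').mul (contDiffOn_const.sub hγ))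

theorem smooth_visc (j k : Fin 3) : UnifSmooth Ω (m.visc j k) :=
  ((m.smooth_param contDiffOn_viscosity).neg m.isOpen).mul m.isOpen
    ((((m.smooth_u j).dx m.isOpen k).add m.isOpen ((m.smooth_u k).dx m.isOpen j)).sub m.isOpen
      (((m.smooth_param contDiffOn_secondViscosity).mul m.isOpen m.smooth_divu).mul m.isOpen
        (UnifSmooth.const' _)))

theorem smooth_fourier (j : Fin 3) : UnifSmooth Ω
    (fun i z => -conductivity P (m.ρ i z) (m.T i z) * dx j (m.T i) z) := by
  have hκ := ((m.smooth_param (contDiffOn_relStress (P := P))).mul m.isOpen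
    (m.smooth_param (contDiffOn_viscosity (P := P)))).mul m.isOpen m.smooth_cp
  exact (hκ.neg m.isOpen).mul m.isOpen (m.smooth_T.dx m.isOpen j)

end MomentSystem

end Expansion

/-! ### Moments of a single distribution -/

section Distribution

instance : SFinite microMeasure := by
  unfold microMeasure
  infer_instance

/-- The weight controlling all the moments. -/
noncomputable def weight (y : Micro) : ℝ := 1 + ‖y.1‖ ^ 2 + |y.2.1| + (y.2.2 : ℝ)

theorem one_le_weight (y : Micro) : 1 ≤ weight y := by
  have h1 := sq_nonneg ‖y.1‖
  have h2 := abs_nonneg y.2.1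
  have h3 : (0 : ℝ) ≤ y.2.2 := Nat.cast_nonneg _
  rw [weight]
  linarith

theorem measurable_weight : Measurable weight := by
  unfold weight
  have h : Measurable fun y : Micro => ((y.2.2 : ℕ) : ℝ) :=
    (measurable_of_countable (fun i : ℕ => (i : ℝ))).comp (measurable_snd.comp measurable_snd)
  fun_prop

/-- Measurable functions of at most polynomial growth. -/
structure PolyBdd (φ : Micro → ℝ) : Prop where
  measurable : Measurable φ
  bound : ∃ (C : ℝ) (k : ℕ), ∀ y, |φ y| ≤ C * weight y ^ k

namespace PolyBdd

variable {φ ψ : Micro → ℝ}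

theorem mul (hφ : PolyBdd φ) (hψ : PolyBdd ψ) : PolyBdd (fun y => φ y * ψ y) := by
  obtain ⟨C, k, h⟩ := hφ.bound
  obtain ⟨D, l, h'⟩ := hψ.bound
  refine ⟨hφ.measurable.mul hψ.measurable, C * D, k + l, fun y => ?_⟩
  rw [abs_mul, pow_add]
  calc |φ y| * |ψ y| ≤ (C * weight y ^ k) * (D * weight y ^ l) :=
        mul_le_mul (h y) (h' y) (abs_nonneg _) ((abs_nonneg _).trans (h y))
    _ = _ := by ring

theorem of_le_weight (hm : Measurable φ) (h : ∀ y, |φ y| ≤ weight y) : PolyBdd φ :=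
  ⟨hm, 1, 1, fun y => by simpa using h y⟩

theorem const (c : ℝ) : PolyBdd (fun _ => c) := ⟨measurable_const, |c|, 0, fun y => by simp⟩

theorem add (hφ : PolyBdd φ) (hψ : PolyBdd ψ) : PolyBdd (fun y => φ y + ψ y) := by
  obtain ⟨C, k, h⟩ := hφ.bound
  obtain ⟨D, l, h'⟩ := hψ.bound
  refine ⟨hφ.measurable.add hψ.measurable, |C| + |D|, k + l, fun y => ?_⟩
  have hw := one_le_weight y
  have h1 : weight y ^ k ≤ weight y ^ (k + l) := pow_le_pow_right₀ hw (by omega)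
  have h2 : weight y ^ l ≤ weight y ^ (k + l) := pow_le_pow_right₀ hw (by omega)
  have hp : ∀ n : ℕ, 0 ≤ weight y ^ n := fun n => pow_nonneg (by linarith) n
  calc |φ y + ψ y| ≤ |φ y| + |ψ y| := abs_add_le _ _
    _ ≤ |C| * weight y ^ k + |D| * weight y ^ l := by
        refine add_le_add ((h y).trans ?_) ((h' y).trans ?_)
        · exact mul_le_mul_of_nonneg_right (le_abs_self _) (hp _)
        · exact mul_le_mul_of_nonneg_right (le_abs_self _) (hp _)
    _ ≤ |C| * weight y ^ (k + l) + |D| * weight y ^ (k + l) := by gcongr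
    _ = _ := by ring

theorem velocity (j : Fin 3) : PolyBdd (fun y => y.1 j) := by
  refine of_le_weight (by fun_prop) fun y => ?_
  have h1 : |y.1 j| ≤ ‖y.1‖ := by
    simpa using EuclideanSpace.norm_eq y.1 ▸ PiLp.norm_apply_le y.1 j
  have h2 := abs_nonneg y.2.1
  have h3 : (0 : ℝ) ≤ y.2.2 := Nat.cast_nonneg _
  rw [weight]
  nlinarith [sq_nonneg (‖y.1‖ - 1)]

theorem rotEnergy : PolyBdd (fun y => y.2.1) := by
  refine of_le_weight (by fun_prop) fun y => ?_
  have h1 := sq_nonneg ‖y.1‖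
  have h3 : (0 : ℝ) ≤ y.2.2 := Nat.cast_nonneg _
  rw [weight]
  linarith

theorem level : PolyBdd (fun y => ((y.2.2 : ℕ) : ℝ)) := by
  refine of_le_weight ((measurable_of_countable (fun i : ℕ => (i : ℝ))).comp
    (measurable_snd.comp measurable_snd)) fun y => ?_
  have h1 := sq_nonneg ‖y.1‖
  have h2 := abs_nonneg y.2.1
  rw [weight, abs_of_nonneg (Nat.cast_nonneg _)]
  linarith

theorem congr (hφ : PolyBdd φ) (h : ∀ y, φ y = ψ y) : PolyBdd ψ := by
  rwa [← funext h]

theorem sub_const (hφ : PolyBdd φ) (c : ℝ) : PolyBdd (fun y => φ y - c) := by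
  simpa [sub_eq_add_neg] using hφ.add (const (-c))

theorem const_mul (hφ : PolyBdd φ) (c : ℝ) : PolyBdd (fun y => c * φ y) := (const c).mul hφ

theorem peculiar (u : Vec) (j : Fin 3) : PolyBdd (fun y => y.1 j - u j) :=
  (velocity j).sub_const _

theorem sum {κ : Type*} {s : Finset κ} {φ : κ → Micro → ℝ} (h : ∀ k ∈ s, PolyBdd (φ k)) :
    PolyBdd (fun y => ∑ k ∈ s, φ k y) := by
  classical
  induction s using Finset.induction_on with
  | empty => simpa using const 0
  | insert k s hk ih =>
    simp only [Finset.sum_insert hk]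
    exact (h k (by simp)).add (ih fun l hl => h l (by simp [hl]))

end PolyBdd

theorem norm_sub_sq (v u : Vec) : ‖v - u‖ ^ 2 = ∑ j, (v j - u j) * (v j - u j) := by
  rw [EuclideanSpace.norm_sq_eq]
  refine Finset.sum_congr rfl fun j _ => ?_
  rw [Real.norm_eq_abs, sq_abs, sq]
  rfl

theorem norm_sq_eq_sum (v : Vec) : ‖v‖ ^ 2 = ∑ j, v j * v j := by
  simpa using norm_sub_sq v 0

/-- Integrability of all polynomial moments. -/
structure HasMoments (g : Micro → ℝ) : Prop where
  measurable : Measurable g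
  integrable : ∀ m : ℕ, Integrable (fun y => weight y ^ m * g y) microMeasure

theorem HasMoments.integrable_mul {g φ : Micro → ℝ} (hg : HasMoments g) (hφ : PolyBdd φ) :
    Integrable (fun y => φ y * g y) microMeasure := by
  obtain ⟨C, k, h⟩ := hφ.bound
  refine ((hg.integrable k).const_mul C).mono
    (hφ.measurable.mul hg.measurable).aestronglyMeasurable (Filter.Eventually.of_forall fun y => ?_)
  have hC : |φ y| ≤ |C * weight y ^ k| := (h y).trans (le_abs_self _)
  calc ‖φ y * g y‖ = |φ y| * |g y| := by rw [Real.norm_eq_abs, abs_mul]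
    _ ≤ |C * weight y ^ k| * |g y| := mul_le_mul_of_nonneg_right hC (abs_nonneg _)
    _ = ‖C * (weight y ^ k * g y)‖ := by rw [← abs_mul, Real.norm_eq_abs, mul_assoc]

theorem bracket_prod (A : Vec → ℝ) (B : ℝ → ℝ) (C : ℕ → ℝ) :
    bracket (fun y => A y.1 * (B y.2.1 * C y.2.2))
      = (∫ v, A v) * ((∫ ε in Set.Ioi 0, B ε) * ∫ i, C i ∂Measure.count) := by
  rw [bracket, microMeasure, ← integral_prod_mul B C]
  exact integral_prod_mul A fun s : ℝ × ℕ => B s.1 * C s.2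

theorem ae_rotEnergy_pos : ∀ᵐ y ∂microMeasure, 0 < y.2.1 := by
  have h : ∀ᵐ ε ∂(volume.restrict (Set.Ioi (0 : ℝ))), 0 < ε :=
    ae_restrict_mem measurableSet_Ioi
  have h2 : ∀ᵐ s ∂((volume.restrict (Set.Ioi (0 : ℝ))).prod (Measure.count : Measure ℕ)),
      0 < s.1 := Measure.quasiMeasurePreserving_fst.ae h
  exact Measure.quasiMeasurePreserving_snd.ae h2

theorem bracket_congr {φ ψ : Micro → ℝ} (h : ∀ y, 0 < y.2.1 → φ y = ψ y) :
    bracket φ = bracket ψ :=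
  integral_congr_ae (ae_rotEnergy_pos.mono fun y hy => h y hy)

theorem bracket_const_mul (c : ℝ) (φ : Micro → ℝ) :
    bracket (fun y => c * φ y) = c * bracket φ := integral_const_mul c φ

theorem ae_velocity_ne (u : Vec) : ∀ᵐ y ∂microMeasure, y.1 ≠ u := by
  have h : ∀ᵐ v ∂(volume : Measure Vec), v ≠ u := by
    rw [ae_iff]
    simp
  exact Measure.quasiMeasurePreserving_fst.ae h

theorem gaussian_eq (P : Params) (g : Micro → ℝ) (y : Micro) :
    gaussian P g y = density g * gaussKernel (piTensor P g) (fun j => y.1 j - velocity g j)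
      * (rotKernel P.δ (P.R * tempRotRel P g) y.2.1 * vibKernel (P.T₀ / tempVibRel P g) y.2.2) := by
  rw [gaussian, gaussTr, gaussRot, gaussVib, gaussKernel, rotKernel, vibKernel,
    neg_div (tempVibRel P g) P.T₀]
  ring

section Gaussian

variable {P : Params} {g : Micro → ℝ} (F : (Fin 3 → ℝ) → ℝ)

/-- The integral of `F (v - u)` against the normalized velocity part of `𝓖[g]`. -/
noncomputable def gaussAvg (P : Params) (g : Micro → ℝ) (F : (Fin 3 → ℝ) → ℝ) : ℝ :=
  ∫ v : Vec, F (fun j => v j - velocity g j)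
    * gaussKernel (piTensor P g) (fun j => v j - velocity g j)

theorem bracket_gaussian (hr : 0 < eRotRel P g) (hv : 0 < eVibRel P g) :
    bracket (fun y => F (fun j => y.1 j - velocity g j) * gaussian P g y)
      = density g * gaussAvg P g F := by
  have hT := tempOf_eRot P hr
  have hV := tempOf_eVib P hv
  have ha : 0 < P.R * tempRotRel P g := mul_pos P.R_pos hT.1
  have hx : 0 < P.T₀ / tempVibRel P g := div_pos P.T₀_pos hV.1
  have h := bracket_prod (fun v => density g * (F (fun j => v j - velocity g j)
    * gaussKernel (piTensor P g) (fun j => v j - velocity g j)))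
    (rotKernel P.δ (P.R * tempRotRel P g)) (vibKernel (P.T₀ / tempVibRel P g))
  rw [integral_rotKernel P.δ_pos ha, integral_vibKernel hx, integral_const_mul, mul_one,
    mul_one] at h
  rw [gaussAvg, ← h]
  refine congrArg bracket (funext fun y => ?_)
  rw [gaussian_eq]
  ring

theorem bracket_gaussian_rot (hr : 0 < eRotRel P g) (hv : 0 < eVibRel P g) :
    bracket (fun y => y.2.1 * F (fun j => y.1 j - velocity g j) * gaussian P g y)
      = density g * eRotRel P g * gaussAvg P g F := by
  have hT := tempOf_eRot P hr
  have hV := tempOf_eVib P hv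
  have ha : 0 < P.R * tempRotRel P g := mul_pos P.R_pos hT.1
  have hx : 0 < P.T₀ / tempVibRel P g := div_pos P.T₀_pos hV.1
  have h := bracket_prod (fun v => density g * (F (fun j => v j - velocity g j)
    * gaussKernel (piTensor P g) (fun j => v j - velocity g j)))
    (fun ε => ε * rotKernel P.δ (P.R * tempRotRel P g) ε) (vibKernel (P.T₀ / tempVibRel P g))
  rw [integral_mul_rotKernel P.δ_pos ha, integral_vibKernel hx, integral_const_mul, mul_one,
    tempRotRel, hT.2] at h
  rw [gaussAvg, mul_right_comm, ← h]
  refine congrArg bracket (funext fun y => ?_)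
  rw [gaussian_eq, tempRotRel]
  ring

theorem bracket_gaussian_vib (hr : 0 < eRotRel P g) (hv : 0 < eVibRel P g) :
    bracket (fun y => (y.2.2 : ℝ) * P.R * P.T₀ * F (fun j => y.1 j - velocity g j)
        * gaussian P g y)
      = density g * eVibRel P g * gaussAvg P g F := by
  have hT := tempOf_eRot P hr
  have hV := tempOf_eVib P hv
  have ha : 0 < P.R * tempRotRel P g := mul_pos P.R_pos hT.1
  have hx : 0 < P.T₀ / tempVibRel P g := div_pos P.T₀_pos hV.1
  have h := bracket_prod (fun v => density g * P.R * P.T₀ * (F (fun j => v j - velocity g j)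
    * gaussKernel (piTensor P g) (fun j => v j - velocity g j)))
    (rotKernel P.δ (P.R * tempRotRel P g))
    (fun i => (i : ℝ) * vibKernel (P.T₀ / tempVibRel P g) i)
  rw [integral_rotKernel P.δ_pos ha, integral_mul_vibKernel hx, integral_const_mul, one_mul] at h
  have e : density g * eVibRel P g * gaussAvg P g F = density g * P.R * P.T₀ * gaussAvg P g F
      * (1 / (Real.exp (P.T₀ / tempVibRel P g) - 1)) := by
    rw [← hV.2, eVib, tempVibRel]
    ring
  rw [e, gaussAvg, ← h]
  refine congrArg bracket (funext fun y => ?_)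
  rw [gaussian_eq]
  ring

end Gaussian

end Distribution

/-! ### Macroscopic quantities of a single distribution -/

theorem bracket_const_mul_mul (c : ℝ) (φ g : Micro → ℝ) :
    bracket (fun y => c * φ y * g y) = c * bracket (fun y => φ y * g y) := by
  simp only [mul_assoc]
  exact bracket_const_mul c _

/-- A distribution with positive mass and finite moments, extended by zero to nonpositive rotational
energies. -/
structure IsDistribution (g : Micro → ℝ) : Prop where
  moments : HasMoments g
  nonneg : ∀ y, 0 ≤ g y
  zero : ∀ y : Micro, y.2.1 ≤ 0 → g y = 0
  density_pos : 0 < density g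

namespace IsDistribution

variable {P : Params} {g : Micro → ℝ} (d : IsDistribution g)

include d

theorem integrable {φ : Micro → ℝ} (hφ : PolyBdd φ) :
    Integrable (fun y => φ y * g y) microMeasure := d.moments.integrable_mul hφ

theorem bracket_add {φ ψ : Micro → ℝ} (hφ : PolyBdd φ) (hψ : PolyBdd ψ) :
    bracket (fun y => (φ y + ψ y) * g y)
      = bracket (fun y => φ y * g y) + bracket (fun y => ψ y * g y) := by
  simp only [add_mul]
  exact integral_add (d.integrable hφ) (d.integrable hψ)

theorem bracket_sum {κ : Type*} {s : Finset κ} {φ : κ → Micro → ℝ} (h : ∀ k ∈ s, PolyBdd (φ k)) :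
    bracket (fun y => (∑ k ∈ s, φ k y) * g y) = ∑ k ∈ s, bracket (fun y => φ k y * g y) := by
  simp only [Finset.sum_mul]
  exact integral_finsetSum _ fun k hk => d.integrable (h k hk)

theorem bracket_nonneg {φ : Micro → ℝ} (h : ∀ y : Micro, 0 < y.2.1 → 0 ≤ φ y) :
    0 ≤ bracket (fun y => φ y * g y) :=
  integral_nonneg fun y => by
    rcases lt_or_ge 0 y.2.1 with hy | hy
    · exact mul_nonneg (h y hy) (d.nonneg y)
    · simp [d.zero y hy]

theorem bracket_velocity (j : Fin 3) :
    bracket (fun y => y.1 j * g y) = density g * velocity g j := by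
  have := d.density_pos.ne'
  rw [velocity]
  simp only
  field_simp

theorem bracket_peculiar (j : Fin 3) :
    bracket (fun y => (y.1 j - velocity g j) * g y) = 0 := by
  have h := d.bracket_add (PolyBdd.velocity j) (PolyBdd.const (-velocity g j))
  simp only [← sub_eq_add_neg] at h
  rw [h, d.bracket_velocity, bracket_const_mul, density]
  ring

theorem density_mul_energyTr :
    density g * energyTr g = bracket (fun y => 1 / 2 * ‖y.1 - velocity g‖ ^ 2 * g y) := by
  rw [energyTr, mul_div_cancel₀ _ d.density_pos.ne']

theorem density_mul_energyRot : density g * energyRot g = bracket (fun y => y.2.1 * g y) := by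
  rw [energyRot, mul_div_cancel₀ _ d.density_pos.ne']

theorem density_mul_energyVib : density g * energyVib P g
    = bracket (fun y => (y.2.2 : ℝ) * P.R * P.T₀ * g y) := by
  rw [energyVib, mul_div_cancel₀ _ d.density_pos.ne']

omit d in
theorem polyBdd_kinetic (u : Vec) : PolyBdd (fun y => 1 / 2 * ‖y.1 - u‖ ^ 2) := by
  simp only [norm_sub_sq]
  exact (PolyBdd.sum fun j _ => (PolyBdd.peculiar u j).mul (PolyBdd.peculiar u j)).const_mul _

omit d in
theorem polyBdd_vib (P : Params) : PolyBdd (fun y => (y.2.2 : ℝ) * P.R * P.T₀) :=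
  (PolyBdd.level.mul (PolyBdd.const (P.R * P.T₀))).congr fun y => by ring

theorem energyInt_eq : energyInt P g = energyTr g + energyRot g + energyVib P g := by
  rw [energyInt, d.bracket_add ((polyBdd_kinetic _).add PolyBdd.rotEnergy) (polyBdd_vib P),
    d.bracket_add (polyBdd_kinetic _) PolyBdd.rotEnergy, energyTr, energyRot, energyVib]
  ring

theorem energyRot_nonneg : 0 ≤ energyRot g :=
  div_nonneg (d.bracket_nonneg fun _ hy => hy.le) d.density_pos.le

theorem energyVib_nonneg : 0 ≤ energyVib P g :=
  div_nonneg (d.bracket_nonneg fun _ _ =>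
    mul_nonneg (mul_nonneg (Nat.cast_nonneg _) P.R_pos.le) P.T₀_pos.le) d.density_pos.le

theorem energyTr_pos : 0 < energyTr g := by
  refine div_pos ?_ d.density_pos
  refine (d.bracket_nonneg fun y _ => by positivity).lt_of_ne fun h => ?_
  -- otherwise `g` would be concentrated on the null set `v = u`
  have h0 := (integral_eq_zero_iff_of_nonneg
    (fun y => mul_nonneg (by positivity) (d.nonneg y)) (d.integrable (polyBdd_kinetic _))).1 h.symm
  have : g =ᵐ[microMeasure] 0 := by
    filter_upwards [h0, ae_velocity_ne (velocity g)] with y hy hne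
    have hn : 0 < ‖y.1 - velocity g‖ := norm_pos_iff.2 (sub_ne_zero.2 hne)
    have hy' : 1 / 2 * ‖y.1 - velocity g‖ ^ 2 * g y = 0 := hy
    exact (mul_eq_zero.1 hy').resolve_left (by positivity)
  exact d.density_pos.ne' (integral_eq_zero_of_ae this)

theorem energyInt_pos : 0 < energyInt P g := by
  have h1 := d.energyTr_pos
  have h2 := d.energyRot_nonneg
  have h3 := d.energyVib_nonneg (P := P)
  rw [d.energyInt_eq]
  linarith

theorem tempEq_pos : 0 < tempEq P g := (tempOf_eTot P d.energyInt_pos).1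

theorem eTot_tempEq : eTot P (tempEq P g) = energyInt P g := (tempOf_eTot P d.energyInt_pos).2

theorem state_mem : state P g ∈ Set.Ioi (0 : ℝ) ×ˢ Set.Ioi (0 : ℝ) :=
  ⟨d.density_pos, d.tempEq_pos⟩

theorem R_mul_tempTr : P.R * tempTr P g = 2 / 3 * energyTr g := tempOf_eTr P d.energyTr_pos

theorem R_mul_tempTrRot : P.R * tempTrRot P g = 2 / (3 + P.δ) * (energyTr g + energyRot g) :=
  tempOf_eTrRot P (by linarith [d.energyTr_pos, d.energyRot_nonneg])

theorem eRotRel_eq : eRotRel P g = P.Γ (state P g) * (P.δ / 2 * P.R * tempEq P g)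
    + (1 - P.Γ (state P g)) * (P.θ (state P g) *
      (P.δ / (3 + P.δ) * (energyTr g + energyRot g)) + (1 - P.θ (state P g)) * energyRot g) := by
  have h := d.R_mul_tempTrRot (P := P)
  have e : eRot P (tempTrRot P g) = P.δ / (3 + P.δ) * (energyTr g + energyRot g) := by
    rw [eRot, mul_assoc, h]
    ring
  rw [eRotRel, e, eRot]

theorem eRotRel_pos : 0 < eRotRel P g := by
  obtain ⟨h1, h2⟩ := P.Γ_mem _ (d.state_mem (P := P))
  obtain ⟨h3, h4⟩ := P.θ_mem _ (d.state_mem (P := P))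
  have h5 := d.energyTr_pos
  have h6 := d.energyRot_nonneg
  have hδ := P.δ_pos
  have hR := P.R_pos
  have hT := d.tempEq_pos (P := P)
  rw [d.eRotRel_eq]
  have h7 : 0 ≤ 1 - P.Γ (state P g) := by linarith
  have h8 : 0 ≤ 1 - P.θ (state P g) := by linarith
  positivity

theorem eVibRel_pos : 0 < eVibRel P g := by
  obtain ⟨h1, h2⟩ := P.Γ_mem _ (d.state_mem (P := P))
  have h6 := d.energyVib_nonneg (P := P)
  have hT := eVib_pos P (d.tempEq_pos (P := P))
  rw [eVibRel]
  have h7 : 0 ≤ 1 - P.Γ (state P g) := by linarith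
  positivity

omit d in
theorem stress_apply (g : Micro → ℝ) (j k : Fin 3) : stress g j k
    = bracket fun y => (y.1 j - velocity g j) * (y.1 k - velocity g k) * g y := rfl

omit d in
theorem stress_symm (g : Micro → ℝ) (j k : Fin 3) : stress g j k = stress g k j := by
  simp only [stress_apply, mul_comm (_ - velocity g j)]

theorem trace_stress : ∑ j, stress g j j = 2 * (density g * energyTr g) := by
  rw [d.density_mul_energyTr]
  simp only [norm_sub_sq]
  rw [bracket_const_mul_mul, d.bracket_sum fun j _ =>
    (PolyBdd.peculiar _ j).mul (PolyBdd.peculiar _ j)]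
  simp only [stress_apply]
  ring

theorem density_mul_piTensor (j k : Fin 3) : density g * piTensor P g j k
    = density g * (P.Γ (state P g) * P.R * tempEq P g + (1 - P.Γ (state P g)) *
        (P.θ (state P g) * (2 / (3 + P.δ) * (energyTr g + energyRot g))
          + (1 - P.θ (state P g)) * (1 - P.ν (state P g)) * (2 / 3 * energyTr g)))
        * (1 : Matrix (Fin 3) (Fin 3) ℝ) j k
      + (1 - P.Γ (state P g)) * (1 - P.θ (state P g)) * P.ν (state P g) * stress g j k := by
  have hρ := d.density_pos.ne'
  rw [← d.R_mul_tempTrRot (P := P), ← d.R_mul_tempTr (P := P)]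
  simp only [piTensor, theta, Matrix.add_apply, Matrix.smul_apply, smul_eq_mul]
  field_simp
  ring

/-- `x · Σ x = ⟨(x · (v - u))² g⟩`. -/
theorem quadratic_stress (x : Fin 3 → ℝ) : ∑ j, ∑ k, x j * stress g j k * x k
    = bracket (fun y => (∑ j, x j * (y.1 j - velocity g j)) ^ 2 * g y) := by
  have h : ∀ j k, PolyBdd (fun y => x j * x k * ((y.1 j - velocity g j)
      * (y.1 k - velocity g k))) := fun j k =>
    ((PolyBdd.peculiar _ j).mul (PolyBdd.peculiar _ k)).const_mul _
  have e : (fun y : Micro => (∑ j, x j * (y.1 j - velocity g j)) ^ 2 * g y)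
      = fun y => (∑ j, ∑ k, x j * x k * ((y.1 j - velocity g j) * (y.1 k - velocity g k)))
        * g y := by
    funext y
    rw [sq, Finset.sum_mul_sum]
    congr 1
    refine Finset.sum_congr rfl fun j _ => Finset.sum_congr rfl fun k _ => ?_
    ring
  rw [e, d.bracket_sum fun j _ => PolyBdd.sum fun k _ => h j k]
  refine Finset.sum_congr rfl fun j _ => ?_
  rw [d.bracket_sum fun k _ => h j k]
  refine Finset.sum_congr rfl fun k _ => ?_
  rw [bracket_const_mul_mul, stress_apply]
  ring

theorem quadratic_stress_nonneg (x : Fin 3 → ℝ) : 0 ≤ ∑ j, ∑ k, x j * stress g j k * x k := by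
  rw [d.quadratic_stress]
  exact d.bracket_nonneg fun y _ => sq_nonneg _

theorem quadratic_stress_le (x : Fin 3 → ℝ) : ∑ j, ∑ k, x j * stress g j k * x k
    ≤ 2 * (density g * energyTr g) * ∑ j, x j ^ 2 := by
  rw [d.quadratic_stress, d.density_mul_energyTr, ← bracket_const_mul, mul_comm,
    ← bracket_const_mul]
  refine integral_mono (d.integrable ?_) ?_ fun y => ?_
  · simp only [sq]
    exact (PolyBdd.sum fun j _ => (PolyBdd.peculiar _ j).const_mul _).mul
      (PolyBdd.sum fun j _ => (PolyBdd.peculiar _ j).const_mul _)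
  · exact ((d.integrable (polyBdd_kinetic _)).const_mul _).const_mul _
  · have h := Finset.sum_mul_sq_le_sq_mul_sq Finset.univ x (fun j => y.1 j - velocity g j)
    have h2 := mul_le_mul_of_nonneg_right h (d.nonneg y)
    refine h2.trans (le_of_eq ?_)
    simp only [norm_sub_sq, ← sq]
    ring

/-- Positivity of the corrected tensor uses `-1/2 ≤ ν < 1` and `0 ≤ x · Θ x ≤ tr Θ |x|²`. -/
theorem posDef_piTensor : (piTensor P g).PosDef := by
  have hρ := d.density_pos
  have hsymm : (piTensor P g).IsHermitian := by
    ext j k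
    have hone : ∀ j k, (1 : Matrix (Fin 3) (Fin 3) ℝ) j k = (1 : Matrix (Fin 3) (Fin 3) ℝ) k j :=
      fun j k => (congrFun₂ (Matrix.transpose_one (n := Fin 3) (α := ℝ)) k j)
    have h1 := d.density_mul_piTensor (P := P) j k
    have h2 := d.density_mul_piTensor (P := P) k j
    rw [stress_symm g k j, hone k j] at h2
    have := mul_left_cancel₀ hρ.ne' (h2.trans h1.symm)
    simpa using this
  refine Matrix.PosDef.of_dotProduct_mulVec_pos hsymm fun x hx => ?_
  have hx2 : 0 < ∑ j, x j ^ 2 := by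
    obtain ⟨j, hj⟩ := Function.ne_iff.1 hx
    exact Finset.sum_pos' (fun _ _ => sq_nonneg _) ⟨j, Finset.mem_univ _, sq_pos_of_ne_zero hj⟩
  have hq : density g * (star x ⬝ᵥ (piTensor P g).mulVec x)
      = density g * (P.Γ (state P g) * P.R * tempEq P g + (1 - P.Γ (state P g)) *
        (P.θ (state P g) * (2 / (3 + P.δ) * (energyTr g + energyRot g))
          + (1 - P.θ (state P g)) * (1 - P.ν (state P g)) * (2 / 3 * energyTr g)))
        * ∑ j, x j ^ 2
      + (1 - P.Γ (state P g)) * (1 - P.θ (state P g)) * (P.ν (state P g)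
        * ∑ j, ∑ k, x j * stress g j k * x k) := by
    set a := (P.Γ (state P g) * P.R * tempEq P g + (1 - P.Γ (state P g)) *
        (P.θ (state P g) * (2 / (3 + P.δ) * (energyTr g + energyRot g))
          + (1 - P.θ (state P g)) * (1 - P.ν (state P g)) * (2 / 3 * energyTr g))) with ha
    have e : density g * (star x ⬝ᵥ (piTensor P g).mulVec x)
        = ∑ j, ∑ k, x j * (density g * piTensor P g j k) * x k := by
      simp only [dotProduct, Matrix.mulVec, Finset.mul_sum, star_trivial]
      refine Finset.sum_congr rfl fun j _ => Finset.sum_congr rfl fun k _ => ?_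
      ring
    rw [e]
    simp only [d.density_mul_piTensor, ← ha, Fin.sum_univ_three, Matrix.one_apply]
    simp
    ring
  set A := ∑ j, ∑ k, x j * stress g j k * x k with hA
  have hA0 : 0 ≤ A := d.quadratic_stress_nonneg x
  have hA1 : A ≤ 2 * (density g * energyTr g) * ∑ j, x j ^ 2 := d.quadratic_stress_le x
  obtain ⟨h1, h2⟩ := P.Γ_mem _ (d.state_mem (P := P))
  obtain ⟨h3, h4⟩ := P.θ_mem _ (d.state_mem (P := P))
  obtain ⟨h5, h6⟩ := P.ν_mem _ (d.state_mem (P := P))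
  have h7 := d.energyTr_pos
  have h8 := d.energyRot_nonneg
  have hδ := P.δ_pos
  have hR := P.R_pos
  have hT := d.tempEq_pos (P := P)
  have h9 : 0 ≤ 1 - P.Γ (state P g) := by linarith
  have h10 : 0 ≤ 1 - P.θ (state P g) := by linarith
  -- the part of the quadratic form that involves `ν`
  have hν : 0 ≤ (1 - P.ν (state P g)) * (2 / 3 * (density g * energyTr g)) * ∑ j, x j ^ 2
      + P.ν (state P g) * A := by
    have hB : 0 ≤ 2 * (density g * energyTr g) * ∑ j, x j ^ 2 := hA0.trans hA1
    nlinarith [mul_nonneg (sub_nonneg.2 h6.le) (sub_nonneg.2 hA1),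
      mul_nonneg (by linarith : 0 ≤ P.ν (state P g) + 1 / 2) hA0]
  have hpos : 0 < density g * (P.Γ (state P g) * P.R * tempEq P g) * ∑ j, x j ^ 2 := by positivity
  have h11 : 0 ≤ density g * ((1 - P.Γ (state P g)) * (P.θ (state P g)
      * (2 / (3 + P.δ) * (energyTr g + energyRot g)))) * ∑ j, x j ^ 2 := by positivity
  have h12 := mul_nonneg (mul_nonneg h9 h10) hν
  refine pos_of_mul_pos_right ?_ hρ.le
  rw [hq]
  linarith

end IsDistribution

/-! ### Moments of families of distributions -/

section Families

variable {ι : Type*} {Ω : Set SpaceTime}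

/-- Families of functions `g(z, v, ε, i)` with smooth, uniformly bounded moments on `Ω`. -/
abbrev TameFam (Ω : Set SpaceTime) (g : ι → SpaceTime → Micro → ℝ) : Prop :=
  Tame Ω microMeasure weight g

/-- The moment `⟨g⟩` as a family of functions on space-time. -/
noncomputable def avg (g : ι → SpaceTime → Micro → ℝ) (i : ι) (z : SpaceTime) : ℝ :=
  bracket (g i z)

/-- The family `φ g` for a function `φ` of the microscopic variable. -/
def scale (φ : Micro → ℝ) (g : ι → SpaceTime → Micro → ℝ) : ι → SpaceTime → Micro → ℝ :=
  fun i z y => φ y * g i z y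

/-- The family `(v_j - u_j) g`. -/
def pec (u : Fin 3 → ι → SpaceTime → ℝ) (j : Fin 3) (g : ι → SpaceTime → Micro → ℝ) :
    ι → SpaceTime → Micro → ℝ :=
  fun i z y => (y.1 j - u j i z) * g i z y

/-- The transport operator `∂ₜ g + v · ∇ g`. -/
noncomputable def kinDeriv (g : ι → SpaceTime → Micro → ℝ) : ι → SpaceTime → Micro → ℝ :=
  fun i z y => dt (fun z' => g i z' y) z + ∑ l, y.1 l * dx l (fun z' => g i z' y) z

/-- The commutator of multiplication by `v_j - u_j` with the transport operator, applied to `g`. -/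
noncomputable def drift (u : Fin 3 → ι → SpaceTime → ℝ) (j : Fin 3)
    (g : ι → SpaceTime → Micro → ℝ) : ι → SpaceTime → Micro → ℝ :=
  fun i z y => materialDeriv (fun l => u l i) (u j i) z * g i z y
    + ∑ k, dx k (u j i) z * pec u k g i z y

theorem pec_comm (u : Fin 3 → ι → SpaceTime → ℝ) (j k : Fin 3) (g : ι → SpaceTime → Micro → ℝ) :
    pec u j (pec u k g) = pec u k (pec u j g) := by
  funext i z y
  simp only [pec]
  ring

theorem pec_drift (u : Fin 3 → ι → SpaceTime → ℝ) (j k : Fin 3)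
    (g : ι → SpaceTime → Micro → ℝ) : pec u j (drift u k g) = drift u k (pec u j g) := by
  funext i z y
  simp only [pec, drift, mul_add, Finset.mul_sum]
  congr 1
  · ring
  · exact Finset.sum_congr rfl fun l _ => by ring

namespace TameFam

variable {g h : ι → SpaceTime → Micro → ℝ} {u : Fin 3 → ι → SpaceTime → ℝ}

theorem scale (hΩ : IsOpen Ω) (hg : TameFam Ω g) {φ : Micro → ℝ} (hφ : PolyBdd φ) :
    TameFam Ω (scale φ g) := by
  obtain ⟨C, k, h⟩ := hφ.bound
  exact hg.weight_mul hΩ one_le_weight hφ.measurable h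

theorem pec (hΩ : IsOpen Ω) (hu : ∀ j, UnifSmooth Ω (u j)) (hg : TameFam Ω g) (j : Fin 3) :
    TameFam Ω (pec u j g) :=
  ((scale hΩ hg (PolyBdd.velocity j)).sub hΩ measurable_weight
    (hg.mul_left hΩ measurable_weight (hu j))).congr hΩ fun i z _ y => by
      rw [ESBGK.scale, ESBGK.pec]; ring

theorem kinDeriv (hΩ : IsOpen Ω) (hg : TameFam Ω g) : TameFam Ω (kinDeriv g) :=
  (hg.famDeriv hΩ (1, 0)).add hΩ measurable_weight (Tame.sum hΩ measurable_weight fun l _ =>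
    scale hΩ (hg.famDeriv hΩ (0, EuclideanSpace.single l 1)) (PolyBdd.velocity l))

theorem avg (hΩ : IsOpen Ω) (hg : TameFam Ω g) : UnifSmooth Ω (avg g) :=
  hg.unifSmooth_integral hΩ

theorem hasMoments (hg : TameFam Ω g) (i : ι) {z : SpaceTime} (hz : z ∈ Ω) :
    HasMoments (g i z) :=
  ⟨hg.measurable i z hz, fun m => hg.integrable_weight measurable_weight m i hz⟩

theorem avg_add (hg : TameFam Ω g) (hh : TameFam Ω h) (i : ι) {z : SpaceTime} (hz : z ∈ Ω) :
    ESBGK.avg (fun i z y => g i z y + h i z y) i z = ESBGK.avg g i z + ESBGK.avg h i z :=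
  integral_add (hg.integrable i hz) (hh.integrable i hz)

theorem avg_sum {κ : Type*} {s : Finset κ} {g : κ → ι → SpaceTime → Micro → ℝ}
    (hg : ∀ k ∈ s, TameFam Ω (g k)) (i : ι) {z : SpaceTime} (hz : z ∈ Ω) :
    ESBGK.avg (fun i z y => ∑ k ∈ s, g k i z y) i z = ∑ k ∈ s, ESBGK.avg (g k) i z :=
  integral_finsetSum _ fun k hk => (hg k hk).integrable i hz

theorem dirDeriv_avg (hΩ : IsOpen Ω) (hg : TameFam Ω g) (i : ι) {z : SpaceTime} (hz : z ∈ Ω)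
    (w : SpaceTime) : dirDeriv w (ESBGK.avg g i) z = bracket (famDeriv w g i z) :=
  hg.dirDeriv_integral hΩ i hz w

theorem avg_velocity (hΩ : IsOpen Ω) (hu : ∀ j, UnifSmooth Ω (u j)) (hg : TameFam Ω g)
    (l : Fin 3) (i : ι) {z : SpaceTime} (hz : z ∈ Ω) :
    ESBGK.avg (ESBGK.scale (fun y => y.1 l) g) i z
      = u l i z * ESBGK.avg g i z + ESBGK.avg (ESBGK.pec u l g) i z := by
  rw [ESBGK.avg, ESBGK.avg, ESBGK.avg, ← bracket_const_mul, bracket, bracket, bracket,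
    ← integral_add ((hg.integrable i hz).const_mul _) ((pec hΩ hu hg l).integrable i hz)]
  refine integral_congr_ae (Filter.Eventually.of_forall fun y => ?_)
  simp only [ESBGK.scale, ESBGK.pec]
  ring

/-- The average of `∂ₜ g + v · ∇g` in conservative form. -/
theorem avg_kinDeriv' (hΩ : IsOpen Ω) (hg : TameFam Ω g) (i : ι) {z : SpaceTime} (hz : z ∈ Ω) :
    ESBGK.avg (ESBGK.kinDeriv g) i z
      = dt (ESBGK.avg g i) z + ∑ l, dx l (ESBGK.avg (ESBGK.scale (fun y => y.1 l) g) i) z := by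
  have h1 := hg.famDeriv hΩ (1, 0)
  have h2 : ∀ l ∈ Finset.univ, TameFam Ω
      (ESBGK.scale (fun y => y.1 l) (famDeriv (0, EuclideanSpace.single l 1) g)) := fun l _ =>
    scale hΩ (hg.famDeriv hΩ (0, EuclideanSpace.single l 1)) (PolyBdd.velocity l)
  refine (avg_add h1 (Tame.sum hΩ measurable_weight h2) i hz).trans ?_
  rw [avg_sum h2 i hz]
  refine congrArg₂ (· + ·) (dirDeriv_avg hΩ hg i hz _).symm (Finset.sum_congr rfl fun l _ => ?_)
  refine Eq.trans ?_ (dirDeriv_avg hΩ (scale hΩ hg (PolyBdd.velocity l)) i hz _).symm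
  refine congrArg bracket (funext fun y => ?_)
  exact (dirDeriv_const_mul (hg.differentiableAt hΩ i y hz) _ _).symm

theorem avg_kinDeriv (hΩ : IsOpen Ω) (hu : ∀ j, UnifSmooth Ω (u j)) (hg : TameFam Ω g) (i : ι)
    {z : SpaceTime} (hz : z ∈ Ω) : ESBGK.avg (ESBGK.kinDeriv g) i z
      = transport (fun l => u l i) (ESBGK.avg g i) (fun l => ESBGK.avg (ESBGK.pec u l g) i) z := by
  rw [avg_kinDeriv' hΩ hg i hz, transport]
  congr 1
  refine Finset.sum_congr rfl fun l _ => ?_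
  exact dirDeriv_congr hΩ (fun z' hz' => avg_velocity hΩ hu hg l i hz') _ z hz

theorem kinDeriv_scale (hΩ : IsOpen Ω) (hg : TameFam Ω g) (φ : Micro → ℝ) (i : ι)
    {z : SpaceTime} (hz : z ∈ Ω) (y : Micro) :
    ESBGK.kinDeriv (ESBGK.scale φ g) i z y = φ y * ESBGK.kinDeriv g i z y := by
  have h : ∀ w, dirDeriv w (fun z' => φ y * g i z' y) z = φ y * dirDeriv w (fun z' => g i z' y) z :=
    fun w => dirDeriv_const_mul (hg.differentiableAt hΩ i y hz) _ w
  have h1 : dt (fun z' => φ y * g i z' y) z = φ y * dt (fun z' => g i z' y) z := h _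
  have h2 : ∀ l, dx l (fun z' => φ y * g i z' y) z = φ y * dx l (fun z' => g i z' y) z :=
    fun l => h _
  simp only [ESBGK.kinDeriv, ESBGK.scale, h1, h2, mul_add, Finset.mul_sum]
  congr 1
  exact Finset.sum_congr rfl fun l _ => by ring

theorem kinDeriv_add (hΩ : IsOpen Ω) (hg : TameFam Ω g) (hh : TameFam Ω h) (i : ι)
    {z : SpaceTime} (hz : z ∈ Ω) (y : Micro) :
    ESBGK.kinDeriv (fun i z y => g i z y + h i z y) i z y
      = ESBGK.kinDeriv g i z y + ESBGK.kinDeriv h i z y := by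
  have h' : ∀ w, dirDeriv w (fun z' => g i z' y + h i z' y) z
      = dirDeriv w (fun z' => g i z' y) z + dirDeriv w (fun z' => h i z' y) z :=
    fun w => dirDeriv_fun_add (hg.differentiableAt hΩ i y hz) (hh.differentiableAt hΩ i y hz) w
  have h1 : dt (fun z' => g i z' y + h i z' y) z
      = dt (fun z' => g i z' y) z + dt (fun z' => h i z' y) z := h' _
  have h2 : ∀ l, dx l (fun z' => g i z' y + h i z' y) z
      = dx l (fun z' => g i z' y) z + dx l (fun z' => h i z' y) z := fun l => h' _
  simp only [ESBGK.kinDeriv, h1, h2, mul_add, Finset.sum_add_distrib]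
  ring

theorem drift (hΩ : IsOpen Ω) (hu : ∀ j, UnifSmooth Ω (u j)) (hg : TameFam Ω g) (j : Fin 3) :
    TameFam Ω (drift u j g) :=
  (hg.mul_left hΩ measurable_weight (UnifSmooth.materialDeriv hΩ hu (hu j))).add hΩ
    measurable_weight (Tame.sum hΩ measurable_weight fun k _ =>
      (pec hΩ hu hg k).mul_left hΩ measurable_weight ((hu j).dx hΩ k))

theorem avg_drift (hΩ : IsOpen Ω) (hu : ∀ j, UnifSmooth Ω (u j)) (hg : TameFam Ω g) (j : Fin 3)
    (i : ι) {z : SpaceTime} (hz : z ∈ Ω) : ESBGK.avg (ESBGK.drift u j g) i z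
      = materialDeriv (fun l => u l i) (u j i) z * ESBGK.avg g i z
        + ∑ k, dx k (u j i) z * ESBGK.avg (ESBGK.pec u k g) i z := by
  have h1 := hg.mul_left hΩ measurable_weight (UnifSmooth.materialDeriv hΩ hu (hu j))
  have h2 : ∀ k ∈ Finset.univ, TameFam Ω fun i z y => dx k (u j i) z * ESBGK.pec u k g i z y :=
    fun k _ => (pec hΩ hu hg k).mul_left hΩ measurable_weight ((hu j).dx hΩ k)
  refine (avg_add h1 (Tame.sum hΩ measurable_weight h2) i hz).trans ?_
  rw [avg_sum h2 i hz]
  simp only [ESBGK.avg, bracket_const_mul]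

/-- Commutator of the transport operator with the multiplication by `v_j - u_j`. -/
theorem pec_kinDeriv (hΩ : IsOpen Ω) (hu : ∀ j, UnifSmooth Ω (u j)) (hg : TameFam Ω g)
    (j : Fin 3) (i : ι) {z : SpaceTime} (hz : z ∈ Ω) (y : Micro) :
    ESBGK.pec u j (ESBGK.kinDeriv g) i z y
      = ESBGK.kinDeriv (ESBGK.pec u j g) i z y + ESBGK.drift u j g i z y := by
  have hd := hg.differentiableAt hΩ i y hz
  have hud := (hu j).differentiableAt hΩ i hz
  have h : ∀ w, dirDeriv w (fun z' => (y.1 j - u j i z') * g i z' y) z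
      = -dirDeriv w (u j i) z * g i z y
        + (y.1 j - u j i z) * dirDeriv w (fun z' => g i z' y) z := fun w => by
    have hc : DifferentiableAt ℝ (fun z' => y.1 j - u j i z') z := (differentiableAt_const _).sub hud
    rw [dirDeriv_fun_mul hc hd, dirDeriv_fun_sub (differentiableAt_const _) hud]
    simp [dirDeriv]
  have h1 : dt (fun z' => (y.1 j - u j i z') * g i z' y) z = -dt (u j i) z * g i z y
        + (y.1 j - u j i z) * dt (fun z' => g i z' y) z := h _
  have h2 : ∀ l, dx l (fun z' => (y.1 j - u j i z') * g i z' y) z = -dx l (u j i) z * g i z y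
        + (y.1 j - u j i z) * dx l (fun z' => g i z' y) z := fun l => h _
  simp only [ESBGK.kinDeriv, ESBGK.pec, ESBGK.drift, materialDeriv, h1, h2, Fin.sum_univ_three]
  ring

theorem avg_pec_kinDeriv (hΩ : IsOpen Ω) (hu : ∀ j, UnifSmooth Ω (u j)) (hg : TameFam Ω g)
    (j : Fin 3) (i : ι) {z : SpaceTime} (hz : z ∈ Ω) :
    ESBGK.avg (ESBGK.pec u j (ESBGK.kinDeriv g)) i z
      = transport (fun l => u l i) (ESBGK.avg (ESBGK.pec u j g) i)
          (fun l => ESBGK.avg (ESBGK.pec u l (ESBGK.pec u j g)) i) z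
        + ESBGK.avg (ESBGK.drift u j g) i z := by
  have hp := pec hΩ hu hg j
  rw [← avg_kinDeriv hΩ hu hp i hz, ← avg_add (kinDeriv hΩ hp) (drift hΩ hu hg j) i hz]
  exact congrArg bracket (funext fun y => pec_kinDeriv hΩ hu hg j i hz y)

theorem avg_pec_pec_kinDeriv (hΩ : IsOpen Ω) (hu : ∀ j, UnifSmooth Ω (u j)) (hg : TameFam Ω g)
    (j k : Fin 3) (i : ι) {z : SpaceTime} (hz : z ∈ Ω) :
    ESBGK.avg (ESBGK.pec u j (ESBGK.pec u k (ESBGK.kinDeriv g))) i z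
      = transport (fun l => u l i) (ESBGK.avg (ESBGK.pec u j (ESBGK.pec u k g)) i)
          (fun l => ESBGK.avg (ESBGK.pec u l (ESBGK.pec u j (ESBGK.pec u k g))) i) z
        + ESBGK.avg (ESBGK.drift u j (ESBGK.pec u k g)) i z
        + ESBGK.avg (ESBGK.drift u k (ESBGK.pec u j g)) i z := by
  have hk := pec hΩ hu hg k
  rw [← avg_pec_kinDeriv hΩ hu hk j i hz, ← pec_drift,
    ← avg_add (pec hΩ hu (kinDeriv hΩ hk) j) (pec hΩ hu (drift hΩ hu hg k) j) i hz]
  refine congrArg bracket (funext fun y => ?_)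
  change (y.1 j - u j i z) * ESBGK.pec u k (ESBGK.kinDeriv g) i z y = _
  rw [pec_kinDeriv hΩ hu hg k i hz y, mul_add]
  rfl

end TameFam

/-- The family `η g`, where `η = |v - u|² / 2 + ε + i R T₀` is the peculiar energy. -/
noncomputable def thermal (P : Params) (u : Fin 3 → ι → SpaceTime → ℝ)
    (g : ι → SpaceTime → Micro → ℝ) : ι → SpaceTime → Micro → ℝ :=
  fun i z y => ∑ l, scale (fun _ => 1 / 2) (pec u l (pec u l g)) i z y
    + scale (fun y => y.2.1 + (y.2.2 : ℝ) * P.R * P.T₀) g i z y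

theorem polyBdd_internal (P : Params) : PolyBdd fun y => y.2.1 + (y.2.2 : ℝ) * P.R * P.T₀ :=
  PolyBdd.rotEnergy.add (IsDistribution.polyBdd_vib P)

namespace TameFam

variable {P : Params} {g : ι → SpaceTime → Micro → ℝ} {u : Fin 3 → ι → SpaceTime → ℝ}

theorem thermal (hΩ : IsOpen Ω) (hu : ∀ j, UnifSmooth Ω (u j)) (hg : TameFam Ω g) :
    TameFam Ω (thermal P u g) :=
  (Tame.sum hΩ measurable_weight fun l _ =>
    scale hΩ (pec hΩ hu (pec hΩ hu hg l) l) (PolyBdd.const _)).add hΩ measurable_weight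
      (scale hΩ hg (polyBdd_internal P))

theorem kinDeriv_sum (hΩ : IsOpen Ω) {κ : Type*} {s : Finset κ}
    {g : κ → ι → SpaceTime → Micro → ℝ} (hg : ∀ k ∈ s, TameFam Ω (g k)) (i : ι)
    {z : SpaceTime} (hz : z ∈ Ω) (y : Micro) :
    ESBGK.kinDeriv (fun i z y => ∑ k ∈ s, g k i z y) i z y = ∑ k ∈ s, ESBGK.kinDeriv (g k) i z y := by
  have h' : ∀ w, dirDeriv w (fun z' => ∑ k ∈ s, g k i z' y) z
      = ∑ k ∈ s, dirDeriv w (fun z' => g k i z' y) z :=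
    fun w => dirDeriv_fun_sum (fun k hk => (hg k hk).differentiableAt hΩ i y hz) w
  have h1 : dt (fun z' => ∑ k ∈ s, g k i z' y) z = ∑ k ∈ s, dt (fun z' => g k i z' y) z := h' _
  have h2 : ∀ l, dx l (fun z' => ∑ k ∈ s, g k i z' y) z
      = ∑ k ∈ s, dx l (fun z' => g k i z' y) z := fun l => h' _
  simp only [ESBGK.kinDeriv, h1, h2, Finset.sum_add_distrib, Finset.mul_sum]
  rw [Finset.sum_comm]

/-- Commutator of the transport operator with the multiplication by the peculiar energy. -/
theorem thermal_kinDeriv (hΩ : IsOpen Ω) (hu : ∀ j, UnifSmooth Ω (u j)) (hg : TameFam Ω g)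
    (i : ι) {z : SpaceTime} (hz : z ∈ Ω) (y : Micro) :
    ESBGK.thermal P u (ESBGK.kinDeriv g) i z y
      = ESBGK.kinDeriv (ESBGK.thermal P u g) i z y
        + ∑ l, ESBGK.drift u l (ESBGK.pec u l g) i z y := by
  have hp : ∀ l ∈ Finset.univ, TameFam Ω
      (ESBGK.scale (fun _ => 1 / 2) (ESBGK.pec u l (ESBGK.pec u l g))) := fun l _ =>
    scale hΩ (pec hΩ hu (pec hΩ hu hg l) l) (PolyBdd.const _)
  have e := kinDeriv_add hΩ (Tame.sum hΩ measurable_weight hp)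
    (scale hΩ hg (polyBdd_internal P)) i hz y
  change _ = ESBGK.kinDeriv (fun i z y => _ + _) i z y + _
  rw [e, kinDeriv_sum hΩ hp i hz, kinDeriv_scale hΩ hg _ i hz]
  have h : ∀ l, ESBGK.pec u l (ESBGK.pec u l (ESBGK.kinDeriv g)) i z y
      = ESBGK.kinDeriv (ESBGK.pec u l (ESBGK.pec u l g)) i z y
        + 2 * ESBGK.drift u l (ESBGK.pec u l g) i z y := fun l => by
    have h1 := pec_kinDeriv hΩ hu hg l i hz y
    have h2 := pec_kinDeriv hΩ hu (pec hΩ hu hg l) l i hz y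
    have h3 : ESBGK.drift u l (ESBGK.pec u l g) i z y
        = (y.1 l - u l i z) * ESBGK.drift u l g i z y := by
      rw [← pec_drift]; rfl
    change (y.1 l - u l i z) * ESBGK.pec u l (ESBGK.kinDeriv g) i z y = _
    rw [h1, mul_add, ← h3]
    change (y.1 l - u l i z) * _ = _ at h2
    rw [h2]
    ring
  have hs : ∀ l, ESBGK.kinDeriv (ESBGK.scale (fun _ => 1 / 2)
      (ESBGK.pec u l (ESBGK.pec u l g))) i z y
      = 1 / 2 * ESBGK.kinDeriv (ESBGK.pec u l (ESBGK.pec u l g)) i z y := fun l =>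
    kinDeriv_scale hΩ (pec hΩ hu (pec hΩ hu hg l) l) _ i hz y
  simp only [ESBGK.thermal, ESBGK.scale] at hs ⊢
  simp only [h, hs, Fin.sum_univ_three]
  ring

theorem avg_thermal_kinDeriv (hΩ : IsOpen Ω) (hu : ∀ j, UnifSmooth Ω (u j)) (hg : TameFam Ω g)
    (i : ι) {z : SpaceTime} (hz : z ∈ Ω) :
    ESBGK.avg (ESBGK.thermal P u (ESBGK.kinDeriv g)) i z
      = transport (fun l => u l i) (ESBGK.avg (ESBGK.thermal P u g) i)
          (fun l => ESBGK.avg (ESBGK.pec u l (ESBGK.thermal P u g)) i) z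
        + ∑ l, ESBGK.avg (ESBGK.drift u l (ESBGK.pec u l g)) i z := by
  have ht := thermal (P := P) hΩ hu hg
  have hd : ∀ l ∈ Finset.univ, TameFam Ω (ESBGK.drift u l (ESBGK.pec u l g)) := fun l _ =>
    drift hΩ hu (pec hΩ hu hg l) l
  rw [← avg_kinDeriv hΩ hu ht i hz, ← avg_sum hd i hz,
    ← avg_add (kinDeriv hΩ ht) (Tame.sum hΩ measurable_weight hd) i hz]
  exact congrArg bracket (funext fun y => thermal_kinDeriv hΩ hu hg i hz y)

theorem avg_pec_thermal_kinDeriv (hΩ : IsOpen Ω) (hu : ∀ j, UnifSmooth Ω (u j))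
    (hg : TameFam Ω g) (j : Fin 3) (i : ι) {z : SpaceTime} (hz : z ∈ Ω) :
    ESBGK.avg (ESBGK.pec u j (ESBGK.thermal P u (ESBGK.kinDeriv g))) i z
      = transport (fun l => u l i) (ESBGK.avg (ESBGK.pec u j (ESBGK.thermal P u g)) i)
          (fun l => ESBGK.avg (ESBGK.pec u l (ESBGK.pec u j (ESBGK.thermal P u g))) i) z
        + ESBGK.avg (ESBGK.drift u j (ESBGK.thermal P u g)) i z
        + ∑ l, ESBGK.avg (ESBGK.drift u l (ESBGK.pec u l (ESBGK.pec u j g))) i z := by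
  have ht := thermal (P := P) hΩ hu hg
  have hd : ∀ l ∈ Finset.univ, TameFam Ω (ESBGK.drift u l (ESBGK.pec u l (ESBGK.pec u j g))) :=
    fun l _ => drift hΩ hu (pec hΩ hu (pec hΩ hu hg j) l) l
  rw [← avg_pec_kinDeriv hΩ hu ht j i hz, ← avg_sum hd i hz,
    ← avg_add (pec hΩ hu (kinDeriv hΩ ht) j) (Tame.sum hΩ measurable_weight hd) i hz]
  refine congrArg bracket (funext fun y => ?_)
  change (y.1 j - u j i z) * ESBGK.thermal P u (ESBGK.kinDeriv g) i z y = _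
  rw [thermal_kinDeriv hΩ hu hg i hz y, mul_add, Finset.mul_sum]
  refine congrArg₂ (· + ·) rfl (Finset.sum_congr rfl fun l _ => ?_)
  rw [pec_comm u l j, ← pec_drift u j l]
  rfl

end TameFam

end Families

/-! ### Moment equations of a kinetic family -/

section Kinetic

variable {ι : Type*} {P : Params} {Ω : Set SpaceTime} {ε : ι → ℝ}
  {F : ι → SpaceTime → Micro → ℝ}

/-- A family of solutions of the kinetic equation with relaxation times `ε i * τ`, with uniformly
bounded moments of all derivatives and no vacuum. -/
structure KineticFamily (P : Params) (Ω : Set SpaceTime) (ε : ι → ℝ)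
    (F : ι → SpaceTime → Micro → ℝ) : Prop where
  isOpen : IsOpen Ω
  ε_pos : ∀ i, 0 < ε i
  ε_bdd : ∃ K, ∀ i, |ε i| ≤ K
  tame : TameFam Ω F
  isDistribution : ∀ i, ∀ z ∈ Ω, IsDistribution (F i z)
  lower : ∃ c > 0, ∀ i, ∀ z ∈ Ω, c ≤ density (F i z) ∧ c ≤ tempEq P (F i z)
  equation : ∀ i, ∀ z ∈ Ω, ∀ y : Micro, 0 < y.2.1 →
    gaussian P (F i z) y = F i z y + ε i * P.τ (state P (F i z)) * kinDeriv F i z y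

/-- The components of the bulk velocity. -/
noncomputable def flow (F : ι → SpaceTime → Micro → ℝ) (j : Fin 3) (i : ι) (z : SpaceTime) : ℝ :=
  velocity (F i z) j

theorem stress_eq_avg (j k : Fin 3) (i : ι) (z : SpaceTime) :
    stress (F i z) j k = avg (pec (flow F) j (pec (flow F) k F)) i z := by
  rw [IsDistribution.stress_apply]
  refine congrArg bracket (funext fun y => ?_)
  simp only [pec, flow]
  ring

theorem thermal_flow (g : ι → SpaceTime → Micro → ℝ) (i : ι) (z : SpaceTime) (y : Micro) :
    thermal P (flow F) g i z y
      = (1 / 2 * ‖y.1 - velocity (F i z)‖ ^ 2 + y.2.1 + (y.2.2 : ℝ) * P.R * P.T₀) * g i z y := by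
  simp only [thermal, scale, pec, flow, norm_sub_sq, Fin.sum_univ_three]
  ring

theorem heatFlux_eq_avg (j : Fin 3) (i : ι) (z : SpaceTime) :
    heatFlux P (F i z) j = avg (pec (flow F) j (thermal P (flow F) F)) i z := by
  refine congrArg bracket (funext fun y => ?_)
  simp only [pec, thermal_flow]
  rw [flow]
  ring

/-- The peculiar energy `|v - u|² / 2 + ε + i R T₀`. -/
noncomputable def peculiarEnergy (P : Params) (u : Vec) (y : Micro) : ℝ :=
  1 / 2 * ‖y.1 - u‖ ^ 2 + y.2.1 + (y.2.2 : ℝ) * P.R * P.T₀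

theorem polyBdd_peculiarEnergy (P : Params) (u : Vec) : PolyBdd (peculiarEnergy P u) :=
  ((IsDistribution.polyBdd_kinetic u).add PolyBdd.rotEnergy).add (IsDistribution.polyBdd_vib P)

namespace KineticFamily

variable (K : KineticFamily P Ω ε F)

include K

theorem smooth_density : UnifSmooth Ω fun i z => density (F i z) := TameFam.avg K.isOpen K.tame

theorem smooth_inv_density : UnifSmooth Ω fun i z => (density (F i z))⁻¹ := by
  obtain ⟨c, hc, h⟩ := K.lower
  exact K.smooth_density.inv K.isOpen hc fun i z hz => (h i z hz).1

theorem smooth_flow (j : Fin 3) : UnifSmooth Ω (flow F j) :=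
  ((TameFam.avg K.isOpen (TameFam.scale K.isOpen K.tame (PolyBdd.velocity j))).mul K.isOpen
    K.smooth_inv_density).congr K.isOpen fun _ _ _ => (div_eq_mul_inv _ _).symm

theorem tame_pec (j : Fin 3) : TameFam Ω (pec (flow F) j F) :=
  TameFam.pec K.isOpen K.smooth_flow K.tame j

theorem tame_thermal : TameFam Ω (thermal P (flow F) F) :=
  TameFam.thermal K.isOpen K.smooth_flow K.tame

theorem avg_pec_eq_zero (j : Fin 3) (i : ι) {z : SpaceTime} (hz : z ∈ Ω) :
    avg (pec (flow F) j F) i z = 0 := (K.isDistribution i z hz).bracket_peculiar j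

theorem avg_thermal (i : ι) {z : SpaceTime} (hz : z ∈ Ω) :
    avg (thermal P (flow F) F) i z = density (F i z) * eTot P (tempEq P (F i z)) := by
  have d := K.isDistribution i z hz
  rw [d.eTot_tempEq, energyInt, mul_div_cancel₀ _ d.density_pos.ne']
  exact congrArg bracket (funext fun y => thermal_flow F i z y)

theorem smooth_energyRot : UnifSmooth Ω fun i z => energyRot (F i z) :=
  ((TameFam.avg K.isOpen (TameFam.scale K.isOpen K.tame PolyBdd.rotEnergy)).mul K.isOpen
    K.smooth_inv_density).congr K.isOpen fun _ _ _ => (div_eq_mul_inv _ _).symm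

theorem smooth_energyVib : UnifSmooth Ω fun i z => energyVib P (F i z) :=
  ((TameFam.avg K.isOpen (TameFam.scale K.isOpen K.tame (IsDistribution.polyBdd_vib P))).mul
    K.isOpen K.smooth_inv_density).congr K.isOpen fun _ _ _ => (div_eq_mul_inv _ _).symm

theorem smooth_energyInt : UnifSmooth Ω fun i z => energyInt P (F i z) :=
  ((TameFam.avg K.isOpen K.tame_thermal).mul K.isOpen K.smooth_inv_density).congr K.isOpen
    fun i z _ => by
      rw [energyInt, div_eq_mul_inv]
      congr 1
      exact congrArg bracket (funext fun y => thermal_flow F i z y)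

theorem smooth_tempEq : UnifSmooth Ω fun i z => tempEq P (F i z) := by
  obtain ⟨c, hc, h⟩ := K.lower
  obtain ⟨C, hC⟩ := K.smooth_energyInt.bdd 0
  have hR := P.R_pos
  have hpos : 0 < 3 / 2 * P.R * c := by positivity
  refine UnifSmooth.comp K.isOpen (K := Set.Icc (3 / 2 * P.R * c) C) isOpen_Ioi isCompact_Icc
    (fun E hE => hpos.trans_le hE.1) (contDiffOn_tempOf_eTot P) K.smooth_energyInt
    fun i z hz => ⟨?_, (le_abs_self _).trans (hC i z hz)⟩
  have d := K.isDistribution i z hz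
  rw [← d.eTot_tempEq]
  refine le_trans ?_ (le_eTot P d.tempEq_pos)
  have := (h i z hz).2
  gcongr

theorem smooth_param {φ : ℝ × ℝ → ℝ}
    (hφ : ContDiffOn ℝ ∞ φ (Set.Ioi (0 : ℝ) ×ˢ Set.Ioi (0 : ℝ))) :
    UnifSmooth Ω (fun i z => φ (state P (F i z))) := by
  obtain ⟨c, hc, h⟩ := K.lower
  obtain ⟨C, hC⟩ := K.smooth_density.bdd 0
  obtain ⟨D, hD⟩ := K.smooth_tempEq.bdd 0
  exact UnifSmooth.comp₂ K.isOpen (isOpen_Ioi.prod isOpen_Ioi)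
    (isCompact_Icc.prod (isCompact_Icc (a := c) (b := D)))
    (Set.prod_mono (fun x (hx : x ∈ Set.Icc c C) => hc.trans_le hx.1)
      fun x hx => hc.trans_le hx.1) hφ K.smooth_density K.smooth_tempEq fun i z hz =>
    ⟨⟨(h i z hz).1, (le_abs_self _).trans (hC i z hz)⟩,
      ⟨(h i z hz).2, (le_abs_self _).trans (hD i z hz)⟩⟩

/-! ### Moments of the Gaussian of a kinetic family -/

/-- The moments of the Gaussian in terms of those of `F` and of `∂ₜF + v · ∇F`. -/
theorem bracket_mul_gaussian {φ : Micro → ℝ} (hφ : PolyBdd φ) (i : ι) {z : SpaceTime}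
    (hz : z ∈ Ω) : bracket (fun y => φ y * gaussian P (F i z) y)
      = bracket (fun y => φ y * F i z y)
        + ε i * P.τ (state P (F i z)) * bracket (fun y => φ y * kinDeriv F i z y) := by
  have hF := (TameFam.hasMoments K.tame i hz).integrable_mul hφ
  have hk := (TameFam.hasMoments (TameFam.kinDeriv K.isOpen K.tame) i hz).integrable_mul hφ
  rw [← bracket_const_mul, bracket, bracket, bracket, ← integral_add hF (hk.const_mul _)]
  exact bracket_congr fun y hy => by rw [K.equation i z hz y hy]; ring

theorem bracket_gaussian (G : (Fin 3 → ℝ) → ℝ) (i : ι) {z : SpaceTime} (hz : z ∈ Ω) :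
    bracket (fun y => G (fun j => y.1 j - flow F j i z) * gaussian P (F i z) y)
      = density (F i z) * gaussAvg P (F i z) G :=
  ESBGK.bracket_gaussian G (K.isDistribution i z hz).eRotRel_pos
    (K.isDistribution i z hz).eVibRel_pos

theorem bracket_gaussian_rot (G : (Fin 3 → ℝ) → ℝ) (i : ι) {z : SpaceTime} (hz : z ∈ Ω) :
    bracket (fun y => y.2.1 * G (fun j => y.1 j - flow F j i z) * gaussian P (F i z) y)
      = density (F i z) * eRotRel P (F i z) * gaussAvg P (F i z) G :=
  ESBGK.bracket_gaussian_rot G (K.isDistribution i z hz).eRotRel_pos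
    (K.isDistribution i z hz).eVibRel_pos

theorem bracket_gaussian_vib (G : (Fin 3 → ℝ) → ℝ) (i : ι) {z : SpaceTime} (hz : z ∈ Ω) :
    bracket (fun y => (y.2.2 : ℝ) * P.R * P.T₀ * G (fun j => y.1 j - flow F j i z)
        * gaussian P (F i z) y)
      = density (F i z) * eVibRel P (F i z) * gaussAvg P (F i z) G :=
  ESBGK.bracket_gaussian_vib G (K.isDistribution i z hz).eRotRel_pos
    (K.isDistribution i z hz).eVibRel_pos

theorem gaussAvg_one (i : ι) {z : SpaceTime} (hz : z ∈ Ω) :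
    gaussAvg P (F i z) (fun _ => 1) = 1 := by
  simpa [gaussAvg] using
    integral_gaussKernel_one (K.isDistribution i z hz).posDef_piTensor (velocity (F i z))

theorem gaussAvg_odd {G : (Fin 3 → ℝ) → ℝ} (hG : ∀ c, G (-c) = -G c) (i : ι) {z : SpaceTime}
    (hz : z ∈ Ω) : gaussAvg P (F i z) G = 0 :=
  integral_gaussKernel_odd (K.isDistribution i z hz).posDef_piTensor (velocity (F i z)) hG

theorem gaussAvg_two (j k : Fin 3) (i : ι) {z : SpaceTime} (hz : z ∈ Ω) :
    gaussAvg P (F i z) (fun c => c j * c k) = piTensor P (F i z) j k :=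
  integral_gaussKernel_two (K.isDistribution i z hz).posDef_piTensor (velocity (F i z)) j k

theorem gaussAvg_four (a b j k : Fin 3) (i : ι) {z : SpaceTime} (hz : z ∈ Ω) :
    gaussAvg P (F i z) (fun c => c a * c b * c j * c k)
      = piTensor P (F i z) a b * piTensor P (F i z) j k
        + piTensor P (F i z) a j * piTensor P (F i z) b k
        + piTensor P (F i z) a k * piTensor P (F i z) b j :=
  integral_gaussKernel_four (K.isDistribution i z hz).posDef_piTensor (velocity (F i z)) a b j k

end KineticFamily

end Kinetic

/-! ### Averages of the transport term -/

section Kinetic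

variable {ι : Type*} {P : Params} {Ω : Set SpaceTime} {ε : ι → ℝ}
  {F : ι → SpaceTime → Micro → ℝ}

theorem transport_congr (hΩ : IsOpen Ω) {u : Fin 3 → SpaceTime → ℝ} {a b : SpaceTime → ℝ}
    {w w' : Fin 3 → SpaceTime → ℝ} (hab : ∀ z ∈ Ω, a z = b z)
    (hw : ∀ l, ∀ z ∈ Ω, w l z = w' l z) {z : SpaceTime} (hz : z ∈ Ω) :
    transport u a w z = transport u b w' z := by
  rw [transport, transport]
  refine congrArg₂ (· + ·) (dirDeriv_congr hΩ hab _ z hz) (Finset.sum_congr rfl fun l _ => ?_)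
  refine dirDeriv_congr hΩ (fun z hz => ?_) _ z hz
  rw [hab z hz, hw l z hz]

theorem avg_pec_pec (u : Fin 3 → ι → SpaceTime → ℝ) (g : ι → SpaceTime → Micro → ℝ)
    (j k : Fin 3) (i : ι) (z : SpaceTime) : avg (pec u j (pec u k g)) i z
      = bracket fun y => (y.1 j - u j i z) * (y.1 k - u k i z) * g i z y := by
  refine congrArg bracket (funext fun y => ?_)
  simp only [pec]
  ring

theorem avg_pec_pec_pec (u : Fin 3 → ι → SpaceTime → ℝ) (g : ι → SpaceTime → Micro → ℝ)
    (j k l : Fin 3) (i : ι) (z : SpaceTime) : avg (pec u j (pec u k (pec u l g))) i z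
      = bracket fun y => (y.1 j - u j i z) * (y.1 k - u k i z) * (y.1 l - u l i z) * g i z y := by
  refine congrArg bracket (funext fun y => ?_)
  simp only [pec]
  ring

theorem avg_pec_scale (u : Fin 3 → ι → SpaceTime → ℝ) (φ : Micro → ℝ)
    (g : ι → SpaceTime → Micro → ℝ) (j : Fin 3) (i : ι) (z : SpaceTime) :
    avg (pec u j (scale φ g)) i z = bracket fun y => φ y * (y.1 j - u j i z) * g i z y := by
  refine congrArg bracket (funext fun y => ?_)
  simp only [pec, scale]
  ring

theorem avg_pec_thermal (g : ι → SpaceTime → Micro → ℝ) (j : Fin 3) (i : ι) (z : SpaceTime) :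
    avg (pec (flow F) j (thermal P (flow F) g)) i z = bracket fun y =>
      peculiarEnergy P (velocity (F i z)) y * (y.1 j - flow F j i z) * g i z y := by
  refine congrArg bracket (funext fun y => ?_)
  rw [pec, thermal_flow, peculiarEnergy]
  ring

theorem avg_pec_pec_thermal (g : ι → SpaceTime → Micro → ℝ) (j k : Fin 3) (i : ι)
    (z : SpaceTime) : avg (pec (flow F) j (pec (flow F) k (thermal P (flow F) g))) i z
      = bracket fun y => peculiarEnergy P (velocity (F i z)) y
        * ((y.1 j - flow F j i z) * (y.1 k - flow F k i z)) * g i z y := by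
  refine congrArg bracket (funext fun y => ?_)
  rw [pec, pec, thermal_flow, peculiarEnergy]
  ring

namespace KineticFamily

variable (K : KineticFamily P Ω ε F)

include K

theorem integrable_mul_gaussian {φ : Micro → ℝ} (hφ : PolyBdd φ) (i : ι) {z : SpaceTime}
    (hz : z ∈ Ω) : Integrable (fun y => φ y * gaussian P (F i z) y) microMeasure := by
  have hF := (TameFam.hasMoments K.tame i hz).integrable_mul hφ
  have hk := (TameFam.hasMoments (TameFam.kinDeriv K.isOpen K.tame) i hz).integrable_mul hφ
  refine (hF.add (hk.const_mul (ε i * P.τ (state P (F i z))))).congr ?_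
  filter_upwards [ae_rotEnergy_pos] with y hy
  rw [K.equation i z hz y hy, Pi.add_apply]
  ring

theorem bracket_gaussian_thermal {G : (Fin 3 → ℝ) → ℝ} (i : ι) {z : SpaceTime} (hz : z ∈ Ω)
    (hG : PolyBdd fun y => G (fun j => y.1 j - flow F j i z)) :
    bracket (fun y => peculiarEnergy P (velocity (F i z)) y * G (fun j => y.1 j - flow F j i z)
        * gaussian P (F i z) y)
      = density (F i z) * (1 / 2 * ∑ l, gaussAvg P (F i z) (fun c => c l * c l * G c)
        + (eRotRel P (F i z) + eVibRel P (F i z)) * gaussAvg P (F i z) G) := by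
  have hc : ∀ l ∈ Finset.univ, Integrable (fun y => (fun c : Fin 3 → ℝ => c l * c l * G c)
      (fun j => y.1 j - flow F j i z) * gaussian P (F i z) y) microMeasure := fun l _ =>
    K.integrable_mul_gaussian (((PolyBdd.peculiar _ l).mul (PolyBdd.peculiar _ l)).mul hG) i hz
  have hr : Integrable (fun y => y.2.1 * G (fun j => y.1 j - flow F j i z)
      * gaussian P (F i z) y) microMeasure :=
    K.integrable_mul_gaussian (PolyBdd.rotEnergy.mul hG) i hz
  have hv : Integrable (fun y => (y.2.2 : ℝ) * P.R * P.T₀ * G (fun j => y.1 j - flow F j i z)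
      * gaussian P (F i z) y) microMeasure :=
    K.integrable_mul_gaussian ((IsDistribution.polyBdd_vib P).mul hG) i hz
  have e : (fun y => peculiarEnergy P (velocity (F i z)) y * G (fun j => y.1 j - flow F j i z)
      * gaussian P (F i z) y) = fun y => (1 / 2 * ∑ l, (fun c : Fin 3 → ℝ => c l * c l * G c)
        (fun j => y.1 j - flow F j i z) * gaussian P (F i z) y)
        + (y.2.1 * G (fun j => y.1 j - flow F j i z) * gaussian P (F i z) y
          + (y.2.2 : ℝ) * P.R * P.T₀ * G (fun j => y.1 j - flow F j i z)
            * gaussian P (F i z) y) := by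
    funext y
    simp only [peculiarEnergy, norm_sub_sq, flow, Fin.sum_univ_three]
    ring
  have hrv : Integrable (fun y => y.2.1 * G (fun j => y.1 j - flow F j i z)
      * gaussian P (F i z) y + (y.2.2 : ℝ) * P.R * P.T₀ * G (fun j => y.1 j - flow F j i z)
      * gaussian P (F i z) y) microMeasure := hr.add hv
  rw [e, bracket, integral_add ((integrable_finsetSum _ hc).const_mul _) hrv,
    integral_add hr hv, integral_const_mul, integral_finsetSum _ hc]
  have h1 := K.bracket_gaussian_rot G i hz
  have h2 := K.bracket_gaussian_vib G i hz
  have h3 := fun l => K.bracket_gaussian (fun c => c l * c l * G c) i hz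
  simp only [bracket] at h1 h2 h3
  simp only [h1, h2, h3, Fin.sum_univ_three]
  ring

theorem relaxTime_pos (i : ι) {z : SpaceTime} (hz : z ∈ Ω) :
    0 < ε i * P.τ (state P (F i z)) :=
  mul_pos (K.ε_pos i) (P.τ_pos _ (K.isDistribution i z hz).state_mem)

/-- Moments shared by `F` and its Gaussian are conserved. -/
theorem bracket_kinDeriv_eq_zero {φ : Micro → ℝ} (hφ : PolyBdd φ) (i : ι) {z : SpaceTime}
    (hz : z ∈ Ω)
    (h : bracket (fun y => φ y * gaussian P (F i z) y) = bracket (fun y => φ y * F i z y)) :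
    bracket (fun y => φ y * kinDeriv F i z y) = 0 := by
  have := K.bracket_mul_gaussian hφ i hz
  rw [h, left_eq_add] at this
  exact (mul_eq_zero.1 this).resolve_left (K.relaxTime_pos i hz).ne'

theorem avg_kinDeriv_eq_zero (i : ι) {z : SpaceTime} (hz : z ∈ Ω) : avg (kinDeriv F) i z = 0 := by
  have h := K.bracket_gaussian (fun _ => 1) i hz
  rw [K.gaussAvg_one i hz] at h
  simpa [avg] using K.bracket_kinDeriv_eq_zero (PolyBdd.const 1) i hz
    (h.trans (by simp [density]))

theorem avg_pec_kinDeriv_eq_zero (j : Fin 3) (i : ι) {z : SpaceTime} (hz : z ∈ Ω) :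
    avg (pec (flow F) j (kinDeriv F)) i z = 0 := by
  have h := K.bracket_gaussian (fun c => c j) i hz
  rw [K.gaussAvg_odd (fun c => rfl) i hz, mul_zero, ← K.avg_pec_eq_zero j i hz] at h
  exact K.bracket_kinDeriv_eq_zero (PolyBdd.peculiar _ j) i hz h

theorem avg_thermal_kinDeriv_eq_zero (i : ι) {z : SpaceTime} (hz : z ∈ Ω) :
    avg (thermal P (flow F) (kinDeriv F)) i z = 0 := by
  have d := K.isDistribution i z hz
  have h := K.bracket_gaussian_thermal (G := fun _ => 1) i hz (PolyBdd.const 1)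
  have hF : avg (thermal P (flow F) F) i z
      = bracket fun y => peculiarEnergy P (velocity (F i z)) y * F i z y :=
    congrArg bracket (funext fun y => thermal_flow F i z y)
  have hk : avg (thermal P (flow F) (kinDeriv F)) i z
      = bracket fun y => peculiarEnergy P (velocity (F i z)) y * kinDeriv F i z y :=
    congrArg bracket (funext fun y => thermal_flow (kinDeriv F) i z y)
  rw [hk]
  refine K.bracket_kinDeriv_eq_zero (polyBdd_peculiarEnergy P _) i hz ?_
  rw [← hF, K.avg_thermal i hz]
  simp only [mul_one, K.gaussAvg_two _ _ i hz, K.gaussAvg_one i hz] at h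
  refine h.trans ?_
  have htr := d.trace_stress
  have hPi := fun j => d.density_mul_piTensor (P := P) j j
  have hE : energyTr (F i z) + energyRot (F i z) + energyVib P (F i z)
      = eTot P (tempEq P (F i z)) := by rw [d.eTot_tempEq, d.energyInt_eq]
  have hsum : density (F i z) * ∑ l, piTensor P (F i z) l l
      = ∑ l, density (F i z) * piTensor P (F i z) l l := Finset.mul_sum _ _ _
  have hδ : (3 + P.δ) ≠ 0 := by linarith [P.δ_pos]
  rw [mul_add, mul_left_comm, hsum]
  simp only [hPi, Matrix.one_apply_eq, mul_one, Finset.sum_add_distrib, ← Finset.mul_sum, htr,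
    Finset.sum_const, Finset.card_univ, Fintype.card_fin, nsmul_eq_mul]
  rw [d.eRotRel_eq, eVibRel]
  have hV : energyVib P (F i z) = eTot P (tempEq P (F i z)) - energyTr (F i z)
      - energyRot (F i z) := by linarith
  have hv : eVib P (tempEq P (F i z)) = eTot P (tempEq P (F i z)) - 3 / 2 * P.R * tempEq P (F i z)
      - P.δ / 2 * P.R * tempEq P (F i z) := by rw [eTot, eTr, eRot]; ring
  rw [hV, hv]
  push_cast
  field_simp
  ring

theorem relax_stress (j k : Fin 3) (i : ι) {z : SpaceTime} (hz : z ∈ Ω) :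
    avg (pec (flow F) j (pec (flow F) k F)) i z = density (F i z) * piTensor P (F i z) j k
      - ε i * P.τ (state P (F i z)) * avg (pec (flow F) j (pec (flow F) k (kinDeriv F))) i z := by
  have h := K.bracket_mul_gaussian ((PolyBdd.peculiar (velocity (F i z)) j).mul
    (PolyBdd.peculiar (velocity (F i z)) k)) i hz
  have h2 := K.bracket_gaussian (fun c => c j * c k) i hz
  rw [K.gaussAvg_two j k i hz] at h2
  rw [avg_pec_pec, avg_pec_pec]
  exact eq_sub_of_add_eq (h.symm.trans h2)

theorem relax_third (j k l : Fin 3) (i : ι) {z : SpaceTime} (hz : z ∈ Ω) :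
    avg (pec (flow F) j (pec (flow F) k (pec (flow F) l F))) i z
      = -(ε i * P.τ (state P (F i z))
        * avg (pec (flow F) j (pec (flow F) k (pec (flow F) l (kinDeriv F)))) i z) := by
  have h := K.bracket_mul_gaussian (((PolyBdd.peculiar (velocity (F i z)) j).mul
    (PolyBdd.peculiar (velocity (F i z)) k)).mul (PolyBdd.peculiar (velocity (F i z)) l)) i hz
  have h2 := K.bracket_gaussian (fun c => c j * c k * c l) i hz
  rw [K.gaussAvg_odd (fun c => by simp only [Pi.neg_apply]; ring) i hz, mul_zero] at h2
  rw [avg_pec_pec_pec, avg_pec_pec_pec]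
  exact eq_neg_of_add_eq_zero_left (h.symm.trans h2)

theorem relax_heatFlux (j : Fin 3) (i : ι) {z : SpaceTime} (hz : z ∈ Ω) :
    avg (pec (flow F) j (thermal P (flow F) F)) i z = -(ε i * P.τ (state P (F i z))
      * avg (pec (flow F) j (thermal P (flow F) (kinDeriv F))) i z) := by
  have hp := PolyBdd.peculiar (velocity (F i z)) j
  have h := K.bracket_mul_gaussian ((polyBdd_peculiarEnergy P (velocity (F i z))).mul hp) i hz
  have h2 := K.bracket_gaussian_thermal (G := fun c => c j) i hz hp
  have hodd := fun l => K.gaussAvg_odd (G := fun c => c l * c l * c j)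
    (fun c => by simp only [Pi.neg_apply]; ring) i hz
  have hodd' := K.gaussAvg_odd (G := fun c => c j) (fun c => rfl) i hz
  simp only [hodd, hodd', Finset.sum_const_zero, mul_zero, add_zero] at h2
  rw [avg_pec_thermal, avg_pec_thermal]
  exact eq_neg_of_add_eq_zero_left (h.symm.trans h2)

theorem relax_rot (i : ι) {z : SpaceTime} (hz : z ∈ Ω) :
    density (F i z) * energyRot (F i z) = density (F i z) * eRotRel P (F i z)
      - ε i * P.τ (state P (F i z)) * avg (scale (fun y => y.2.1) (kinDeriv F)) i z := by
  have h := K.bracket_mul_gaussian PolyBdd.rotEnergy i hz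
  have h2 := K.bracket_gaussian_rot (fun _ => 1) i hz
  rw [K.gaussAvg_one i hz] at h2
  simp only [mul_one] at h2
  rw [(K.isDistribution i z hz).density_mul_energyRot]
  exact eq_sub_of_add_eq (h.symm.trans h2)

theorem relax_vib (i : ι) {z : SpaceTime} (hz : z ∈ Ω) :
    density (F i z) * energyVib P (F i z) = density (F i z) * eVibRel P (F i z)
      - ε i * P.τ (state P (F i z))
        * avg (scale (fun y => (y.2.2 : ℝ) * P.R * P.T₀) (kinDeriv F)) i z := by
  have h := K.bracket_mul_gaussian (IsDistribution.polyBdd_vib P) i hz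
  have h2 := K.bracket_gaussian_vib (fun _ => 1) i hz
  rw [K.gaussAvg_one i hz] at h2
  simp only [mul_one] at h2
  rw [(K.isDistribution i z hz).density_mul_energyVib]
  exact eq_sub_of_add_eq (h.symm.trans h2)

theorem relax_rot_flux (j : Fin 3) (i : ι) {z : SpaceTime} (hz : z ∈ Ω) :
    avg (pec (flow F) j (scale (fun y => y.2.1) F)) i z = -(ε i * P.τ (state P (F i z))
      * avg (pec (flow F) j (scale (fun y => y.2.1) (kinDeriv F))) i z) := by
  have h := K.bracket_mul_gaussian
    (PolyBdd.rotEnergy.mul (PolyBdd.peculiar (velocity (F i z)) j)) i hz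
  have h2 := K.bracket_gaussian_rot (fun c => c j) i hz
  rw [K.gaussAvg_odd (fun c => rfl) i hz, mul_zero] at h2
  rw [avg_pec_scale, avg_pec_scale]
  exact eq_neg_of_add_eq_zero_left (h.symm.trans h2)

theorem relax_vib_flux (j : Fin 3) (i : ι) {z : SpaceTime} (hz : z ∈ Ω) :
    avg (pec (flow F) j (scale (fun y => (y.2.2 : ℝ) * P.R * P.T₀) F)) i z
      = -(ε i * P.τ (state P (F i z))
        * avg (pec (flow F) j (scale (fun y => (y.2.2 : ℝ) * P.R * P.T₀) (kinDeriv F))) i z) := by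
  have h := K.bracket_mul_gaussian
    ((IsDistribution.polyBdd_vib P).mul (PolyBdd.peculiar (velocity (F i z)) j)) i hz
  have h2 := K.bracket_gaussian_vib (fun c => c j) i hz
  rw [K.gaussAvg_odd (fun c => rfl) i hz, mul_zero] at h2
  rw [avg_pec_scale, avg_pec_scale]
  exact eq_neg_of_add_eq_zero_left (h.symm.trans h2)

theorem relax_thermal_second (j k : Fin 3) (i : ι) {z : SpaceTime} (hz : z ∈ Ω) :
    avg (pec (flow F) j (pec (flow F) k (thermal P (flow F) F))) i z
      = density (F i z) * (1 / 2 * ∑ l, (piTensor P (F i z) l l * piTensor P (F i z) j k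
          + 2 * (piTensor P (F i z) l j * piTensor P (F i z) l k))
        + (eRotRel P (F i z) + eVibRel P (F i z)) * piTensor P (F i z) j k)
      - ε i * P.τ (state P (F i z))
        * avg (pec (flow F) j (pec (flow F) k (thermal P (flow F) (kinDeriv F)))) i z := by
  have hp := (PolyBdd.peculiar (velocity (F i z)) j).mul (PolyBdd.peculiar (velocity (F i z)) k)
  have h := K.bracket_mul_gaussian ((polyBdd_peculiarEnergy P (velocity (F i z))).mul hp) i hz
  have h2 := K.bracket_gaussian_thermal (G := fun c => c j * c k) i hz hp
  have h4 : ∀ l, gaussAvg P (F i z) (fun c => c l * c l * (c j * c k))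
      = piTensor P (F i z) l l * piTensor P (F i z) j k
          + 2 * (piTensor P (F i z) l j * piTensor P (F i z) l k) := fun l => by
    have := K.gaussAvg_four l l j k i hz
    simp only [mul_assoc] at this ⊢
    rw [this]
    ring
  simp only [h4, K.gaussAvg_two j k i hz] at h2
  rw [avg_pec_pec_thermal, avg_pec_pec_thermal]
  exact eq_sub_of_add_eq (h.symm.trans h2)

end KineticFamily

end Kinetic

section Kinetic

variable {ι : Type*} {P : Params} {Ω : Set SpaceTime} {ε : ι → ℝ}
  {F : ι → SpaceTime → Micro → ℝ}

theorem transport_zero_left (u w : Fin 3 → SpaceTime → ℝ) (z : SpaceTime) :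
    transport u (fun _ => 0) w z = ∑ l, dx l (w l) z := by
  have h : dt (fun _ => 0) z = 0 := by simp [dt]
  simp only [transport, h, mul_zero, zero_add]

namespace KineticFamily

variable (K : KineticFamily P Ω ε F)

include K

/-- Moments that vanish on the Gaussian are `O(ε)`, as they equal `-ε τ` times a moment of
`∂ₜF + v · ∇F`. -/
theorem isOrder_one {a b : ι → SpaceTime → ℝ} (hb : UnifSmooth Ω b)
    (h : ∀ i, ∀ z ∈ Ω, a i z = -(ε i * P.τ (state P (F i z)) * b i z)) : IsOrder Ω ε 1 a :=
  ⟨_, ((K.smooth_param P.τ_smooth).mul K.isOpen hb).neg K.isOpen, fun i z hz => by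
    rw [h i z hz]; ring⟩

theorem tame_kinDeriv : TameFam Ω (kinDeriv F) := TameFam.kinDeriv K.isOpen K.tame

theorem smooth_avg_pec {g : ι → SpaceTime → Micro → ℝ} (hg : TameFam Ω g) (j : Fin 3) :
    UnifSmooth Ω (avg (pec (flow F) j g)) :=
  TameFam.avg K.isOpen (TameFam.pec K.isOpen K.smooth_flow hg j)

/-- The macroscopic fields of a kinetic family solve the system of moment equations. -/
noncomputable def momentSystem : MomentSystem P Ω ε where
  ρ i z := density (F i z)
  T i z := tempEq P (F i z)
  Etr i z := energyTr (F i z)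
  Erot i z := energyRot (F i z)
  Evib i z := energyVib P (F i z)
  u := flow F
  S j k := avg (pec (flow F) j (pec (flow F) k F))
  Q j k l := avg (pec (flow F) j (pec (flow F) k (pec (flow F) l F)))
  q j := avg (pec (flow F) j (thermal P (flow F) F))
  qrot j := avg (pec (flow F) j (scale (fun y => y.2.1) F))
  qvib j := avg (pec (flow F) j (scale (fun y => (y.2.2 : ℝ) * P.R * P.T₀) F))
  M j k := avg (pec (flow F) j (pec (flow F) k (thermal P (flow F) F)))
  Cov j k i z := piTensor P (F i z) j k
  rotRel i z := eRotRel P (F i z)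
  vibRel i z := eVibRel P (F i z)
  isOpen := K.isOpen
  ε_bdd := K.ε_bdd
  lower := K.lower
  smooth_ρ := K.smooth_density
  smooth_T := K.smooth_tempEq
  smooth_Erot := K.smooth_energyRot
  smooth_Evib := K.smooth_energyVib
  smooth_u := K.smooth_flow
  smooth_S j k := K.smooth_avg_pec (K.tame_pec k) j
  smooth_Q j k l := K.smooth_avg_pec (TameFam.pec K.isOpen K.smooth_flow (K.tame_pec l) k) j
  smooth_q j := K.smooth_avg_pec K.tame_thermal j
  smooth_qrot j := K.smooth_avg_pec (TameFam.scale K.isOpen K.tame PolyBdd.rotEnergy) j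
  smooth_qvib j :=
    K.smooth_avg_pec (TameFam.scale K.isOpen K.tame (IsDistribution.polyBdd_vib P)) j
  smooth_M j k :=
    K.smooth_avg_pec (TameFam.pec K.isOpen K.smooth_flow K.tame_thermal k) j
  mass i z hz := by
    have h := TameFam.avg_kinDeriv K.isOpen K.smooth_flow K.tame i hz
    rw [K.avg_kinDeriv_eq_zero i hz, transport_congr K.isOpen (fun _ _ => rfl)
      (w' := fun _ _ => 0) (fun l z hz => K.avg_pec_eq_zero l i hz) hz, transport_zero] at h
    exact h.symm
  momentum i z hz j := by
    have h := TameFam.avg_pec_kinDeriv K.isOpen K.smooth_flow K.tame j i hz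
    rw [K.avg_pec_kinDeriv_eq_zero j i hz, TameFam.avg_drift K.isOpen K.smooth_flow K.tame j i hz,
      transport_congr K.isOpen (b := fun _ => 0) (fun z hz => K.avg_pec_eq_zero j i hz)
        (fun _ _ _ => rfl) hz, transport_zero_left] at h
    simp only [K.avg_pec_eq_zero _ i hz, mul_zero, Finset.sum_const_zero, add_zero] at h
    simp only [pec_comm (flow F) j]
    rw [add_comm, mul_comm]
    exact h.symm
  energy i z hz := by
    have h := TameFam.avg_thermal_kinDeriv (P := P) K.isOpen K.smooth_flow K.tame i hz
    rw [K.avg_thermal_kinDeriv_eq_zero i hz, transport_congr K.isOpen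
      (fun z hz => K.avg_thermal i hz) (fun _ _ _ => rfl) hz] at h
    simp only [TameFam.avg_drift K.isOpen K.smooth_flow (K.tame_pec _) _ i hz,
      K.avg_pec_eq_zero _ i hz, mul_zero, zero_add] at h
    refine Eq.trans ?_ h.symm
    refine congrArg₂ (· + ·) rfl (Finset.sum_congr rfl fun j _ => Finset.sum_congr rfl fun l _ => ?_)
    rw [pec_comm, mul_comm]
  energy_split i z hz := by
    have d := K.isDistribution i z hz
    rw [d.eTot_tempEq, d.energyInt_eq]
  cov_eq i z hz j k := by
    rw [← stress_eq_avg]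
    exact (K.isDistribution i z hz).density_mul_piTensor j k
  rotRel_eq i z hz := (K.isDistribution i z hz).eRotRel_eq
  vibRel_eq i z hz := rfl
  relax_S i z hz j k := by
    have h := TameFam.avg_pec_pec_kinDeriv K.isOpen K.smooth_flow K.tame j k i hz
    rw [TameFam.avg_drift K.isOpen K.smooth_flow (K.tame_pec k) j i hz,
      TameFam.avg_drift K.isOpen K.smooth_flow (K.tame_pec j) k i hz] at h
    simp only [K.avg_pec_eq_zero _ i hz, mul_zero, zero_add] at h
    rw [K.relax_stress j k i hz, h, add_assoc, ← Finset.sum_add_distrib]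
    rfl
  relax_rot i z hz := by
    have h := TameFam.avg_kinDeriv K.isOpen K.smooth_flow
      (TameFam.scale K.isOpen K.tame PolyBdd.rotEnergy) i hz
    have e : avg (scale (fun y => y.2.1) (kinDeriv F)) i z
        = avg (kinDeriv (scale (fun y => y.2.1) F)) i z :=
      congrArg bracket (funext fun y => (TameFam.kinDeriv_scale K.isOpen K.tame (fun y => y.2.1) i hz y).symm)
    rw [K.relax_rot i hz, e, h, transport_congr K.isOpen
      (a := avg (scale (fun y => y.2.1) F) i)
      (fun z hz => ((K.isDistribution i z hz).density_mul_energyRot).symm) (fun _ _ _ => rfl) hz]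
    rfl
  relax_vib i z hz := by
    have h := TameFam.avg_kinDeriv K.isOpen K.smooth_flow
      (TameFam.scale K.isOpen K.tame (IsDistribution.polyBdd_vib P)) i hz
    have e : avg (scale (fun y => (y.2.2 : ℝ) * P.R * P.T₀) (kinDeriv F)) i z
        = avg (kinDeriv (scale (fun y => (y.2.2 : ℝ) * P.R * P.T₀) F)) i z :=
      congrArg bracket (funext fun y => (TameFam.kinDeriv_scale K.isOpen K.tame
        (fun y => (y.2.2 : ℝ) * P.R * P.T₀) i hz y).symm)
    rw [K.relax_vib i hz, e, h, transport_congr K.isOpen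
      (a := avg (scale (fun y => (y.2.2 : ℝ) * P.R * P.T₀) F) i)
      (fun z hz => ((K.isDistribution i z hz).density_mul_energyVib (P := P)).symm) (fun _ _ _ => rfl) hz]
    rfl
  relax_q i z hz j := by
    have h := TameFam.avg_pec_thermal_kinDeriv (P := P) K.isOpen K.smooth_flow K.tame j i hz
    rw [TameFam.avg_drift K.isOpen K.smooth_flow K.tame_thermal j i hz, K.avg_thermal i hz] at h
    simp only [TameFam.avg_drift K.isOpen K.smooth_flow
      (TameFam.pec K.isOpen K.smooth_flow (K.tame_pec j) _) _ i hz] at h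
    rw [K.relax_heatFlux j i hz, h, add_right_comm]
    rfl
  order_Q j k l := K.isOrder_one (K.smooth_avg_pec (TameFam.pec K.isOpen K.smooth_flow
    (TameFam.pec K.isOpen K.smooth_flow K.tame_kinDeriv l) k) j)
      fun i z hz => K.relax_third j k l i hz
  order_qrot j := K.isOrder_one (K.smooth_avg_pec (TameFam.scale K.isOpen K.tame_kinDeriv
    PolyBdd.rotEnergy) j) fun i z hz => K.relax_rot_flux j i hz
  order_qvib j := K.isOrder_one (K.smooth_avg_pec (TameFam.scale K.isOpen K.tame_kinDeriv
    (IsDistribution.polyBdd_vib P)) j) fun i z hz => K.relax_vib_flux j i hz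
  order_M j k := K.isOrder_one (K.smooth_avg_pec (TameFam.pec K.isOpen K.smooth_flow
    (TameFam.thermal (P := P) K.isOpen K.smooth_flow K.tame_kinDeriv) k) j) fun i z hz => by
      rw [K.relax_thermal_second j k i hz]
      ring

end KineticFamily

end Kinetic

/-! ### From solutions to kinetic families -/

section Cutoff

variable {P : Params}

open Classical in
/-- The distribution `g`, set to zero at nonpositive rotational energies, which have measure
zero. -/
noncomputable def cutoff (g : Micro → ℝ) (y : Micro) : ℝ := if 0 < y.2.1 then g y else 0

theorem cutoff_of_pos (g : Micro → ℝ) {y : Micro} (hy : 0 < y.2.1) : cutoff g y = g y := if_pos hy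

theorem cutoff_of_nonpos (g : Micro → ℝ) {y : Micro} (hy : y.2.1 ≤ 0) : cutoff g y = 0 :=
  if_neg hy.not_gt

theorem measurable_cutoff {g : Micro → ℝ} (hg : Measurable g) : Measurable (cutoff g) :=
  Measurable.ite (measurableSet_lt measurable_const (measurable_fst.comp measurable_snd)) hg
    measurable_const

theorem bracket_mul_cutoff (φ g : Micro → ℝ) :
    bracket (fun y => φ y * cutoff g y) = bracket (fun y => φ y * g y) :=
  bracket_congr fun y hy => by rw [cutoff_of_pos g hy]

theorem density_cutoff (g : Micro → ℝ) : density (cutoff g) = density g :=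
  bracket_congr fun _ hy => cutoff_of_pos g hy

theorem velocity_cutoff (g : Micro → ℝ) : velocity (cutoff g) = velocity g := by
  simp only [velocity, bracket_mul_cutoff, density_cutoff]

theorem tempEq_cutoff (g : Micro → ℝ) : tempEq P (cutoff g) = tempEq P g := by
  simp only [tempEq, energyInt, bracket_mul_cutoff, density_cutoff, velocity_cutoff]

theorem stress_cutoff (g : Micro → ℝ) : stress (cutoff g) = stress g := by
  simp only [stress, bracket_mul_cutoff, velocity_cutoff]

theorem heatFlux_cutoff (g : Micro → ℝ) : heatFlux P (cutoff g) = heatFlux P g := by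
  funext j
  simp only [heatFlux, bracket_mul_cutoff, velocity_cutoff]

theorem totalEnergy_cutoff (g : Micro → ℝ) : totalEnergy P (cutoff g) = totalEnergy P g := by
  simp only [totalEnergy, bracket_mul_cutoff]

theorem gaussian_cutoff (g : Micro → ℝ) : gaussian P (cutoff g) = gaussian P g := by
  funext y
  simp only [gaussian, gaussTr, gaussRot, gaussVib, tempRotRel, tempVibRel, eRotRel, eVibRel,
    piTensor, theta, state, tempTr, tempTrRot, energyTr, energyRot, energyVib, tempEq_cutoff,
    density_cutoff, velocity_cutoff, stress_cutoff, bracket_mul_cutoff]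

end Cutoff

section Derivatives

variable {E : Type*} [NormedAddCommGroup E] [NormedSpace ℝ E] {Ω : Set E}

theorem dirDeriv_iteratedFDeriv (hΩ : IsOpen Ω) {a : E → ℝ} (ha : ContDiffOn ℝ ∞ a Ω) (k : ℕ)
    (m : Fin k → E) (w : E) {z : E} (hz : z ∈ Ω) :
    dirDeriv w (fun z' => iteratedFDeriv ℝ k a z' m) z
      = iteratedFDeriv ℝ (k + 1) a z (Fin.cons w m) := by
  have hd : DifferentiableAt ℝ (iteratedFDeriv ℝ k a) z :=
    (((ha.contDiffAt (hΩ.mem_nhds hz)).iteratedFDeriv_right (m := 1) (i := k)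
      (by exact_mod_cast le_top))).differentiableAt (by simp)
  rw [iteratedFDeriv_succ_apply_left, Fin.cons_zero, Fin.tail_cons]
  exact congrArg (fun L : E →L[ℝ] ℝ => L w)
    ((ContinuousMultilinearMap.apply ℝ (fun _ : Fin k => E) ℝ m).hasFDerivAt.comp z
      hd.hasFDerivAt).fderiv

end Derivatives

section Solutions

variable {P : Params} {Kn₀ : ℝ} {Ω : Set SpaceTime} {f : ℝ → SpaceTime → Micro → ℝ}

/-- The derivatives of `f` applied to fixed directions, cut off at nonpositive rotational
energies. -/
noncomputable def cutoffDeriv (f : ℝ → SpaceTime → Micro → ℝ) (k : ℕ) (m : Fin k → SpaceTime)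
    (Kn : Set.Ioo (0 : ℝ) Kn₀) (z : SpaceTime) : Micro → ℝ :=
  cutoff fun y => iteratedFDeriv ℝ k (fun z' => f Kn z' y) z m

theorem momentBdd_cutoffDeriv (hbound : IsBoundedFamily Kn₀ Ω f) (k : ℕ)
    (m : Fin k → SpaceTime) :
    MomentBdd Ω microMeasure weight (cutoffDeriv (Kn₀ := Kn₀) f k m) := by
  intro p
  obtain ⟨C, hC⟩ := hbound p k
  refine ⟨(∏ j, ‖m j‖).toNNReal * C.toNNReal, fun Kn z hz => ?_⟩
  calc ∫⁻ y, ‖weight y ^ p * cutoffDeriv f k m Kn z y‖ₑ ∂microMeasure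
      ≤ ∫⁻ y, ((∏ j, ‖m j‖).toNNReal : ℝ≥0∞) * ENNReal.ofReal
          ((1 + ‖y.1‖ ^ 2 + y.2.1 + (y.2.2 : ℝ)) ^ p
            * ‖iteratedFDeriv ℝ k (fun z' => f Kn z' y) z‖) ∂microMeasure := by
        refine lintegral_mono_ae ?_
        filter_upwards [ae_rotEnergy_pos] with y hy
        have hw : weight y = 1 + ‖y.1‖ ^ 2 + y.2.1 + (y.2.2 : ℝ) := by rw [weight, abs_of_pos hy]
        rw [cutoffDeriv, cutoff_of_pos _ hy, ← hw, ← ofReal_norm]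
        change _ ≤ ENNReal.ofReal _ * _
        have hp : 0 ≤ ∏ j, ‖m j‖ := Finset.prod_nonneg fun _ _ => norm_nonneg _
        rw [← ENNReal.ofReal_mul hp]
        refine ENNReal.ofReal_le_ofReal ?_
        have hw0 : 0 ≤ weight y ^ p := pow_nonneg (zero_le_one.trans (one_le_weight y)) p
        rw [norm_mul, Real.norm_of_nonneg hw0]
        calc weight y ^ p * ‖iteratedFDeriv ℝ k (fun z' => f Kn z' y) z m‖
            ≤ weight y ^ p * (‖iteratedFDeriv ℝ k (fun z' => f Kn z' y) z‖ * ∏ j, ‖m j‖) :=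
              mul_le_mul_of_nonneg_left (ContinuousMultilinearMap.le_opNorm _ _) hw0
          _ = _ := by ring
    _ = ((∏ j, ‖m j‖).toNNReal : ℝ≥0∞) * ∫⁻ y, ENNReal.ofReal
          ((1 + ‖y.1‖ ^ 2 + y.2.1 + (y.2.2 : ℝ)) ^ p
            * ‖iteratedFDeriv ℝ k (fun z' => f Kn z' y) z‖) ∂microMeasure :=
        lintegral_const_mul' _ _ ENNReal.coe_ne_top
    _ ≤ (((∏ j, ‖m j‖).toNNReal * C.toNNReal : ℝ≥0) : ℝ≥0∞) := by
        rw [ENNReal.coe_mul]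
        exact mul_le_mul' le_rfl (hC Kn Kn.2 z hz)

/-- The families `cutoffDeriv` are stable under differentiation, which makes induction on the order
of differentiation possible. -/
theorem famDeriv_cutoffDeriv (hΩ : IsOpen Ω)
    (hsol : ∀ Kn ∈ Set.Ioo 0 Kn₀, IsSolution P Kn Ω (f Kn)) (k : ℕ) (m : Fin k → SpaceTime)
    (w : SpaceTime) (Kn : Set.Ioo (0 : ℝ) Kn₀) {z : SpaceTime} (hz : z ∈ Ω) (y : Micro) :
    famDeriv w (cutoffDeriv f k m) Kn z y = cutoffDeriv f (k + 1) (Fin.cons w m) Kn z y := by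
  rcases lt_or_ge 0 y.2.1 with hy | hy
  · simp only [famDeriv, cutoffDeriv, cutoff_of_pos _ hy]
    exact dirDeriv_iteratedFDeriv hΩ ((hsol Kn Kn.2).smooth y hy) k m w hz
  · simp only [famDeriv, cutoffDeriv, cutoff_of_nonpos _ hy]
    simp [dirDeriv]

theorem tameDerivs_cutoffDeriv (hΩ : IsOpen Ω)
    (hsol : ∀ Kn ∈ Set.Ioo 0 Kn₀, IsSolution P Kn Ω (f Kn))
    (hbound : IsBoundedFamily Kn₀ Ω f) (n k : ℕ) (m : Fin k → SpaceTime) :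
    TameDerivs Ω microMeasure weight n (cutoffDeriv (Kn₀ := Kn₀) f k m) := by
  induction n generalizing k with
  | zero => exact momentBdd_cutoffDeriv hbound k m
  | succ n ih =>
    refine ⟨momentBdd_cutoffDeriv hbound k m, fun w => (ih (k + 1) (Fin.cons w m)).congr hΩ ?_⟩
    exact fun Kn z hz y => (famDeriv_cutoffDeriv hΩ hsol k m w Kn hz y).symm

theorem tameFam_cutoff (hΩ : IsOpen Ω)
    (hsol : ∀ Kn ∈ Set.Ioo 0 Kn₀, IsSolution P Kn Ω (f Kn)) (hbound : IsBoundedFamily Kn₀ Ω f) :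
    TameFam Ω fun (Kn : Set.Ioo (0 : ℝ) Kn₀) z => cutoff (f Kn z) where
  smooth Kn y := by
    rcases lt_or_ge 0 y.2.1 with hy | hy
    · simp only [cutoff_of_pos _ hy]
      exact (hsol Kn Kn.2).smooth y hy
    · simp only [cutoff_of_nonpos _ hy]
      exact contDiffOn_const
  measurable Kn z hz := measurable_cutoff ((hsol Kn Kn.2).measurable z hz)
  moments n := (tameDerivs_cutoffDeriv hΩ hsol hbound n 0 Fin.elim0).congr hΩ fun _ _ _ _ => rfl

theorem kineticFamily_cutoff (hΩ : IsOpen Ω)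
    (hsol : ∀ Kn ∈ Set.Ioo 0 Kn₀, IsSolution P Kn Ω (f Kn)) (hbound : IsBoundedFamily Kn₀ Ω f)
    (hnondeg : IsNondegenerateFamily P Kn₀ Ω f) :
    KineticFamily P Ω (fun Kn : Set.Ioo (0 : ℝ) Kn₀ => (Kn : ℝ))
      fun Kn z => cutoff (f Kn z) := by
  have ht := tameFam_cutoff hΩ hsol hbound
  obtain ⟨c, hc, hlow⟩ := hnondeg
  have hlow' : ∀ (Kn : Set.Ioo (0 : ℝ) Kn₀), ∀ z ∈ Ω, c ≤ density (cutoff (f Kn z))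
      ∧ c ≤ tempEq P (cutoff (f Kn z)) := fun Kn z hz => by
    rw [density_cutoff, tempEq_cutoff]
    exact hlow Kn Kn.2 z hz
  refine ⟨hΩ, fun Kn => Kn.2.1, ⟨Kn₀, fun Kn => by rw [abs_of_pos Kn.2.1]; exact Kn.2.2.le⟩, ht,
    fun Kn z hz => ⟨TameFam.hasMoments ht Kn hz, fun y => ?_, fun y hy => cutoff_of_nonpos _ hy,
      hc.trans_le (hlow' Kn z hz).1⟩, ⟨c, hc, hlow'⟩, fun Kn z hz y hy => ?_⟩
  · rcases lt_or_ge 0 y.2.1 with hy | hy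
    · rw [cutoff_of_pos _ hy]
      exact (hsol Kn Kn.2).nonneg z hz y hy
    · rw [cutoff_of_nonpos _ hy]
  · have hs : state P (cutoff (f Kn z)) = state P (f Kn z) := by
      rw [state, state, density_cutoff, tempEq_cutoff]
    have hτ : 0 < P.τ (state P (f Kn z)) := P.τ_pos _
      ⟨hc.trans_le (hlow Kn Kn.2 z hz).1, hc.trans_le (hlow Kn Kn.2 z hz).2⟩
    have hK : (0 : ℝ) < Kn := Kn.2.1
    have h := (hsol Kn Kn.2).equation z hz y hy
    rw [gaussian_cutoff, hs]
    simp only [kinDeriv, cutoff_of_pos _ hy, h]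
    field_simp
    ring

end Solutions

/-! ### Residuals of the Navier–Stokes equations -/

section Residuals

variable {ι : Type*} {P : Params} {Ω : Set SpaceTime} {ε : ι → ℝ}

theorem dirDeriv_fun_add₃ {E : Type*} [NormedAddCommGroup E] [NormedSpace ℝ E] {a b c : E → ℝ}
    {z : E} (ha : DifferentiableAt ℝ a z) (hb : DifferentiableAt ℝ b z)
    (hc : DifferentiableAt ℝ c z) (w : E) : dirDeriv w (fun z => a z + b z + c z) z
      = dirDeriv w a z + dirDeriv w b z + dirDeriv w c z := by
  have hab : DifferentiableAt ℝ (fun z => a z + b z) z := ha.add hb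
  rw [dirDeriv_fun_add hab hc, dirDeriv_fun_add ha hb]

theorem IsOrder.divergence_sub (hΩ : IsOpen Ω) {n : ℕ} {A B : Fin 3 → ι → SpaceTime → ℝ}
    (hA : ∀ k, UnifSmooth Ω (A k)) (hB : ∀ k, UnifSmooth Ω (B k))
    (h : ∀ k, IsOrder Ω ε n fun i z => B k i z - A k i z) :
    IsOrder Ω ε n fun i z => ∑ k, dx k (B k i) z - ∑ k, dx k (A k i) z :=
  (IsOrder.sum hΩ (s := Finset.univ) fun k _ =>
    (h k).dirDeriv hΩ ((0 : ℝ), EuclideanSpace.single k (1 : ℝ))).congr fun i z hz => by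
      rw [← Finset.sum_sub_distrib]
      exact Finset.sum_congr rfl fun k _ => dirDeriv_fun_sub
        ((hB k).differentiableAt hΩ i hz) ((hA k).differentiableAt hΩ i hz) _

namespace MomentSystem

variable (m : MomentSystem P Ω ε)

include m

theorem smooth_param_family : UnifSmooth Ω fun i (_ : SpaceTime) => ε i := by
  obtain ⟨K, hK⟩ := m.ε_bdd
  exact UnifSmooth.const K hK

omit m in
theorem one_symm (j k : Fin 3) :
    (1 : Matrix (Fin 3) (Fin 3) ℝ) j k = (1 : Matrix (Fin 3) (Fin 3) ℝ) k j :=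
  congrFun₂ (Matrix.transpose_one (n := Fin 3) (α := ℝ)) k j

theorem visc_symm (j k : Fin 3) (i : ι) (z : SpaceTime) : m.visc j k i z = m.visc k j i z := by
  rw [visc, visc, one_symm j k, add_comm (dx k _ z)]

/-- Conservation of momentum. -/
theorem transport_momentum (i : ι) {z : SpaceTime} (hz : z ∈ Ω) (j : Fin 3) :
    transport (fun l => m.u l i) (fun z' => m.ρ i z' * m.u j i z') (fun l => m.S j l i) z = 0 := by
  rw [m.transport_density (m.smooth_u j) (m.smooth_S j) i hz]
  exact m.momentum i z hz j

/-- Specific total energy. -/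
noncomputable def specificEnergy (i : ι) (z : SpaceTime) : ℝ :=
  eTot P (m.T i z) + 1 / 2 * ∑ j, m.u j i z * m.u j i z

theorem smooth_specificEnergy : UnifSmooth Ω m.specificEnergy :=
  m.smooth_eTot.add m.isOpen ((UnifSmooth.sum m.isOpen fun j _ =>
    (m.smooth_u j).mul m.isOpen (m.smooth_u j)).const_mul m.isOpen _)

/-- The flux of energy relative to the mean flow. -/
noncomputable def energyFlux (l : Fin 3) (i : ι) (z : SpaceTime) : ℝ :=
  m.q l i z + ∑ j, m.S j l i z * m.u j i z

theorem smooth_energyFlux (l : Fin 3) : UnifSmooth Ω (m.energyFlux l) :=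
  (m.smooth_q l).add m.isOpen (UnifSmooth.sum m.isOpen fun j _ =>
    (m.smooth_S j l).mul m.isOpen (m.smooth_u j))

/-- Conservation of energy. -/
theorem transport_energy (i : ι) {z : SpaceTime} (hz : z ∈ Ω) :
    transport (fun l => m.u l i) (fun z' => m.ρ i z' * m.specificEnergy i z')
      (fun l => m.energyFlux l i) z = 0 := by
  have hΩ := m.isOpen
  have hu := fun j => (m.smooth_u j).differentiableAt hΩ i hz
  have hS := fun j l => (m.smooth_S j l).differentiableAt hΩ i hz
  have hq := fun l => (m.smooth_q l).differentiableAt hΩ i hz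
  have he := m.smooth_eTot.differentiableAt hΩ i hz
  have h1 : ∀ w, dirDeriv w (m.specificEnergy i) z = dirDeriv w (fun z' => eTot P (m.T i z')) z
      + ∑ j, m.u j i z * dirDeriv w (m.u j i) z := fun w => by
    have hs : ∀ j ∈ Finset.univ, DifferentiableAt ℝ (fun z' => m.u j i z' * m.u j i z') z :=
      fun j _ => (hu j).mul (hu j)
    have hsum : DifferentiableAt ℝ (fun z' => ∑ j, m.u j i z' * m.u j i z') z :=
      DifferentiableAt.fun_sum hs
    change dirDeriv w (fun z' => eTot P (m.T i z') + 1 / 2 * ∑ j, m.u j i z' * m.u j i z') z = _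
    rw [dirDeriv_fun_add he (hsum.const_mul _), dirDeriv_const_mul hsum, dirDeriv_fun_sum hs]
    simp only [dirDeriv_fun_mul (hu _) (hu _), Fin.sum_univ_three]
    ring
  have h2 : ∀ l w, dirDeriv w (m.energyFlux l i) z = dirDeriv w (m.q l i) z
      + ∑ j, (dirDeriv w (m.S j l i) z * m.u j i z + m.S j l i z * dirDeriv w (m.u j i) z) :=
    fun l w => by
      have hs : ∀ j ∈ Finset.univ, DifferentiableAt ℝ (fun z' => m.S j l i z' * m.u j i z') z :=
        fun j _ => (hS j l).mul (hu j)
      change dirDeriv w (fun z' => m.q l i z' + ∑ j, m.S j l i z' * m.u j i z') z = _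
      rw [dirDeriv_fun_add (hq l) (DifferentiableAt.fun_sum hs), dirDeriv_fun_sum hs]
      simp only [dirDeriv_fun_mul (hS _ l) (hu _)]
  have ht : dt (m.specificEnergy i) z = dt (fun z' => eTot P (m.T i z')) z
      + ∑ j, m.u j i z * dt (m.u j i) z := h1 _
  have hx : ∀ k, dx k (m.specificEnergy i) z = dx k (fun z' => eTot P (m.T i z')) z
      + ∑ j, m.u j i z * dx k (m.u j i) z := fun k => h1 _
  have hf : ∀ l, dx l (m.energyFlux l i) z = dx l (m.q l i) z
      + ∑ j, (dx l (m.S j l i) z * m.u j i z + m.S j l i z * dx l (m.u j i) z) := fun l => h2 l _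
  have hE := m.energy i z hz
  have hM := m.momentum i z hz
  have hM0 := hM 0
  have hM1 := hM 1
  have hM2 := hM 2
  rw [m.transport_density m.smooth_eTot m.smooth_q i hz] at hE
  rw [m.transport_density m.smooth_specificEnergy m.smooth_energyFlux i hz]
  simp only [materialDeriv, ht, hx, hf, Fin.sum_univ_three] at hE hM0 hM1 hM2 ⊢
  linear_combination hE + m.u 0 i z * hM0 + m.u 1 i z * hM1 + m.u 2 i z * hM2

variable {v : ι → SpaceTime → Vec}

theorem nsStress_eq (hv : ∀ i z j, v i z j = m.u j i z) (j k : Fin 3) (i : ι) (z : SpaceTime) :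
    nsStress P (m.ρ i) (m.T i) (v i) z j k = m.visc j k i z := by
  simp only [nsStress, visc, divergence, divu, hv]

theorem massResidual_eq_zero (hv : ∀ i z j, v i z j = m.u j i z) (i : ι) {z : SpaceTime}
    (hz : z ∈ Ω) : massResidual (m.ρ i) (v i) z = 0 := by
  simp only [massResidual, divergence, hv]
  rw [← m.mass i z hz]
  simp only [mul_comm]

/-- The residual is the divergence of the `O(ε²)` remainder of the stress. Since `IsOrder` includes
all derivatives, the divergence is again `O(ε²)`. -/
theorem order_momentumResidual (hv : ∀ i z j, v i z j = m.u j i z) (j : Fin 3) :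
    IsOrder Ω ε 2 fun i z => momentumResidual P (ε i) (m.ρ i) (m.T i) (v i) j z := by
  have hΩ := m.isOpen
  have hρu := m.smooth_ρ.mul hΩ (m.smooth_u j)
  have h1 := fun k => hρu.mul hΩ (m.smooth_u k)
  have h2 := fun k => m.smooth_press.mul hΩ
    (UnifSmooth.const' ((1 : Matrix (Fin 3) (Fin 3) ℝ) j k))
  have h3 := fun k => m.smooth_param_family.mul hΩ (m.smooth_visc j k)
  have hA := fun k => ((m.smooth_u k).mul hΩ hρu).add hΩ (m.smooth_S j k)
  refine (IsOrder.divergence_sub hΩ hA (fun k => ((h1 k).add hΩ (h2 k)).add hΩ (h3 k))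
    fun k => ((m.order_stress_two j k).neg hΩ).congr fun i z _ => by ring).congr fun i z hz => ?_
  have d1 := fun k => (h1 k).differentiableAt hΩ i hz
  have d2 := fun k => (h2 k).differentiableAt hΩ i hz
  have d3 := fun k => (h3 k).differentiableAt hΩ i hz
  have hB : ∀ k, dx k (fun z' => m.ρ i z' * m.u j i z' * m.u k i z'
      + m.press i z' * (1 : Matrix (Fin 3) (Fin 3) ℝ) j k + ε i * m.visc j k i z') z
      = dx k (fun z' => m.ρ i z' * m.u j i z' * m.u k i z') z
        + dx k (m.press i) z * (1 : Matrix (Fin 3) (Fin 3) ℝ) j k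
        + dx k (fun z' => ε i * m.visc j k i z') z := fun k => by
    refine (dirDeriv_fun_add₃ (d1 k) (d2 k) (d3 k) _).trans ?_
    rw [dirDeriv_fun_mul (m.smooth_press.differentiableAt hΩ i hz) (differentiableAt_const _)]
    simp [dirDeriv, dx]
  have hp : ∑ k, dx k (m.press i) z * (1 : Matrix (Fin 3) (Fin 3) ℝ) j k = dx j (m.press i) z := by
    simp [Matrix.one_apply]
  have hc := m.transport_momentum i hz j
  rw [transport] at hc
  simp only [hB, Finset.sum_add_distrib, hp]
  simp only [momentumResidual, m.nsStress_eq hv, divergence, hv, pressure]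
  change _ = _ + _ + dx j (m.press i) z + _
  linear_combination -hc

/-- The residual is the divergence of the `O(ε²)` remainder of `q + Σ u`. -/
theorem order_energyResidual (hv : ∀ i z j, v i z j = m.u j i z) {𝓔 : ι → SpaceTime → ℝ}
    (hE : ∀ i, ∀ z ∈ Ω, 𝓔 i z = m.ρ i z * m.specificEnergy i z) :
    IsOrder Ω ε 2 fun i z => energyResidual P (ε i) (m.ρ i) (m.T i) (𝓔 i) (v i) z := by
  have hΩ := m.isOpen
  have hρe := m.smooth_ρ.mul hΩ m.smooth_specificEnergy
  have hE' : UnifSmooth Ω 𝓔 := hρe.congr hΩ fun i z hz => (hE i z hz).symm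
  have h1 := fun k => (hE'.add hΩ m.smooth_press).mul hΩ (m.smooth_u k)
  have h2 := fun k => m.smooth_param_family.mul hΩ (m.smooth_fourier k)
  have h3 := fun k => m.smooth_param_family.mul hΩ (UnifSmooth.sum hΩ (s := Finset.univ)
    fun j _ => (m.smooth_visc k j).mul hΩ (m.smooth_u j))
  have hA := fun k => ((m.smooth_u k).mul hΩ hρe).add hΩ (m.smooth_energyFlux k)
  refine (IsOrder.divergence_sub hΩ hA (fun k => ((h1 k).add hΩ (h2 k)).add hΩ (h3 k))
    fun k => (((m.order_q_two k).add hΩ (IsOrder.sum hΩ (s := Finset.univ) fun j _ =>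
      (m.order_stress_two j k).mul_left hΩ (m.smooth_u j))).neg hΩ).congr
        fun i z hz => ?_).congr fun i z hz => ?_
  · rw [hE i z hz, energyFlux]
    simp only [m.visc_symm k]
    have hp : ∑ j, m.u j i z * (m.press i z * (1 : Matrix (Fin 3) (Fin 3) ℝ) j k)
        = m.press i z * m.u k i z := by
      simp [Matrix.one_apply, mul_comm]
    simp only [mul_sub, mul_add, Finset.sum_sub_distrib, Finset.sum_add_distrib, hp,
      Finset.mul_sum]
    simp only [Fin.sum_univ_three]
    ring
  · have d1 := fun k => (h1 k).differentiableAt hΩ i hz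
    have d2 := fun k => (h2 k).differentiableAt hΩ i hz
    have d3 := fun k => (h3 k).differentiableAt hΩ i hz
    have hB := fun k => dirDeriv_fun_add₃ (d1 k) (d2 k) (d3 k)
      ((0 : ℝ), EuclideanSpace.single k (1 : ℝ))
    have hc := m.transport_energy i hz
    have ht : dt (𝓔 i) z = dt (fun z' => m.ρ i z' * m.specificEnergy i z') z :=
      dirDeriv_congr hΩ (hE i) _ z hz
    rw [transport, ← ht] at hc
    simp only [energyResidual, m.nsStress_eq hv, divergence, hv, pressure, nsHeatFlux]
    rw [← sub_eq_zero]
    rw [← sub_eq_zero] at hc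
    have hs := Finset.sum_congr (s₁ := Finset.univ) rfl fun k _ => hB k
    rw [Finset.sum_add_distrib, Finset.sum_add_distrib] at hs
    refine Eq.trans (congrArg (fun x => x - _ - _) hs) ?_
    refine Eq.trans ?_ (congrArg Neg.neg hc |>.trans neg_zero)
    simp only [dx, dirDeriv, press]
    ring

end MomentSystem

end Residuals

/-! ### Uniform bounds and the Prandtl number -/

theorem IsDistribution.totalEnergy_eq {P : Params} {g : Micro → ℝ} (d : IsDistribution g) :
    totalEnergy P g = density g * (eTot P (tempEq P g)
      + 1 / 2 * ∑ j, velocity g j * velocity g j) := by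
  have hc : PolyBdd fun _ => -(1 / 2 * ∑ j, velocity g j * velocity g j) := PolyBdd.const _
  have hu : ∀ j ∈ Finset.univ, PolyBdd fun y => velocity g j * y.1 j := fun j _ =>
    (PolyBdd.velocity j).const_mul _
  have e : (fun y : Micro => (1 / 2 * ‖y.1‖ ^ 2 + y.2.1 + (y.2.2 : ℝ) * P.R * P.T₀) * g y)
      = fun y => (peculiarEnergy P (velocity g) y + (∑ j, velocity g j * y.1 j
        + -(1 / 2 * ∑ j, velocity g j * velocity g j))) * g y := by
    funext y
    rw [peculiarEnergy, norm_sub_sq, norm_sq_eq_sum]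
    simp only [Fin.sum_univ_three]
    ring
  have hE : bracket (fun y => peculiarEnergy P (velocity g) y * g y)
      = density g * energyInt P g := (mul_div_cancel₀ _ d.density_pos.ne').symm
  rw [totalEnergy, e, d.bracket_add (polyBdd_peculiarEnergy P _) ((PolyBdd.sum hu).add hc),
    d.bracket_add (PolyBdd.sum hu) hc, d.bracket_sum hu, bracket_const_mul, hE, d.eTot_tempEq]
  simp only [bracket_const_mul_mul, d.bracket_velocity, Fin.sum_univ_three]
  rw [← density]
  ring

theorem IsOrder.eventually_bound {ι E : Type*} [NormedAddCommGroup E] [NormedSpace ℝ E]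
    {Ω : Set E} {ε : ι → ℝ} {n : ℕ} {a : ι → E → ℝ} (ha : IsOrder Ω ε n a) :
    ∀ᶠ C in Filter.atTop, ∀ i, ∀ z ∈ Ω, |a i z| ≤ C * |ε i| ^ n := by
  obtain ⟨C, hC⟩ := ha.bound
  filter_upwards [Filter.eventually_ge_atTop C] with D hD i z hz
  exact (hC i z hz).trans (by gcongr)

theorem prandtl_eq (P : Params) {r T : ℝ} (hr : 0 < r) (hT : 0 < T) :
    prandtl P r T = 1 / (1 - (1 - P.Γ (r, T)) * (1 - P.θ (r, T)) * P.ν (r, T)) := by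
  have hs : (r, T) ∈ Set.Ioi (0 : ℝ) ×ˢ Set.Ioi (0 : ℝ) := ⟨hr, hT⟩
  have hb : 0 < 1 - (1 - P.Γ (r, T)) * (1 - P.θ (r, T)) * P.ν (r, T) := relStress_pos hs
  have hR := P.R_pos
  have hτ := P.τ_pos _ hs
  have hμ : 0 < viscosity P r T := by
    rw [viscosity, pressure]
    positivity
  have hcp : 0 < cp P T := by
    have := cv_pos P hT
    rw [cp_eq P hT]
    positivity
  rw [prandtl, conductivity, mul_assoc, div_mul_cancel_right₀ (mul_pos hμ hcp).ne', one_div]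

end ESBGK

theorem proposition4 (P : ESBGK.Params) (Kn₀ : ℝ) (Ω : Set SpaceTime) (hΩ : IsOpen Ω)
    (f : ℝ → SpaceTime → Micro → ℝ)
    (hsol : ∀ Kn ∈ Set.Ioo 0 Kn₀, IsSolution P Kn Ω (f Kn))
    (hbound : IsBoundedFamily Kn₀ Ω f)
    (hnondeg : IsNondegenerateFamily P Kn₀ Ω f) :
    -- the macroscopic fields are smooth
    (∀ Kn ∈ Set.Ioo 0 Kn₀,
      ContDiffOn ℝ ∞ (fun z => density (f Kn z)) Ω ∧
      ContDiffOn ℝ ∞ (fun z => velocity (f Kn z)) Ω ∧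
      ContDiffOn ℝ ∞ (fun z => tempEq P (f Kn z)) Ω ∧
      ContDiffOn ℝ ∞ (fun z => totalEnergy P (f Kn z)) Ω) ∧
    -- second order expansion of the fluxes, and the Navier–Stokes equations up to `O(Kn²)`
    (∃ C : ℝ, ∀ Kn ∈ Set.Ioo 0 Kn₀, ∀ z ∈ Ω,
      (∀ j k : Fin 3,
        |stress (f Kn z) j k
          - (pressure P (density (f Kn z)) (tempEq P (f Kn z))
              * (1 : Matrix (Fin 3) (Fin 3) ℝ) j k
            + Kn * nsStress P (fun z' => density (f Kn z')) (fun z' => tempEq P (f Kn z'))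
                (fun z' => velocity (f Kn z')) z j k)| ≤ C * Kn ^ 2) ∧
      (∀ j : Fin 3,
        |heatFlux P (f Kn z) j
          - Kn * nsHeatFlux P (fun z' => density (f Kn z')) (fun z' => tempEq P (f Kn z')) z j|
            ≤ C * Kn ^ 2) ∧
      |massResidual (fun z' => density (f Kn z')) (fun z' => velocity (f Kn z')) z|
        ≤ C * Kn ^ 2 ∧
      (∀ j : Fin 3,
        |momentumResidual P Kn (fun z' => density (f Kn z')) (fun z' => tempEq P (f Kn z'))
          (fun z' => velocity (f Kn z')) j z| ≤ C * Kn ^ 2) ∧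
      |energyResidual P Kn (fun z' => density (f Kn z')) (fun z' => tempEq P (f Kn z'))
        (fun z' => totalEnergy P (f Kn z')) (fun z' => velocity (f Kn z')) z| ≤ C * Kn ^ 2) ∧
    -- the Prandtl number
    (∀ r T : ℝ, 0 < r → 0 < T →
      prandtl P r T = 1 / (1 - (1 - P.Γ (r, T)) * (1 - P.θ (r, T)) * P.ν (r, T))) := by
  have K := kineticFamily_cutoff hΩ hsol hbound hnondeg
  have hE : ∀ (Kn : Set.Ioo (0 : ℝ) Kn₀), ∀ z ∈ Ω, totalEnergy P (cutoff (f Kn z))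
      = K.momentSystem.ρ Kn z * K.momentSystem.specificEnergy Kn z := fun Kn z hz =>
    (K.isDistribution Kn z hz).totalEnergy_eq
  have hv : ∀ (Kn : Set.Ioo (0 : ℝ) Kn₀) (z : SpaceTime) (j : Fin 3),
      velocity (cutoff (f Kn z)) j = K.momentSystem.u j Kn z := fun _ _ _ => rfl
  refine ⟨fun Kn hKn => ?_, ?_, fun r T hr hT => prandtl_eq P hr hT⟩
  · have h1 := K.smooth_density.smooth ⟨Kn, hKn⟩
    have h2 : ContDiffOn ℝ ∞ (fun z => velocity (cutoff (f Kn z))) Ω :=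
      contDiffOn_euclidean.2 fun j => (K.smooth_flow j).smooth ⟨Kn, hKn⟩
    have h3 := K.smooth_tempEq.smooth ⟨Kn, hKn⟩
    have h4 : ContDiffOn ℝ ∞ (fun z => totalEnergy P (cutoff (f Kn z))) Ω :=
      ((K.momentSystem.smooth_ρ.mul hΩ K.momentSystem.smooth_specificEnergy).smooth
        ⟨Kn, hKn⟩).congr fun z hz => hE ⟨Kn, hKn⟩ z hz
    simp only [density_cutoff, velocity_cutoff, tempEq_cutoff, totalEnergy_cutoff] at h1 h2 h3 h4
    exact ⟨h1, h2, h3, h4⟩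
  · have hS := Filter.eventually_all.2 fun j => Filter.eventually_all.2 fun k =>
      (K.momentSystem.order_stress_two j k).eventually_bound
    have hq := Filter.eventually_all.2 fun j => (K.momentSystem.order_q_two j).eventually_bound
    have hM := Filter.eventually_all.2 fun j =>
      (K.momentSystem.order_momentumResidual hv j).eventually_bound
    have hN := (K.momentSystem.order_energyResidual hv hE).eventually_bound
    obtain ⟨C, hC, hS, hq, hM, hN⟩ :=
      ((Filter.eventually_ge_atTop (0 : ℝ)).and (hS.and (hq.and (hM.and hN)))).exists
    refine ⟨C, fun Kn hKn z hz => ?_⟩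
    have habs : |Kn| = Kn := abs_of_pos hKn.1
    have hm := K.momentSystem.massResidual_eq_zero hv ⟨Kn, hKn⟩ hz
    have hS' := fun j k => hS j k ⟨Kn, hKn⟩ z hz
    have hq' := fun j => hq j ⟨Kn, hKn⟩ z hz
    have hM' := fun j => hM j ⟨Kn, hKn⟩ z hz
    have hN' := hN ⟨Kn, hKn⟩ z hz
    simp only [habs, ← K.momentSystem.nsStress_eq hv] at hS' hq' hM' hN'
    simp only [KineticFamily.momentSystem, MomentSystem.press, ← stress_eq_avg,
      ← heatFlux_eq_avg, density_cutoff, velocity_cutoff, tempEq_cutoff, totalEnergy_cutoff,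
      stress_cutoff, heatFlux_cutoff] at hm hS' hq' hM' hN'
    refine ⟨hS', hq', ?_, hM', hN'⟩
    rw [hm, abs_zero]
    positivity
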